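/- **Theorem (worst-case upper bound for TS-EBA).** *Model.* Let $K\ge 2$, let $\mathcal Y\subset\mathbb R$ be a Borel set, let $\Theta=[\theta_1,\theta_2]$ with $\theta_1<\theta_2$, and for each arm $a\in[K]=\{1,\dots,K\}$ let $\sigma_a^2:\Theta\to(0,\infty)$ be continuous. For each $a$ let $(P_{a,\mu})_{\mu\in\Theta}$ be probability distributions on $\mathcal Y$ having, for all $\mu$, Lebesgue densities (or, for countable $\mathcal Y$, for all $\mu$, probability mass functions) $f_a(\cdot\mid\mu)$ that are positive on $\mathcal Y$, such that for every $\mu\in\Theta$: $P_{a,\mu}$ has mean $\mu$, variance $\sigma_a^2(\mu)$ and a finite third absolute moment; for each $y\in\mathcal Y$ the log-likelihood $\ell(\cdot\mid y)=\log f_a(y\mid\cdot)$ is three times differentiable on $\Theta$ (one-sidedly at the end points); $\mathbb E_{P_{a,\mu}}[\dot\ell(\mu)]=0$, the Fisher information is $\mathbb E_{P_{a,\mu}}[\dot\ell(\mu)^2]=1/\sigma_a^2(\mu)$, and $\mathbb E_{P_{a,\mu}}[\ddot\ell(\mu)]=-1/\sigma_a^2(\mu)$; and there are a neighbourhood $U$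 of $\mu$ and a function $u\ge0$ with $\mathbb E_{P_{a,\mu}}[u(Y)]<\infty$ and $|\ddot\ell(\tau\mid y)|\le u(y)$ for all $\tau\in U\cap\Theta$, $y\in\mathcal Y$. For $\boldsymbol\mu\in\Theta^K$ the vectors of potential outcomes $(Y_{1,t},\dots,Y_{K,t})$, $t=1,\dots,T$, are i.i.d. with an arbitrary joint law whose $a$-th marginal is $P_{a,\mu_a}$; if arm $A_t$ is allocated in round $t$, only $Y_t=Y_{A_t,t}$ is observed. *TS-EBA experiment* with horizon $T$ and split ratio $r\in(0,1)$. Put $n=\lfloor rT/K\rfloor$. 1. Pilot: allocate every arm $n$ times. Let $\widehat\mu_a$ be the pilot sample means, $\widehat\sigma_a^2$ the pilot sample variances (with divisor $n-1$), $\widehat v=\sqrt{\log(T)/n}\,\max_b\widehat\sigma_b$, and $$\widehat{\mathcal S}=\{a:\widehat\mu_a+\widehat v\ge\max_b(\widehat\mu_b-\widehat v)\}.$$ If $|\widehat{\mathcal S}|=1$, stop and recommend the unique element of $\widehat{\mathcal S}$. 2. Otherwise, for $a\in\widehat{\mathcal S}$ let $\widehat w_a=\widehat\sigma_a/\sum_{b\in\widehat{\mathcal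 S}}\widehat\sigma_b$ if $|\widehat{\mathcal S}|=2$ and $\widehat w_a=\widehat\sigma_a^2/\sum_{b\in\widehat{\mathcal S}}\widehat\sigma_b^2$ if $|\widehat{\mathcal S}|\ge3$ (and $\widehat w_a=1/|\widehat{\mathcal S}|$ if the denominator is $0$), and $$\widehat\pi_a=\max\Big\{\widehat w_a\Big(1-\big(K-|\widehat{\mathcal S}|\big)\frac rK\Big)-\frac rK,\;0\Big\},$$ with $\widehat\pi_a=0$ for $a\notin\widehat{\mathcal S}$. In each of the remaining $T-Kn$ rounds, independently given the pilot, allocate arm $a$ with probability $\widehat\pi_a/\sum_b\widehat\pi_b$. 3. Recommend an arm $\widehat a_T\in[K]$ with the largest sample mean over all its observations from both stages, ties being broken by any fixed measurable rule. Let $\mathrm{Regret}_{\boldsymbol\mu}=\mathbb E_{\boldsymbol\mu}\big[\max_a\mu_a-\mu_{\widehat a_T}\big]$. *Conclusion.* - If $K=2$ and $\dfrac rK\le\min_a\dfrac{\sigma_a(\mu)}{\sigma_1(\mu)+\sigma_2(\mu)}$ for all $\mu\in\Theta$, then $$\limsup_{T\to\infty}\ \sup_{\boldsymbol\mu\in\Theta^K}\sqrt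 T\,\mathrm{Regret}_{\boldsymbol\mu}\le\frac1{\sqrt e}\,\sup_{\mu\in\Theta}\big(\sigma_1(\mu)+\sigma_2(\mu)\big).$$ - If $K\ge3$ and $\dfrac rK\le\min_a\dfrac{\sigma_a^2(\mu)}{\sum_{b\in[K]}\sigma_b^2(\mu)}$ for all $\mu\in\Theta$, then $$\limsup_{T\to\infty}\ \sup_{\boldsymbol\mu\in\Theta^K}\sqrt T\,\mathrm{Regret}_{\boldsymbol\mu}\le2\Big(1+\frac{K-1}K\Big)\sup_{\mu\in\Theta}\sqrt{\sum_{a\in[K]}\sigma_a^2(\mu)\,\log K}.$$ -/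

import Mathlib

open Set Filter Topology MeasureTheory

namespace TSEBA

noncomputable section

/-! ### Parametric outcome models -/

/-- The log-likelihood `ℓ(m ∣ y) = log f(y ∣ m)` as a function of the parameter `m`. -/
def logLik (f : ℝ → ℝ → ℝ) (y : ℝ) : ℝ → ℝ := fun m => Real.log (f m y)

/-- The `k`-th derivative of the log-likelihood in the parameter, at `m` in the parameter
interval `[θ₁, θ₂]` (one-sided at the end points). -/
def logLikDeriv (θ₁ θ₂ : ℝ) (f : ℝ → ℝ → ℝ) (k : ℕ) (m y : ℝ) : ℝ :=
  iteratedDerivWithin k (logLik f y) (Icc θ₁ θ₂) m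

/-- `P m`, `m ∈ [θ₁, θ₂]`, is a family of distributions on the outcome space `𝒴`, parametrised by
its mean, with variance function `v` and densities (or mass functions) `f m`, satisfying the
likelihood regularity conditions. -/
structure IsRegularFamily (𝒴 : Set ℝ) (θ₁ θ₂ : ℝ) (v : ℝ → ℝ) (P : ℝ → Measure ℝ)
    (f : ℝ → ℝ → ℝ) : Prop where
  prob : ∀ m ∈ Icc θ₁ θ₂, IsProbabilityMeasure (P m)
  measurable_density : ∀ m ∈ Icc θ₁ θ₂, Measurable (f m)
  /-- `f m` is a probability density function on `𝒴` for all `m`,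
  or a probability mass function on (countable) `𝒴` for all `m`. -/
  density :
    (∀ m ∈ Icc θ₁ θ₂,
      P m = (volume.restrict 𝒴).withDensity (fun y => ENNReal.ofReal (f m y))) ∨
    (𝒴.Countable ∧ ∀ m ∈ Icc θ₁ θ₂,
      P m = (Measure.count.restrict 𝒴).withDensity (fun y => ENNReal.ofReal (f m y)))
  density_pos : ∀ m ∈ Icc θ₁ θ₂, ∀ y ∈ 𝒴, 0 < f m y
  third_moment : ∀ m ∈ Icc θ₁ θ₂, MemLp (fun y : ℝ => y) 3 (P m)
  mean : ∀ m ∈ Icc θ₁ θ₂, ∫ y, y ∂(P m) = m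
  variance : ∀ m ∈ Icc θ₁ θ₂, ∫ y, (y - m) ^ 2 ∂(P m) = v m
  /-- The log-likelihood is three times differentiable in the parameter. -/
  differentiable : ∀ y ∈ 𝒴, ∀ k < 3,
    DifferentiableOn ℝ (fun m => logLikDeriv θ₁ θ₂ f k m y) (Icc θ₁ θ₂)
  score_mean : ∀ m ∈ Icc θ₁ θ₂,
    Integrable (logLikDeriv θ₁ θ₂ f 1 m) (P m) ∧ ∫ y, logLikDeriv θ₁ θ₂ f 1 m y ∂(P m) = 0
  /-- The Fisher information exists and equals the inverse of the variance. -/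
  fisher : ∀ m ∈ Icc θ₁ θ₂,
    Integrable (fun y => (logLikDeriv θ₁ θ₂ f 1 m y) ^ 2) (P m) ∧
      ∫ y, (logLikDeriv θ₁ θ₂ f 1 m y) ^ 2 ∂(P m) = 1 / v m
  second_deriv_mean : ∀ m ∈ Icc θ₁ θ₂,
    Integrable (logLikDeriv θ₁ θ₂ f 2 m) (P m) ∧
      ∫ y, logLikDeriv θ₁ θ₂ f 2 m y ∂(P m) = -(1 / v m)
  second_deriv_dominated : ∀ m ∈ Icc θ₁ θ₂, ∃ U ∈ 𝓝 m, ∃ u : ℝ → ℝ,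
    (∀ y, 0 ≤ u y) ∧ Integrable u (P m) ∧
      ∀ τ ∈ U ∩ Icc θ₁ θ₂, ∀ y ∈ 𝒴, |logLikDeriv θ₁ θ₂ f 2 τ y| ≤ u y

/-- The bandit model: for every arm `a`, `P a` is a regular mean-parametrised family on `𝒴` over
`[θ₁, θ₂]`, whose variance function `v a` is continuous and positive. -/
def IsBanditModel {K : ℕ} (𝒴 : Set ℝ) (θ₁ θ₂ : ℝ) (v : Fin K → ℝ → ℝ)
    (P : Fin K → ℝ → Measure ℝ) : Prop :=
  ∀ a, ContinuousOn (v a) (Icc θ₁ θ₂) ∧ (∀ m ∈ Icc θ₁ θ₂, 0 < v a m) ∧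
    ∃ f, IsRegularFamily 𝒴 θ₁ θ₂ (v a) (P a) f

/-! ### The two-stage experiment -/

/-- Number of pilot rounds per arm, `r T / K` (rounded down when it is not an integer). -/
def pilotSize (K : ℕ) (r : ℝ) (T : ℕ) : ℕ := ⌊r * T / K⌋₊

/-- Sample mean of arm `a` in the pilot; `z a i` is the `i`-th pilot observation of arm `a`. -/
def pilotMean {K n : ℕ} (z : Fin K → Fin n → ℝ) (a : Fin K) : ℝ := (∑ i, z a i) / n

/-- Unbiased sample variance of arm `a` in the pilot. -/
def pilotVar {K n : ℕ} (z : Fin K → Fin n → ℝ) (a : Fin K) : ℝ :=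
  (∑ i, (z a i - pilotMean z a) ^ 2) / ((n : ℝ) - 1)

/-- Half-width of the confidence intervals after the pilot. -/
def radius {K n : ℕ} (T : ℕ) (z : Fin K → Fin n → ℝ) : ℝ :=
  √(Real.log T / n) * ⨆ b, √(pilotVar z b)

open Classical in
/-- The arms whose upper confidence bound is at least the largest lower confidence bound. -/
def candidates {K n : ℕ} (T : ℕ) (z : Fin K → Fin n → ℝ) : Finset (Fin K) :=
  Finset.univ.filter fun a =>
    (⨆ b, (pilotMean z b - radius T z)) ≤ pilotMean z a + radius T z

/-- Estimated standard deviation if two candidates remain, estimated variance otherwise. -/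
def spread {K n : ℕ} (T : ℕ) (z : Fin K → Fin n → ℝ) (a : Fin K) : ℝ :=
  if (candidates T z).card = 2 then √(pilotVar z a) else pilotVar z a

open Classical in
/-- Estimated ideal allocation ratio among the candidates
(uniform in the degenerate case that all their sample variances vanish). -/
def idealRatio {K n : ℕ} (T : ℕ) (z : Fin K → Fin n → ℝ) (a : Fin K) : ℝ :=
  if a ∈ candidates T z then
    if ∑ b ∈ candidates T z, spread T z b = 0 then 1 / ((candidates T z).card : ℝ)
    else spread T z a / ∑ b ∈ candidates T z, spread T z b
  else 0

/-- Unnormalised second-stage weight of arm `a`: the part of its ideal share that the pilot has not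
yet covered. The candidates receive the fraction `1 - (K - |Ŝ|) r / K` of all `T` rounds, since the
eliminated arms have used `r / K` each; the fraction is `1` if no arm has been eliminated. -/
def allocWeight {K n : ℕ} (r : ℝ) (T : ℕ) (z : Fin K → Fin n → ℝ) (a : Fin K) : ℝ :=
  max (idealRatio T z a * (1 - ((K : ℝ) - (candidates T z).card) * (r / K)) - r / K) 0

/-- Second-stage allocation probability of arm `a`. -/
def allocProb {K n : ℕ} (r : ℝ) (T : ℕ) (z : Fin K → Fin n → ℝ) (a : Fin K) : ℝ :=
  allocWeight r T z a / ∑ b, allocWeight r T z b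

/-- Law of the arm drawn in one round of the second stage, given the pilot observations. -/
def armLaw {K n : ℕ} (r : ℝ) (T : ℕ) (z : Fin K → Fin n → ℝ) : Measure (Fin K) :=
  ∑ a, ENNReal.ofReal (allocProb r T z a) • Measure.dirac a

/-- Sample mean of arm `a` over both stages; in second-stage round `t` the arm `(w t).1` is drawn,
the potential outcomes are `(w t).2`, and only the outcome of the drawn arm is observed. -/
def sampleMean {K n N : ℕ} (z : Fin K → Fin n → ℝ) (w : Fin N → Fin K × (Fin K → ℝ))
    (a : Fin K) : ℝ :=
  ((∑ i, z a i) + ∑ t, if (w t).1 = a then (w t).2 (w t).1 else 0) /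
    ((n : ℝ) + ∑ t, if (w t).1 = a then 1 else 0)

open Classical in
/-- The recommended arm: the only candidate if there is just one, and otherwise an arm with the
largest sample mean, ties being broken by `sel`. -/
def recommend {K n N : ℕ} (sel : (Fin K → ℝ) → Fin K) (T : ℕ) (z : Fin K → Fin n → ℝ)
    (w : Fin N → Fin K × (Fin K → ℝ)) : Fin K :=
  if h : ∃ a, candidates T z = {a} then h.choose else sel (sampleMean z w)

/-- The pilot observations: round `(a, i)` of the pilot is the `i`-th round in which arm `a` is
allocated, `y (a, i)` is the vector of potential outcomes in that round. -/
def pilotObs {K n : ℕ} (y : Fin K × Fin n → Fin K → ℝ) : Fin K → Fin n → ℝ :=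
  fun a i => y (a, i) a

/-- Probability that the experiment with horizon `T` recommends arm `b`, when the vectors of
potential outcomes in the `T` rounds are i.i.d. with law `Q`: the pilot rounds are drawn from `Q`;
given the pilot, in each of the remaining rounds an arm is drawn from `armLaw` and, independently,
a vector of potential outcomes from `Q`. -/
def recommendProb {K : ℕ} (r : ℝ) (sel : (Fin K → ℝ) → Fin K) (T : ℕ)
    (Q : Measure (Fin K → ℝ)) (b : Fin K) : ENNReal :=
  ∫⁻ y : Fin K × Fin (pilotSize K r T) → Fin K → ℝ,
    (Measure.pi fun _ : Fin (T - K * pilotSize K r T) => (armLaw r T (pilotObs y)).prod Q)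
      {w | recommend sel T (pilotObs y) w = b}
    ∂(Measure.pi fun _ => Q)

/-- The (expected) simple regret `𝔼[max_a μ_a - μ_â]` of the experiment. -/
def regret {K : ℕ} (r : ℝ) (sel : (Fin K → ℝ) → Fin K) (T : ℕ)
    (Q : Measure (Fin K → ℝ)) (μ : Fin K → ℝ) : ℝ :=
  ∑ b, ((⨆ a, μ a) - μ b) * (recommendProb r sel T Q b).toReal

/-- `limsup` over `T` of the worst case over `μ ∈ [θ₁, θ₂]^K` of `√T` times the regret. -/
def worstCaseLimsup {K : ℕ} (r : ℝ) (sel : (Fin K → ℝ) → Fin K) (θ₁ θ₂ : ℝ)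
    (Q : (Fin K → ℝ) → Measure (Fin K → ℝ)) : EReal :=
  limsup (fun T : ℕ => ⨆ μ ∈ Set.univ.pi (fun _ : Fin K => Icc θ₁ θ₂),
    ((√(T : ℝ) * regret r sel T (Q μ) μ : ℝ) : EReal)) atTop

end

end TSEBA

/-!
The worst-case bound for the two-stage experiment is proved without a central limit theorem.

The comparison is made through a tangent to an exponential. If `t ≤ β + γ * exp (l * t)` for all
`t`, the mean of `√T * (μ star - μ b)`, for a recommended arm `b`, is bounded by exponential moments
of the difference of the noise in the sample means of `b` and of the best arm `star`, since `b` is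
recommended only if this difference exceeds the gap. For truncated observations such exponential
moments are Gaussian up to factors tending to one, uniformly in `μ` (`integral_exp_sum_pi_le`).

*Uniformity.* The densities are continuous in the parameter, so by Fatou's lemma, continuity of the
variance and compactness of the parameter interval the squared centred outcomes are uniformly
integrable (`IsRegularFamily.exists_tail_le`). Nothing else is used of the likelihood conditions;
they are summarised in `IsUniformModel`, and the error of truncation is small in mean square.

*Reduction to a fixed pilot.* By `sqrt_mul_regret_le` it suffices to bound the conditional mean of
the scaled loss for each pilot. If the pilot noise is of order `√T` and the sample variances are
accurate (typical pilots), the best arm survives, all survivors have nearly the same mean and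
hence, by continuity, variances close to those at the best mean, and the final frequency of every
survivor is close to its ideal share (`meanLE_of_typical`). An arm that has been eliminated can be
recommended only if the noise is of larger order. The other pilots are rare enough for a crude
bound (`le_untypicalBound`, `meanLE_untypicalBound`).

*Exponential moments.* For two survivors `b` and `star` with variances `s b`, `s star` the variance
of the difference of the sample means, scaled by `T`, is `(√(s b) + √(s star)) ^ 2` divided by the
fraction of rounds they receive, which is at most `2 * ∑ a, s a` under the assumption on the split
ratio (`pair_variance_le`). For three or more survivors all variances of the sample means have the
common value `ratio`, which depends on the random set of survivors only through one number between
`0` and `∑ a, s a`. Hence the exponential of the pilot part is dominated by its value for the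
largest possible factor plus a constant (`exp_le_manyTerm`), so that no sum over sets of survivors
is needed and only the `K - 1` suboptimal arms are summed.

*Conclusion.* `eventually_sqrt_mul_regret_le` bounds the limit by `β + γ * D`, where `D` bounds the
sum of the exponential moments. For two arms, `β = 0` and `l` inverse to the largest value `F` of
`σ₁ + σ₂` give `F * exp (-1) * exp (1 / 2)`. For `K ≥ 3`, with `V` the largest sum of the variances,
`l = 5 / 4 * √(log K / V)` and the tangent at the point where the exponential equals
`3 * (K - 1) * exp (5 / 4 * l ^ 2 * V)` give at most `10 / 3 * √(V * log K)`, and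
`10 / 3 ≤ 2 * (1 + (K - 1) / K)`.
-/

namespace TSEBA

/-! ### Sums of independent centred variables -/

section Product

variable {ι X : Type*} [Fintype ι] [MeasurableSpace X] {ν : Measure X} [IsProbabilityMeasure ν]

lemma memLp_sum_pi {h : ι → X → ℝ} (hm : ∀ i, MemLp (h i) 2 ν) :
    MemLp (fun ω : ι → X => ∑ i, h i (ω i)) 2 (Measure.pi fun _ : ι => ν) :=
  memLp_finsetSum _ fun i _ =>
    (hm i).comp_measurePreserving (measurePreserving_eval (fun _ : ι => ν) i)

lemma integral_sum_sq_pi {h : ι → X → ℝ} (hm : ∀ i, MemLp (h i) 2 ν) (h0 : ∀ i, ∫ x, h i x ∂ν = 0) :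
    ∫ ω : ι → X, (∑ i, h i (ω i)) ^ 2 ∂(Measure.pi fun _ : ι => ν) = ∑ i, ∫ x, h i x ^ 2 ∂ν := by
  have hsum : ∫ ω : ι → X, ∑ i, h i (ω i) ∂(Measure.pi fun _ : ι => ν) = 0 := by
    rw [integral_finsetSum]
    · refine Finset.sum_eq_zero fun i _ => ?_
      rw [integral_comp_eval (μ := fun _ : ι => ν) (i := i) (f := h i) (hm i).1, h0]
    · intro i _
      exact ((hm i).comp_measurePreserving
        (measurePreserving_eval (fun _ : ι => ν) i)).integrable (by norm_num)
  have hv := ProbabilityTheory.variance_sum_pi (μ := fun _ : ι => ν) (X := h) hm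
  rw [ProbabilityTheory.variance_of_integral_eq_zero] at hv
  · simp only [Finset.sum_apply] at hv
    rw [hv]
    refine Finset.sum_congr rfl fun i _ => ?_
    rw [ProbabilityTheory.variance_of_integral_eq_zero (hm i).1.aemeasurable (h0 i)]
  · convert (memLp_sum_pi hm).1.aemeasurable using 1
    ext ω; simp
  · simpa using hsum

lemma exp_le_quadratic {x c : ℝ} (hx : |x| ≤ c) :
    Real.exp x ≤ 1 + x + x ^ 2 * (Real.exp c / 2) := by
  rcases eq_or_ne x 0 with rfl | hx0
  · simp
  obtain ⟨t, ht, h⟩ := taylor_mean_remainder_lagrange_iteratedDeriv (f := Real.exp) (n := 1)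
    hx0.symm Real.contDiff_exp.contDiffOn
  have htc : t ≤ c := by
    have := ht.2
    rcases le_total 0 x with h0 | h0
    · rw [max_eq_right h0] at this; linarith [le_abs_self x]
    · rw [max_eq_left h0] at this; linarith [abs_nonneg x]
  have h2 := Real.exp_le_exp.2 htc
  have hd : derivWithin Real.exp (uIcc 0 x) 0 = 1 := by
    rw [Real.differentiableAt_exp.derivWithin ((uniqueDiffOn_uIcc hx0.symm) 0 left_mem_uIcc)]
    simp
  simp [taylorWithinEval_succ, hd, iteratedDeriv_eq_iterate] at h
  nlinarith [sq_nonneg x]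

/-- A Bernstein-type bound: the moment generating function of a sum of independent centred
variables bounded by `c` is at most Gaussian up to the factor `exp c` in the variance. -/
lemma integral_exp_sum_pi_le {h : ι → X → ℝ} {c : ℝ} {s : ι → ℝ} (hm : ∀ i, Measurable (h i))
    (hc : ∀ i x, |h i x| ≤ c) (h0 : ∀ i, ∫ x, h i x ∂ν = 0) (hs : ∀ i, ∫ x, h i x ^ 2 ∂ν ≤ s i) :
    Integrable (fun ω : ι → X => Real.exp (∑ i, h i (ω i))) (Measure.pi fun _ : ι => ν) ∧
    ∫ ω : ι → X, Real.exp (∑ i, h i (ω i)) ∂(Measure.pi fun _ : ι => ν) ≤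
      Real.exp ((∑ i, s i) * (Real.exp c / 2)) := by
  have hint : ∀ i, Integrable (h i) ν := fun i =>
    Integrable.of_bound (hm i).aestronglyMeasurable c (Eventually.of_forall (hc i))
  have hint2 : ∀ i, Integrable (fun x => h i x ^ 2) ν := fun i =>
    Integrable.of_bound ((hm i).pow_const 2).aestronglyMeasurable (c ^ 2)
      (Eventually.of_forall fun x => by
        rw [Real.norm_eq_abs, abs_pow]; exact pow_le_pow_left₀ (abs_nonneg _) (hc i x) 2)
  constructor
  · refine Integrable.of_bound (C := Real.exp (∑ _i : ι, c)) ?_ (Eventually.of_forall fun ω => ?_)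
    · exact (Real.measurable_exp.comp (Finset.measurable_sum _ fun i _ =>
        (hm i).comp (measurable_pi_apply i))).aestronglyMeasurable
    · rw [Real.norm_eq_abs, abs_of_pos (Real.exp_pos _)]
      exact Real.exp_le_exp.2 (Finset.sum_le_sum fun i _ => (abs_le.1 (hc i _)).2)
  · simp_rw [Real.exp_sum]
    rw [integral_fintype_prod_eq_prod (fun i x => Real.exp (h i x)), Finset.sum_mul, Real.exp_sum]
    refine Finset.prod_le_prod (fun i _ => integral_nonneg fun x => (Real.exp_pos _).le)
      fun i _ => ?_
    calc ∫ x, Real.exp (h i x) ∂ν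
        ≤ ∫ x, (1 + h i x + h i x ^ 2 * (Real.exp c / 2)) ∂ν := by
          refine integral_mono ?_ (((integrable_const _).add (hint i)).add
            ((hint2 i).mul_const _)) fun x => exp_le_quadratic (hc i x)
          refine Integrable.of_bound (C := Real.exp c)
            (Real.measurable_exp.comp (hm i)).aestronglyMeasurable
            (Eventually.of_forall fun x => ?_)
          rw [Real.norm_eq_abs, abs_of_pos (Real.exp_pos _)]
          exact Real.exp_le_exp.2 (abs_le.1 (hc i _)).2
      _ = 1 + (∫ x, h i x ^ 2 ∂ν) * (Real.exp c / 2) := by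
          rw [integral_add (f := fun x => 1 + h i x) ((integrable_const _).add (hint i))
            ((hint2 i).mul_const _), integral_add (integrable_const _) (hint i), h0 i,
            integral_mul_const]
          simp
      _ ≤ 1 + s i * (Real.exp c / 2) := by
          gcongr; exact hs i
      _ ≤ _ := by linarith [Real.add_one_le_exp (s i * (Real.exp c / 2))]

lemma integral_abs_le_sqrt {f : X → ℝ} (hf : MemLp f 2 ν) {s : ℝ} (hs : ∫ x, f x ^ 2 ∂ν ≤ s) :
    ∫ x, |f x| ∂ν ≤ √s := by
  have h1 : Integrable (fun x => |f x|) ν := (hf.integrable (by norm_num)).abs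
  refine Real.le_sqrt_of_sq_le (le_trans ?_ hs)
  have hv := ProbabilityTheory.variance_nonneg (fun x => |f x|) ν
  have hv2 := ProbabilityTheory.variance_eq_sub (μ := ν) (X := fun x => |f x|) hf.abs
  rw [hv2] at hv
  simpa using hv

end Product

/-! ### Uniform square integrability of a regular family -/

/-- The part of `x` that exceeds the level `M` in absolute value. -/
noncomputable def tail (M x : ℝ) : ℝ := if |x| ≤ M then 0 else x

lemma tail_sq_anti {M M' x : ℝ} (h : M ≤ M') : tail M' x ^ 2 ≤ tail M x ^ 2 := by
  unfold tail
  split_ifs <;> first | positivity | linarith | nlinarith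

lemma tail_sq_le {M x : ℝ} : tail M x ^ 2 ≤ x ^ 2 := by
  unfold tail
  split_ifs <;> simp [sq_nonneg]

lemma measurable_tail (M : ℝ) : Measurable (tail M) := by
  unfold tail
  exact Measurable.ite (measurableSet_le measurable_norm measurable_const) measurable_const
    measurable_id

namespace IsRegularFamily

variable {𝒴 : Set ℝ} {θ₁ θ₂ : ℝ} {v : ℝ → ℝ} {P : ℝ → Measure ℝ} {f : ℝ → ℝ → ℝ}

/-- By Fatou's lemma, integrals against `P m` are lower semicontinuous in `m`, because the densities
are continuous in the parameter. -/
lemma lintegral_le_liminf (h𝒴 : MeasurableSet 𝒴) (hf : IsRegularFamily 𝒴 θ₁ θ₂ v P f)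
    {g : ℝ → ENNReal} (hg : Measurable g) (m₀ : Icc θ₁ θ₂) :
    ∫⁻ y, g y ∂(P m₀) ≤ liminf (fun m : Icc θ₁ θ₂ => ∫⁻ y, g y ∂(P m)) (𝓝 m₀) := by
  have hcont : ∀ y ∈ 𝒴, Continuous fun m : Icc θ₁ θ₂ => f m y := by
    intro y hy
    have h1 : ContinuousOn (logLik f y) (Icc θ₁ θ₂) := by
      have := (hf.differentiable y hy 0 (by norm_num)).continuousOn
      simpa [logLikDeriv, iteratedDerivWithin_zero] using this
    have h2 : ContinuousOn (fun m => f m y) (Icc θ₁ θ₂) :=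
      (Real.continuous_exp.comp_continuousOn h1).congr fun m hm => by
        simp [logLik, Real.exp_log (hf.density_pos m hm y hy)]
    exact continuousOn_iff_continuous_domRestrict.1 h2
  obtain ⟨ν, hν, hP⟩ : ∃ ν : Measure ℝ, (∀ᵐ y ∂ν, y ∈ 𝒴) ∧
      ∀ m ∈ Icc θ₁ θ₂, P m = ν.withDensity fun y => ENNReal.ofReal (f m y) := by
    rcases hf.density with h | ⟨-, h⟩
    · exact ⟨_, ae_restrict_mem h𝒴, h⟩
    · exact ⟨_, ae_restrict_mem h𝒴, h⟩
  have hint : ∀ m : Icc θ₁ θ₂, ∫⁻ y, g y ∂(P m) = ∫⁻ y, ENNReal.ofReal (f m y) * g y ∂ν := by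
    intro m
    rw [hP m m.2, lintegral_withDensity_eq_lintegral_mul _
      (hf.measurable_density m m.2).ennreal_ofReal hg]
    rfl
  simp_rw [hint]
  refine le_trans (lintegral_mono_ae ?_) (lintegral_liminf_le fun m : Icc θ₁ θ₂ =>
    (hf.measurable_density m m.2).ennreal_ofReal.mul hg)
  filter_upwards [hν] with y hy
  have ht : Tendsto (fun m : Icc θ₁ θ₂ => ENNReal.ofReal (f m y)) (𝓝 m₀)
      (𝓝 (ENNReal.ofReal (f m₀ y))) :=
    ENNReal.tendsto_ofReal ((hcont y hy).tendsto m₀)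
  have hpos : ENNReal.ofReal (f m₀ y) ≠ 0 := by
    simpa using hf.density_pos m₀ m₀.2 y hy
  exact (ENNReal.Tendsto.mul_const ht (Or.inl hpos)).liminf_eq.ge

lemma integral_sq (hf : IsRegularFamily 𝒴 θ₁ θ₂ v P f) {m : ℝ} (hm : m ∈ Icc θ₁ θ₂) :
    Integrable (fun y : ℝ => y ^ 2) (P m) ∧ ∫ y, y ^ 2 ∂(P m) = v m + m ^ 2 := by
  have := hf.prob m hm
  have h2 : MemLp (fun y : ℝ => y) 2 (P m) := (hf.third_moment m hm).mono_exponent (by norm_num)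
  have h1 : Integrable (fun y : ℝ => y) (P m) := h2.integrable (by norm_num)
  refine ⟨h2.integrable_sq, ?_⟩
  have hv := hf.variance m hm
  have h3 : ∀ y : ℝ, (y - m) ^ 2 = y ^ 2 - 2 * m * y + m ^ 2 := fun y => by ring
  simp_rw [h3] at hv
  rw [integral_add (f := fun y : ℝ => y ^ 2 - 2 * m * y)
    (h2.integrable_sq.sub (h1.const_mul _)) (integrable_const _),
    integral_sub h2.integrable_sq (h1.const_mul _), integral_const_mul, hf.mean m hm] at hv
  simp at hv
  linarith

/-- Near every parameter the second moments of the tails are uniformly small: the second moment is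
continuous, and its truncated part is lower semicontinuous. -/
lemma eventually_tail_le (h𝒴 : MeasurableSet 𝒴) (hf : IsRegularFamily 𝒴 θ₁ θ₂ v P f)
    (hv : ContinuousOn v (Icc θ₁ θ₂)) {ε : ℝ} (hε : 0 < ε) (m₀ : Icc θ₁ θ₂) :
    ∃ M : ℝ, ∀ᶠ m : Icc θ₁ θ₂ in 𝓝 m₀, ∫ y, tail M y ^ 2 ∂(P m) ≤ ε := by
  have hIt : ∀ (M : ℝ) (m : Icc θ₁ θ₂), Integrable (fun y => tail M y ^ 2) (P m) := fun M m =>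
    (hf.integral_sq m.2).1.mono' ((measurable_tail M).pow_const 2).aestronglyMeasurable
      (Eventually.of_forall fun y => by
        rw [Real.norm_eq_abs, abs_of_nonneg (sq_nonneg _)]; exact tail_sq_le)
  have hIs : ∀ (M : ℝ) (m : Icc θ₁ θ₂), Integrable (fun y => y ^ 2 - tail M y ^ 2) (P m) :=
    fun M m => (hf.integral_sq m.2).1.sub (hIt M m)
  have hlim : Tendsto (fun M : ℕ => ∫ y, tail M y ^ 2 ∂(P m₀)) atTop (𝓝 0) := by
    have := tendsto_integral_of_dominated_convergence (F := fun (M : ℕ) y => tail M y ^ 2)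
      (f := fun _ => (0 : ℝ)) (μ := P m₀) (fun y => y ^ 2)
      (fun M => ((measurable_tail M).pow_const 2).aestronglyMeasurable) (hf.integral_sq m₀.2).1
      (fun M => Eventually.of_forall fun y => by
        rw [Real.norm_eq_abs, abs_of_nonneg (sq_nonneg _)]; exact tail_sq_le)
      (Eventually.of_forall fun y => ?_)
    · simpa using this
    · refine tendsto_const_nhds.congr' ?_
      filter_upwards [eventually_ge_atTop ⌈|y|⌉₊] with M hM
      have : |y| ≤ M := (Nat.le_ceil _).trans (by exact_mod_cast hM)
      simp [tail, this]
  obtain ⟨M, hM⟩ := (hlim.eventually (gt_mem_nhds (show (0 : ℝ) < ε / 3 by positivity))).exists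
  refine ⟨M, ?_⟩
  have hnn : ∀ y : ℝ, 0 ≤ y ^ 2 - tail M y ^ 2 := fun y => sub_nonneg.2 tail_sq_le
  have hlsc := hf.lintegral_le_liminf h𝒴 (g := fun y => ENNReal.ofReal (y ^ 2 - tail M y ^ 2))
    (by have := measurable_tail M; fun_prop) m₀
  have hA : ∀ m : Icc θ₁ θ₂, ∫⁻ y, ENNReal.ofReal (y ^ 2 - tail M y ^ 2) ∂(P m) =
      ENNReal.ofReal (v m + (m : ℝ) ^ 2 - ∫ y, tail M y ^ 2 ∂(P m)) := by
    intro m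
    rw [← ofReal_integral_eq_lintegral_ofReal (hIs M m) (Eventually.of_forall hnn),
      integral_sub (hf.integral_sq m.2).1 (hIt M m), (hf.integral_sq m.2).2]
  simp_rw [hA] at hlsc
  set A : Icc θ₁ θ₂ → ℝ := fun m => v m + (m : ℝ) ^ 2 - ∫ y, tail M y ^ 2 ∂(P m) with hAdef
  have hAnn : ∀ m, 0 ≤ A m := fun m => by
    have := integral_nonneg (μ := P m) (f := fun y => y ^ 2 - tail M y ^ 2) hnn
    rwa [integral_sub (hf.integral_sq m.2).1 (hIt M m), (hf.integral_sq m.2).2] at this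
  have hev1 : ∀ᶠ m in 𝓝 m₀, A m₀ - ε / 3 < A m := by
    rcases lt_or_ge (A m₀ - ε / 3) 0 with hneg | hpos
    · exact Eventually.of_forall fun m => hneg.trans_le (hAnn m)
    have h1 : ENNReal.ofReal (A m₀ - ε / 3) < ENNReal.ofReal (A m₀) :=
      (ENNReal.ofReal_lt_ofReal_iff_of_nonneg hpos).2 (by linarith)
    have := eventually_lt_of_lt_liminf (h1.trans_le hlsc)
    filter_upwards [this] with m hm
    exact (ENNReal.ofReal_lt_ofReal_iff_of_nonneg hpos).1 hm
  have hc : Continuous fun m : Icc θ₁ θ₂ => v m + (m : ℝ) ^ 2 :=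
    (continuousOn_iff_continuous_domRestrict.1 hv).add (continuous_subtype_val.pow 2)
  have hev2 := (hc.tendsto m₀).eventually
    (gt_mem_nhds (show v m₀ + (m₀ : ℝ) ^ 2 < v m₀ + (m₀ : ℝ) ^ 2 + ε / 3 by linarith))
  filter_upwards [hev1, hev2] with m h1 h2
  simp only [hAdef] at h1
  linarith

/-- The family is uniformly square integrable around its means. -/
lemma exists_tail_le (h𝒴 : MeasurableSet 𝒴) (hf : IsRegularFamily 𝒴 θ₁ θ₂ v P f)
    (hv : ContinuousOn v (Icc θ₁ θ₂)) {ε : ℝ} (hε : 0 < ε) :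
    ∃ M₀ : ℝ, ∀ M ≥ M₀, ∀ m ∈ Icc θ₁ θ₂, ∫ y, tail M (y - m) ^ 2 ∂(P m) ≤ ε := by
  have hIt : ∀ (M : ℝ), ∀ m ∈ Icc θ₁ θ₂, Integrable (fun y => tail M y ^ 2) (P m) := fun M m hm =>
    (hf.integral_sq hm).1.mono' ((measurable_tail M).pow_const 2).aestronglyMeasurable
      (Eventually.of_forall fun y => by
        rw [Real.norm_eq_abs, abs_of_nonneg (sq_nonneg _)]; exact tail_sq_le)
  have huniv : ∃ M₀ : ℝ, ∀ M ≥ M₀, ∀ m ∈ (univ : Set (Icc θ₁ θ₂)),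
      ∫ y, tail M y ^ 2 ∂(P m) ≤ ε / 4 := by
    refine (isCompact_univ (X := Icc θ₁ θ₂)).induction_on
      (p := fun s : Set (Icc θ₁ θ₂) => ∃ M₀ : ℝ, ∀ M ≥ M₀, ∀ m ∈ s,
        ∫ y, tail M y ^ 2 ∂(P m) ≤ ε / 4) ⟨0, by simp⟩ ?_ ?_ ?_
    · rintro s t hst ⟨M₀, h⟩
      exact ⟨M₀, fun M hM m hm => h M hM m (hst hm)⟩
    · rintro s t ⟨M₀, h⟩ ⟨M₁, h'⟩
      refine ⟨max M₀ M₁, fun M hM m hm => hm.elim (h M ((le_max_left _ _).trans hM) m)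
        (h' M ((le_max_right _ _).trans hM) m)⟩
    · intro m₀ _
      obtain ⟨M₀, h⟩ := hf.eventually_tail_le h𝒴 hv (show 0 < ε / 4 by positivity) m₀
      refine ⟨_, mem_nhdsWithin_of_mem_nhds h, M₀, fun M hM m hm => le_trans ?_ hm⟩
      exact integral_mono (hIt M m m.2) (hIt M₀ m m.2) fun y => tail_sq_anti hM
  obtain ⟨M₀, h⟩ := huniv
  set C := max |θ₁| |θ₂| with hC
  have hC0 : 0 ≤ C := (abs_nonneg _).trans (le_max_left _ _)
  refine ⟨max (M₀ + C) (2 * C), fun M hM m hm => ?_⟩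
  have hM1 : M₀ ≤ M - C := by linarith [(le_max_left (M₀ + C) (2 * C)).trans hM]
  have hM2 : 2 * C ≤ M := (le_max_right _ _).trans hM
  have hmC : |m| ≤ C := abs_le_max_abs_abs hm.1 hm.2
  calc ∫ y, tail M (y - m) ^ 2 ∂(P m) ≤ ∫ y, 4 * tail (M - C) y ^ 2 ∂(P m) := by
        refine integral_mono_of_nonneg (Eventually.of_forall fun y => sq_nonneg _)
          ((hIt _ m hm).const_mul 4) (Eventually.of_forall fun y => ?_)
        simp only [tail]
        split_ifs with h1 h2 h2
        · simp
        · rw [zero_pow two_ne_zero]; positivity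
        · exfalso
          have := abs_sub y m
          linarith
        · have h3 : |y - m| ≤ 2 * |y| := by
            have := abs_sub y m
            linarith
          have := sq_le_sq' (by linarith [abs_nonneg (y - m), abs_nonneg y]) h3
          rw [sq_abs, mul_pow, sq_abs] at this
          linarith
    _ = 4 * ∫ y, tail (M - C) y ^ 2 ∂(P m) := integral_const_mul _ _
    _ ≤ ε := by linarith [h (M - C) hM1 ⟨m, hm⟩ (mem_univ _)]

end IsRegularFamily

/-! ### Truncation of a centred variable -/

section Truncation

variable {Ω : Type*} [MeasurableSpace Ω] {q : Measure Ω} {X : Ω → ℝ} {M : ℝ}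

/-- The bounded part of a variable `X`: `X` truncated at the level `M` and then centred. -/
noncomputable def core (q : Measure Ω) (M : ℝ) (X : Ω → ℝ) (ω : Ω) : ℝ :=
  X ω - tail M (X ω) - ∫ ω', (X ω' - tail M (X ω')) ∂q

lemma abs_sub_tail_le (hM : 0 ≤ M) (x : ℝ) : |x - tail M x| ≤ M := by
  unfold tail
  split_ifs with h <;> simpa

lemma measurable_core (hX : Measurable X) : Measurable (core q M X) :=
  (hX.sub ((measurable_tail M).comp hX)).sub_const _

variable [IsProbabilityMeasure q]

lemma abs_core_le (hM : 0 ≤ M) (ω : Ω) : |core q M X ω| ≤ 2 * M := by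
  have h1 := abs_sub_tail_le hM (X ω)
  have h2 : |∫ ω', (X ω' - tail M (X ω')) ∂q| ≤ M := by
    simpa using norm_integral_le_of_norm_le_const (μ := q) (C := M)
      (f := fun ω' => X ω' - tail M (X ω')) (Eventually.of_forall fun ω' => abs_sub_tail_le hM _)
  unfold core
  linarith [abs_sub (X ω - tail M (X ω)) (∫ ω', (X ω' - tail M (X ω')) ∂q)]

lemma memLp_sub_tail (hX : Measurable X) (hM : 0 ≤ M) :
    MemLp (fun ω => X ω - tail M (X ω)) 2 q :=
  MemLp.of_bound (hX.sub ((measurable_tail M).comp hX)).aestronglyMeasurable M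
    (Eventually.of_forall fun _ => abs_sub_tail_le hM _)

lemma memLp_core (hX : Measurable X) (hM : 0 ≤ M) : MemLp (core q M X) 2 q :=
  MemLp.of_bound (measurable_core hX).aestronglyMeasurable (2 * M)
    (Eventually.of_forall fun _ => abs_core_le hM _)

lemma integral_core (hX : Measurable X) (hM : 0 ≤ M) : ∫ ω, core q M X ω ∂q = 0 := by
  unfold core
  rw [integral_sub ((memLp_sub_tail hX hM).integrable (by norm_num)) (integrable_const _)]
  simp

lemma integral_core_sq_le (hX : Measurable X) (hX2 : MemLp X 2 q) (hM : 0 ≤ M) :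
    ∫ ω, core q M X ω ^ 2 ∂q ≤ ∫ ω, X ω ^ 2 ∂q := by
  have h := ProbabilityTheory.variance_le_expectation_sq (μ := q)
    (memLp_sub_tail hX hM).1
  rw [ProbabilityTheory.variance_eq_integral (memLp_sub_tail hX hM).1.aemeasurable] at h
  refine h.trans (integral_mono (memLp_sub_tail hX hM).integrable_sq hX2.integrable_sq fun ω => ?_)
  simp only [Pi.pow_apply, tail]
  split_ifs <;> simp [sq_nonneg]

lemma integral_sub_core (hX : Measurable X) (hX2 : MemLp X 2 q) (hX0 : ∫ ω, X ω ∂q = 0)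
    (hM : 0 ≤ M) : ∫ ω, (X ω - core q M X ω) ∂q = 0 := by
  rw [integral_sub (hX2.integrable (by norm_num)) ((memLp_core hX hM).integrable (by norm_num)),
    hX0, integral_core hX hM, sub_zero]

lemma integral_sub_core_sq_le (hX : Measurable X) (hX2 : MemLp X 2 q) (hX0 : ∫ ω, X ω ∂q = 0)
    (hM : 0 ≤ M) : ∫ ω, (X ω - core q M X ω) ^ 2 ∂q ≤ ∫ ω, tail M (X ω) ^ 2 ∂q := by
  have hm : MemLp (fun ω => tail M (X ω)) 2 q := by
    have := hX2.sub (memLp_sub_tail (q := q) hX hM)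
    convert this using 1
    ext ω; simp
  have hi : ∫ ω, (X ω - tail M (X ω)) ∂q = - ∫ ω, tail M (X ω) ∂q := by
    rw [integral_sub (hX2.integrable (by norm_num)) (hm.integrable (by norm_num)), hX0, zero_sub]
  have h := ProbabilityTheory.variance_le_expectation_sq (μ := q) hm.1
  rw [ProbabilityTheory.variance_eq_integral hm.1.aemeasurable] at h
  simp only [core, hi]
  convert h using 3 with ω
  · ring
  · rfl

end Truncation

/-! ### Uniform outcome models -/

/-- What the regret bound uses of the outcome distributions: means `μ a`, variances `v a (μ a)` with
`v a` continuous and positive, and square integrability uniformly over the parameter box. -/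
structure IsUniformModel {K : ℕ} (θ₁ θ₂ : ℝ) (v : Fin K → ℝ → ℝ)
    (Q : (Fin K → ℝ) → Measure (Fin K → ℝ)) : Prop where
  prob : ∀ μ ∈ Set.univ.pi (fun _ : Fin K => Icc θ₁ θ₂), IsProbabilityMeasure (Q μ)
  memLp : ∀ μ ∈ Set.univ.pi (fun _ : Fin K => Icc θ₁ θ₂), ∀ a, MemLp (fun y => y a - μ a) 2 (Q μ)
  mean : ∀ μ ∈ Set.univ.pi (fun _ : Fin K => Icc θ₁ θ₂), ∀ a, ∫ y, (y a - μ a) ∂(Q μ) = 0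
  variance : ∀ μ ∈ Set.univ.pi (fun _ : Fin K => Icc θ₁ θ₂), ∀ a,
    ∫ y, (y a - μ a) ^ 2 ∂(Q μ) = v a (μ a)
  tail_le : ∀ ε > 0, ∃ M > 0, ∀ μ ∈ Set.univ.pi (fun _ : Fin K => Icc θ₁ θ₂), ∀ a,
    ∫ y, tail M (y a - μ a) ^ 2 ∂(Q μ) ≤ ε
  cont : ∀ a, ContinuousOn (v a) (Icc θ₁ θ₂)
  pos : ∀ a, ∀ m ∈ Icc θ₁ θ₂, 0 < v a m

lemma IsBanditModel.isUniformModel {K : ℕ} [NeZero K] {𝒴 : Set ℝ} (h𝒴 : MeasurableSet 𝒴)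
    {θ₁ θ₂ : ℝ} {v : Fin K → ℝ → ℝ} {P : Fin K → ℝ → Measure ℝ} (hP : IsBanditModel 𝒴 θ₁ θ₂ v P)
    {Q : (Fin K → ℝ) → Measure (Fin K → ℝ)}
    (hQ : ∀ μ ∈ Set.univ.pi (fun _ : Fin K => Icc θ₁ θ₂), ∀ a,
      (Q μ).map (fun y => y a) = P a (μ a)) : IsUniformModel θ₁ θ₂ v Q := by
  choose hv hpos f hf using hP
  have hmem : ∀ μ ∈ Set.univ.pi (fun _ : Fin K => Icc θ₁ θ₂), ∀ a, μ a ∈ Icc θ₁ θ₂ :=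
    fun μ hμ a => hμ a (mem_univ a)
  have hev : ∀ a : Fin K, Measurable fun y : Fin K → ℝ => y a := fun a => measurable_pi_apply a
  have hprob : ∀ μ ∈ Set.univ.pi (fun _ : Fin K => Icc θ₁ θ₂), IsProbabilityMeasure (Q μ) := by
    intro μ hμ
    have := (hf 0).prob _ (hmem μ hμ 0)
    rw [← hQ μ hμ 0] at this
    exact Measure.isProbabilityMeasure_of_map (fun y => y 0)
  have hint : ∀ μ ∈ Set.univ.pi (fun _ : Fin K => Icc θ₁ θ₂), ∀ a, ∀ g : ℝ → ℝ, Measurable g →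
      ∫ y, g (y a) ∂(Q μ) = ∫ y, g y ∂(P a (μ a)) := by
    intro μ hμ a g hg
    rw [← hQ μ hμ a, integral_map (hev a).aemeasurable hg.aestronglyMeasurable]
  have hmemLp : ∀ μ ∈ Set.univ.pi (fun _ : Fin K => Icc θ₁ θ₂), ∀ a,
      MemLp (fun y => y a) 2 (Q μ) := by
    intro μ hμ a
    have := (hf a).prob _ (hmem μ hμ a)
    have h := ((hf a).third_moment _ (hmem μ hμ a)).mono_exponent (q := 3) (p := 2) (by norm_num)
    rw [← hQ μ hμ a] at h
    exact h.comp_of_map (hev a).aemeasurable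
  refine ⟨hprob, fun μ hμ a => ?_, fun μ hμ a => ?_, fun μ hμ a => ?_, fun ε hε => ?_, hv, hpos⟩
  · have := hprob μ hμ
    exact (hmemLp μ hμ a).sub (memLp_const _)
  · have := hprob μ hμ
    rw [integral_sub ((hmemLp μ hμ a).integrable (by norm_num)) (integrable_const _),
      hint μ hμ a (fun y => y) measurable_id, (hf a).mean _ (hmem μ hμ a)]
    simp
  · rw [hint μ hμ a (fun y => (y - μ a) ^ 2) (by fun_prop), (hf a).variance _ (hmem μ hμ a)]
  · choose M hM using fun a => (hf a).exists_tail_le h𝒴 (hv a) hε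
    obtain ⟨M', hM'⟩ := (Set.finite_range M).bddAbove
    refine ⟨max M' 1, by positivity, fun μ hμ a => ?_⟩
    rw [hint μ hμ a (fun y => tail (max M' 1) (y - μ a) ^ 2)
      (((measurable_tail _).comp (measurable_id.sub_const _)).pow_const 2)]
    exact hM a _ ((hM' (mem_range_self a)).trans (le_max_left _ _)) _ (hmem μ hμ a)

namespace IsUniformModel

variable {K : ℕ} {θ₁ θ₂ : ℝ} {v : Fin K → ℝ → ℝ} {Q : (Fin K → ℝ) → Measure (Fin K → ℝ)}

lemma exists_bounds (hU : IsUniformModel θ₁ θ₂ v Q) :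
    ∃ s₀ s₁ : ℝ, 0 < s₀ ∧ 0 < s₁ ∧ ∀ a, ∀ m ∈ Icc θ₁ θ₂, s₀ ≤ v a m ∧ v a m ≤ s₁ := by
  have h : ∀ a : Fin K, ∃ s₀ s₁ : ℝ, 0 < s₀ ∧ 0 < s₁ ∧
      ∀ m ∈ Icc θ₁ θ₂, s₀ ≤ v a m ∧ v a m ≤ s₁ := by
    intro a
    rcases (Icc θ₁ θ₂).eq_empty_or_nonempty with he | hne
    · exact ⟨1, 1, one_pos, one_pos, by simp [he]⟩
    obtain ⟨m₀, hm₀, h0⟩ := isCompact_Icc.exists_isMinOn hne (hU.cont a)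
    obtain ⟨m₁, hm₁, h1⟩ := isCompact_Icc.exists_isMaxOn hne (hU.cont a)
    exact ⟨v a m₀, v a m₁, hU.pos a m₀ hm₀, hU.pos a m₁ hm₁, fun m hm => ⟨h0 hm, h1 hm⟩⟩
  choose s₀ s₁ h0 h1 hb using h
  rcases isEmpty_or_nonempty (Fin K) with hK | hK
  · exact ⟨1, 1, one_pos, one_pos, fun a => (hK.false a).elim⟩
  obtain ⟨a₀, ha₀⟩ := Finite.exists_min s₀
  obtain ⟨a₁, ha₁⟩ := Finite.exists_max s₁
  exact ⟨s₀ a₀, s₁ a₁, h0 a₀, h1 a₁, fun a m hm =>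
    ⟨(ha₀ a).trans (hb a m hm).1, (hb a m hm).2.trans (ha₁ a)⟩⟩

lemma exists_modulus (hU : IsUniformModel θ₁ θ₂ v Q) {η : ℝ} (hη : 0 < η) :
    ∃ d > 0, ∀ a, ∀ m ∈ Icc θ₁ θ₂, ∀ m' ∈ Icc θ₁ θ₂, |m - m'| ≤ d → |v a m - v a m'| ≤ η := by
  have h : ∀ a, ∃ d > 0, ∀ m ∈ Icc θ₁ θ₂, ∀ m' ∈ Icc θ₁ θ₂, |m - m'| < d → |v a m - v a m'| < η :=
    fun a => Metric.uniformContinuousOn_iff.1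
      (isCompact_Icc.uniformContinuousOn_of_continuous (hU.cont a)) η hη
  choose d hd h using h
  rcases isEmpty_or_nonempty (Fin K) with hK | hK
  · exact ⟨1, one_pos, fun a => (hK.false a).elim⟩
  obtain ⟨a₀, ha₀⟩ := Finite.exists_min d
  exact ⟨d a₀ / 2, half_pos (hd a₀), fun a m hm m' hm' hmm =>
    (h a m hm m' hm' (by linarith [hd a₀, ha₀ a])).le⟩

end IsUniformModel

/-! ### Allocation shares as functions of the variances -/

section Shares

variable {K : ℕ} {ρ : ℝ} {S : Finset (Fin K)} {s s' : Fin K → ℝ} {a b c : Fin K}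

/-- The quantity to which the ideal allocation of the candidates `S` is proportional, for arms with
variances `s`: standard deviations for two candidates, variances otherwise. -/
noncomputable def scale (S : Finset (Fin K)) (s : Fin K → ℝ) (a : Fin K) : ℝ :=
  if S.card = 2 then √(s a) else s a

/-- The share of all rounds intended for candidate `a`, when the candidates are `S`, the variances
are `s`, and the pilot spends the fraction `ρ` of all rounds on every arm. -/
noncomputable def share (ρ : ℝ) (S : Finset (Fin K)) (s : Fin K → ℝ) (a : Fin K) : ℝ :=
  scale S s a / (∑ b ∈ S, scale S s b) * (1 - ((K : ℝ) - S.card) * ρ)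

open Classical in
/-- The probability of drawing arm `a` in the second stage, when the candidates are `S` and the
variances are `s`. -/
noncomputable def drawProb (ρ : ℝ) (S : Finset (Fin K)) (s : Fin K → ℝ) (a : Fin K) : ℝ :=
  if a ∈ S then max (share ρ S s a - ρ) 0 / ∑ b ∈ S, max (share ρ S s b - ρ) 0 else 0

lemma scale_pos (h : 0 < s a) : 0 < scale S s a := by
  unfold scale
  split_ifs
  · exact Real.sqrt_pos.2 h
  · exact h

lemma sum_scale_pos (hS : S.Nonempty) (hs : ∀ a ∈ S, 0 < s a) : 0 < ∑ b ∈ S, scale S s b :=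
  Finset.sum_pos (fun b hb => scale_pos (hs b hb)) hS

lemma sum_share (hS : S.Nonempty) (hs : ∀ a ∈ S, 0 < s a) :
    ∑ a ∈ S, (share ρ S s a - ρ) = 1 - K * ρ := by
  simp only [share]
  rw [Finset.sum_sub_distrib, ← Finset.sum_mul, ← Finset.sum_div,
    div_self (sum_scale_pos hS hs).ne']
  simp
  ring

lemma sum_max_share_pos (hρ : K * ρ < 1) (hS : S.Nonempty) (hs : ∀ a ∈ S, 0 < s a) :
    0 < ∑ a ∈ S, max (share ρ S s a - ρ) 0 := by
  refine lt_of_lt_of_le (sub_pos.2 hρ) ?_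
  rw [← sum_share hS hs]
  exact Finset.sum_le_sum fun a _ => le_max_left _ _

lemma drawProb_congr (h : ∀ a ∈ S, s a = s' a) : drawProb ρ S s a = drawProb ρ S s' a := by
  have h1 : ∀ a ∈ S, scale S s a = scale S s' a := fun a ha => by simp [scale, h a ha]
  have h2 : ∀ a ∈ S, share ρ S s a = share ρ S s' a := fun a ha => by
    rw [share, share, h1 a ha, Finset.sum_congr rfl h1]
  unfold drawProb
  split_ifs with ha
  · rw [h2 a ha, Finset.sum_congr rfl fun b hb => by rw [h2 b hb]]
  · rfl

lemma drawProb_eq (hS : S.Nonempty) (hs : ∀ a ∈ S, 0 < s a)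
    (hshare : ∀ a ∈ S, ρ ≤ share ρ S s a) (ha : a ∈ S) :
    drawProb ρ S s a = (share ρ S s a - ρ) / (1 - K * ρ) := by
  rw [drawProb, if_pos ha, max_eq_left (sub_nonneg.2 (hshare a ha)), ← sum_share hS hs]
  congr 1
  exact Finset.sum_congr rfl fun b hb => max_eq_left (sub_nonneg.2 (hshare b hb))

lemma continuousOn_drawProb (hρ : K * ρ < 1) (hS : S.Nonempty) (a : Fin K) :
    ContinuousOn (fun s => drawProb ρ S s a) {s : Fin K → ℝ | ∀ a, 0 < s a} := by
  have h1 : ∀ a, Continuous fun s : Fin K → ℝ => scale S s a := by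
    intro a
    unfold scale
    split_ifs <;> fun_prop
  have h2 : ∀ a, ContinuousOn (fun s : Fin K → ℝ => share ρ S s a) {s | ∀ a, 0 < s a} := by
    intro a
    unfold share
    refine ((h1 a).continuousOn.div (continuous_finsetSum _ fun b _ => h1 b).continuousOn
      fun s hs => ?_).mul continuousOn_const
    exact (sum_scale_pos hS fun a _ => hs a).ne'
  have h3 : ∀ a, ContinuousOn (fun s : Fin K → ℝ => max (share ρ S s a - ρ) 0)
      {s | ∀ a, 0 < s a} := fun a =>
    (((h2 a).sub continuousOn_const).sup continuousOn_const)
  unfold drawProb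
  split_ifs
  · refine (h3 a).div (continuousOn_finsetSum _ fun b _ => h3 b) fun s hs => ?_
    exact (sum_max_share_pos hρ hS fun a _ => hs a).ne'
  · exact continuousOn_const

/-- The drawing probabilities depend uniformly continuously on the variances of the candidates. -/
lemma exists_drawProb_modulus (hρ : K * ρ < 1) {s₀ s₁ δ : ℝ} (hs₀ : 0 < s₀) (hδ : 0 < δ) :
    ∃ η > 0, ∀ (S : Finset (Fin K)) (a : Fin K), S.Nonempty → ∀ s s' : Fin K → ℝ,
      (∀ a, s₀ ≤ s a ∧ s a ≤ s₁) → (∀ a ∈ S, |s' a - s a| ≤ η) →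
      |drawProb ρ S s' a - drawProb ρ S s a| ≤ δ := by
  classical
  have hev : ∀ᶠ η in 𝓝[>] (0 : ℝ), ∀ (S : Finset (Fin K)) (a : Fin K), S.Nonempty →
      ∀ s s' : Fin K → ℝ, (∀ a, s₀ ≤ s a ∧ s a ≤ s₁) → (∀ a ∈ S, |s' a - s a| ≤ η) →
      |drawProb ρ S s' a - drawProb ρ S s a| ≤ δ := by
    simp only [eventually_all]
    intro S a hS
    set B : Set (Fin K → ℝ) := Set.univ.pi fun _ => Icc (s₀ / 2) (s₁ + 1) with hB
    have hBc : IsCompact B := isCompact_univ_pi fun _ => isCompact_Icc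
    have hcont : ContinuousOn (fun s => drawProb ρ S s a) B :=
      (continuousOn_drawProb hρ hS a).mono fun s hs b =>
        lt_of_lt_of_le (half_pos hs₀) (hs b (mem_univ b)).1
    obtain ⟨η, hη, h⟩ := Metric.uniformContinuousOn_iff.1
      (hBc.uniformContinuousOn_of_continuous hcont) δ hδ
    have hmin : 0 < min η (min (s₀ / 2) 1) := by positivity
    filter_upwards [Ioo_mem_nhdsGT hmin] with t ht s s' hs hss
    have ht1 : t < η := ht.2.trans_le (min_le_left _ _)
    have ht2 : t < s₀ / 2 := ht.2.trans_le ((min_le_right _ _).trans (min_le_left _ _))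
    have ht3 : t < 1 := ht.2.trans_le ((min_le_right _ _).trans (min_le_right _ _))
    -- Off `S` the variances do not matter, so they may be taken equal there.
    let s'' : Fin K → ℝ := fun b => if b ∈ S then s' b else s b
    have h1 : drawProb ρ S s' a = drawProb ρ S s'' a :=
      drawProb_congr fun b hb => by simp [s'', hb]
    have h2 : ∀ b, |s'' b - s b| ≤ t := by
      intro b
      by_cases hb : b ∈ S
      · simpa [s'', hb] using hss b hb
      · simpa [s'', hb] using ht.1.le
    rw [h1, ← Real.dist_eq]
    refine (h s'' (fun b _ => ?_) s (fun b _ => ?_) ?_).le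
    · have := abs_le.1 (h2 b)
      constructor <;> linarith [(hs b).1, (hs b).2]
    · constructor <;> linarith [(hs b).1, (hs b).2]
    · refine lt_of_le_of_lt ((dist_pi_le_iff ht.1.le).2 fun b => ?_) ht1
      rw [Real.dist_eq]; exact h2 b
  obtain ⟨η, h, hη⟩ := (hev.and self_mem_nhdsWithin).exists
  exact ⟨η, hη, h⟩

/-! ### Size of the shares and the resulting variances -/

lemma one_sub_pos (hρ0 : 0 < ρ) (hρ : K * ρ < 1) : 0 < 1 - ((K : ℝ) - S.card) * ρ := by
  have : (0 : ℝ) ≤ S.card * ρ := by positivity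
  nlinarith

lemma sum_le_mul_sum (hs : ∀ a, 0 < s a)
    (h : ∀ a, ρ ≤ s a / ∑ b, s b) :
    ∑ b ∈ S, s b ≤ (1 - ((K : ℝ) - S.card) * ρ) * ∑ b, s b := by
  have hle : ∀ a, ρ * ∑ b, s b ≤ s a := fun a =>
    (le_div_iff₀ (Finset.sum_pos (fun b _ => hs b) ⟨a, Finset.mem_univ a⟩)).1 (h a)
  have h1 := Finset.card_nsmul_le_sum Sᶜ s (ρ * ∑ b, s b) fun a _ => hle a
  rw [Finset.card_compl, Fintype.card_fin, nsmul_eq_mul,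
    Nat.cast_sub (by simpa using S.card_le_univ)] at h1
  have h2 := Finset.sum_add_sum_compl S s
  nlinarith

/-- If the pilot takes at most the share of every arm proportional to the variances of all arms, it
takes at most the share of every candidate. This includes two candidates, whose shares are
proportional to the standard deviations. -/
lemma le_share (hρ0 : 0 < ρ) (hρ : K * ρ < 1) (hs : ∀ a, 0 < s a)
    (h : ∀ a, ρ ≤ s a / ∑ b, s b) (hS : 2 ≤ S.card) (ha : a ∈ S) : ρ ≤ share ρ S s a := by
  have hV : 0 < ∑ b, s b := Finset.sum_pos (fun b _ => hs b) ⟨a, Finset.mem_univ a⟩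
  have hle : ρ * ∑ b, s b ≤ s a := (le_div_iff₀ hV).1 (h a)
  have hD := one_sub_pos (S := S) hρ0 hρ
  have hDV := sum_le_mul_sum (S := S) hs h
  have hsc := sum_scale_pos ⟨a, ha⟩ fun b (_ : b ∈ S) => hs b
  rw [share, div_mul_eq_mul_div, le_div_iff₀ hsc]
  rcases hS.eq_or_lt with h2 | h3
  · obtain ⟨c, hc⟩ := Finset.card_eq_one.1
      (show (S.erase a).card = 1 by rw [Finset.card_erase_of_mem ha]; omega)
    have hac : a ≠ c := fun hac => by
      have := hc.symm ▸ Finset.mem_singleton_self c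
      exact Finset.notMem_erase a S (hac ▸ this)
    obtain rfl : S = {a, c} := by rw [← Finset.insert_erase ha, hc]
    rw [Finset.sum_pair hac] at hDV ⊢
    simp only [scale, ← h2, if_true]
    rw [← h2] at hDV hD
    set D := 1 - ((K : ℝ) - (2 : ℕ)) * ρ with hDdef
    have e1 := Real.sq_sqrt (hs a).le
    have e2 := Real.sq_sqrt (hs c).le
    have h1 := Real.sqrt_pos.2 (hs a)
    have h2 := Real.sqrt_pos.2 (hs c)
    rw [← e1, ← e2] at hDV
    rw [← e1] at hle
    set x := √(s a)
    set y := √(s c)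
    rcases le_total x y with hxy | hxy
    · -- The share is at least the one for weights proportional to the variances.
      refine le_of_mul_le_mul_right (?_ : _ * (∑ b, s b) ≤ _ * ∑ b, s b) hV
      calc ρ * (x + y) * ∑ b, s b = (ρ * ∑ b, s b) * (x + y) := by ring
        _ ≤ x ^ 2 * (x + y) := by gcongr
        _ ≤ x * (x ^ 2 + y ^ 2) := by
          nlinarith [mul_nonneg h1.le (mul_nonneg h2.le (sub_nonneg.2 hxy))]
        _ ≤ x * (D * ∑ b, s b) := by gcongr
        _ = x * D * ∑ b, s b := by ring
    · -- The share is at least half of the fraction left for the two candidates.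
      have hD2 : 2 * ρ ≤ D := by rw [hDdef]; push_cast; linarith
      nlinarith [mul_le_mul_of_nonneg_left hD2 h1.le]
  · have h2 : S.card ≠ 2 := by omega
    simp only [scale, h2, if_false] at hsc ⊢
    refine le_of_mul_le_mul_right (?_ : _ * (∑ b, s b) ≤ _ * ∑ b, s b) hV
    calc ρ * (∑ b ∈ S, s b) * ∑ b, s b = (ρ * ∑ b, s b) * ∑ b ∈ S, s b := by ring
      _ ≤ s a * ∑ b ∈ S, s b := by gcongr
      _ ≤ s a * ((1 - ((K : ℝ) - S.card) * ρ) * ∑ b, s b) :=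
        mul_le_mul_of_nonneg_left hDV (hs a).le
      _ = _ := by ring

/-- With two candidates the variance of the difference of the sample means is
`(σ_b + σ_c) ^ 2 / (1 - (K - 2) ρ)`. -/
lemma sum_div_share_pair (hs : ∀ a, 0 < s a) (hbc : b ≠ c) (hρ : 0 < 1 - ((K : ℝ) - 2) * ρ) :
    s b / share ρ {b, c} s b + s c / share ρ {b, c} s c =
      (√(s b) + √(s c)) ^ 2 / (1 - ((K : ℝ) - 2) * ρ) := by
  have h1 := Real.sqrt_pos.2 (hs b)
  have h2 := Real.sqrt_pos.2 (hs c)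
  have e1 := Real.sq_sqrt (hs b).le
  have e2 := Real.sq_sqrt (hs c).le
  simp only [share, scale, Finset.card_pair hbc, if_true, Finset.sum_pair hbc, Nat.cast_ofNat]
  rw [← e1, ← e2, Real.sqrt_sq h1.le, Real.sqrt_sq h2.le]
  set x := √(s b)
  set y := √(s c)
  set z := 1 - ((K : ℝ) - 2) * ρ
  have : x + y ≠ 0 := by positivity
  field_simp

/-- The common ratio of variance and share for at least three candidates. -/
noncomputable def ratio (ρ : ℝ) (S : Finset (Fin K)) (s : Fin K → ℝ) : ℝ :=
  (∑ b ∈ S, s b) / (1 - ((K : ℝ) - S.card) * ρ)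

lemma inv_share_of_three_le (hρ0 : 0 < ρ) (hρ : K * ρ < 1) (hs : ∀ a, 0 < s a)
    (hS : 3 ≤ S.card) (ha : a ∈ S) : (share ρ S s a)⁻¹ = ratio ρ S s / s a := by
  have h1 := one_sub_pos (S := S) hρ0 hρ
  have h2 : S.card ≠ 2 := by omega
  simp only [share, scale, h2, if_false, ratio]
  have h3 : 0 < ∑ b ∈ S, s b := Finset.sum_pos (fun b _ => hs b) ⟨a, ha⟩
  have := hs a
  field_simp

lemma ratio_pos (hρ0 : 0 < ρ) (hρ : K * ρ < 1) (hs : ∀ a, 0 < s a) (hS : S.Nonempty) :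
    0 < ratio ρ S s :=
  div_pos (Finset.sum_pos (fun b _ => hs b) hS) (one_sub_pos hρ0 hρ)

lemma ratio_le (hρ0 : 0 < ρ) (hρ : K * ρ < 1) (hs : ∀ a, 0 < s a)
    (h : ∀ a, ρ ≤ s a / ∑ b, s b) : ratio ρ S s ≤ ∑ b, s b := by
  rw [ratio, div_le_iff₀ (one_sub_pos hρ0 hρ), mul_comm]
  exact sum_le_mul_sum hs h

/-- With at least three arms, two candidates are no harder to compare than two of all `K` arms,
whose sample means have variance `∑ b, s b` each after scaling by `T`. -/
lemma pair_variance_le (hρ0 : 0 < ρ) (hρ : K * ρ < 1) (hs : ∀ a, 0 < s a)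
    (h : ∀ a, ρ ≤ s a / ∑ b, s b) (hbc : b ≠ c) :
    (√(s b) + √(s c)) ^ 2 / (1 - ((K : ℝ) - 2) * ρ) ≤ 2 * ∑ b, s b := by
  have h1 := one_sub_pos (S := {b, c}) hρ0 hρ
  have h2 := sum_le_mul_sum (S := {b, c}) hs h
  rw [Finset.card_pair hbc, Nat.cast_ofNat] at h1 h2
  rw [Finset.sum_pair hbc] at h2
  rw [div_le_iff₀ h1]
  have e1 := Real.sq_sqrt (hs b).le
  have e2 := Real.sq_sqrt (hs c).le
  nlinarith [sq_nonneg (√(s b) - √(s c))]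

end Shares

/-! ### The allocation rule of the experiment -/

section Rule

variable {K n T : ℕ} {r : ℝ} {z : Fin K → Fin n → ℝ}

lemma radius_nonneg : 0 ≤ radius T z :=
  mul_nonneg (Real.sqrt_nonneg _) (Real.iSup_nonneg fun _ => Real.sqrt_nonneg _)

lemma mem_candidates_iff {a : Fin K} : a ∈ candidates T z ↔
    ∀ b, pilotMean z b - radius T z ≤ pilotMean z a + radius T z := by
  have : Nonempty (Fin K) := ⟨a⟩
  simp only [candidates, Finset.mem_filter, Finset.mem_univ, true_and]
  exact ciSup_le_iff (Set.finite_range _).bddAbove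

lemma candidates_nonempty [NeZero K] : (candidates T z).Nonempty := by
  obtain ⟨a, ha⟩ := Finite.exists_max (pilotMean z)
  refine ⟨a, mem_candidates_iff.2 fun b => ?_⟩
  linarith [ha b, radius_nonneg (T := T) (z := z)]

lemma sum_idealRatio [NeZero K] : ∑ a ∈ candidates T z, idealRatio T z a = 1 := by
  have hne := candidates_nonempty (T := T) (z := z)
  by_cases h : ∑ b ∈ candidates T z, spread T z b = 0
  · rw [Finset.sum_congr rfl fun a ha => by rw [idealRatio, if_pos ha, if_pos h]]
    have : ((candidates T z).card : ℝ) ≠ 0 := by exact_mod_cast hne.card_pos.ne'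
    simp [this]
  · rw [Finset.sum_congr rfl fun a ha => by rw [idealRatio, if_pos ha, if_neg h],
      ← Finset.sum_div, div_self h]

lemma sum_allocWeight_pos [NeZero K] (hr : r < 1) : 0 < ∑ a, allocWeight r T z a := by
  have hK : (K : ℝ) ≠ 0 := by exact_mod_cast NeZero.ne K
  calc 0 < 1 - r := by linarith
    _ = ∑ a ∈ candidates T z,
        (idealRatio T z a * (1 - ((K : ℝ) - (candidates T z).card) * (r / K)) - r / K) := by
      rw [Finset.sum_sub_distrib, ← Finset.sum_mul, sum_idealRatio]
      simp
      field_simp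
      ring
    _ ≤ ∑ a ∈ candidates T z, allocWeight r T z a :=
      Finset.sum_le_sum fun a _ => le_max_left _ _
    _ ≤ ∑ a, allocWeight r T z a :=
      Finset.sum_le_sum_of_subset_of_nonneg (Finset.subset_univ _) fun _ _ _ => le_max_right _ _

lemma allocProb_nonneg [NeZero K] (hr : r < 1) (a : Fin K) : 0 ≤ allocProb r T z a :=
  div_nonneg (le_max_right _ _) (sum_allocWeight_pos hr).le

lemma sum_allocProb [NeZero K] (hr : r < 1) : ∑ a, allocProb r T z a = 1 := by
  simp only [allocProb]
  rw [← Finset.sum_div, div_self (sum_allocWeight_pos hr).ne']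

lemma allocProb_le_one [NeZero K] (hr : r < 1) (a : Fin K) : allocProb r T z a ≤ 1 := by
  rw [← sum_allocProb (T := T) (z := z) hr]
  exact Finset.single_le_sum (fun b _ => allocProb_nonneg hr b) (Finset.mem_univ a)

lemma isProbabilityMeasure_armLaw [NeZero K] (hr : r < 1) :
    IsProbabilityMeasure (armLaw r T z) := by
  constructor
  simp only [armLaw, Measure.coe_finsetSum, Finset.sum_apply, Measure.smul_apply, measure_univ,
    smul_eq_mul, mul_one]
  rw [← ENNReal.ofReal_sum_of_nonneg fun a _ => allocProb_nonneg hr a, sum_allocProb hr]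
  simp

lemma allocProb_eq_drawProb [NeZero K] (hr0 : 0 < r)
    (hs : ∀ a ∈ candidates T z, 0 < pilotVar z a) (a : Fin K) :
    allocProb r T z a = drawProb (r / K) (candidates T z) (pilotVar z) a := by
  have hpos := sum_scale_pos candidates_nonempty hs
  have hw : ∀ a ∈ candidates T z, allocWeight r T z a =
      max (share (r / K) (candidates T z) (pilotVar z) a - r / K) 0 := by
    intro a ha
    rw [allocWeight, idealRatio, if_pos ha, if_neg (by exact hpos.ne')]
    rfl
  have hw0 : ∀ a ∉ candidates T z, allocWeight r T z a = 0 := by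
    intro a ha
    rw [allocWeight, idealRatio, if_neg ha, zero_mul, zero_sub]
    exact max_eq_right (by rw [neg_nonpos]; positivity)
  have hsum : ∑ b, allocWeight r T z b = ∑ b ∈ candidates T z,
      max (share (r / K) (candidates T z) (pilotVar z) b - r / K) 0 := by
    rw [← Finset.sum_congr rfl hw]
    exact (Finset.sum_subset (Finset.subset_univ _) fun b _ hb => hw0 b hb).symm
  rw [allocProb, drawProb, hsum]
  split_ifs with ha
  · rw [hw a ha]
  · rw [hw0 a ha, zero_div]

end Rule

/-! ### Sums of observations in the two stages -/

section PilotSums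

variable {K n : ℕ} {Ω : Type*}

/-- The sum of `h` over the pilot rounds of arm `a`. -/
def pilotSum (h : Ω → ℝ) (a : Fin K) (y : Fin K × Fin n → Ω) : ℝ := ∑ i, h (y (a, i))

lemma pilotSum_eq (h : Ω → ℝ) (a : Fin K) (y : Fin K × Fin n → Ω) :
    pilotSum h a y = ∑ j : Fin K × Fin n, (if j.1 = a then h else 0) (y j) := by
  rw [Fintype.sum_prod_type, Finset.sum_eq_single a]
  · simp [pilotSum]
  · intro b _ hb; simp [hb]
  · simp

variable [MeasurableSpace Ω] {q : Measure Ω} [IsProbabilityMeasure q]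

lemma memLp_pilotSum {h : Ω → ℝ} (hh : MemLp h 2 q) (a : Fin K) :
    MemLp (pilotSum (n := n) h a) 2 (Measure.pi fun _ => q) := by
  have : pilotSum (n := n) h a = fun y => ∑ j : Fin K × Fin n, (if j.1 = a then h else 0) (y j) :=
    funext (pilotSum_eq h a)
  rw [this]
  refine memLp_sum_pi (h := fun j : Fin K × Fin n => if j.1 = a then h else 0) fun j => ?_
  split_ifs
  · exact hh
  · exact MemLp.zero

lemma integral_pilotSum_sq {h : Ω → ℝ} (hh : MemLp h 2 q) (h0 : ∫ x, h x ∂q = 0) (a : Fin K) :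
    ∫ y, pilotSum (n := n) h a y ^ 2 ∂(Measure.pi fun _ => q) = n * ∫ x, h x ^ 2 ∂q := by
  simp_rw [pilotSum_eq]
  rw [integral_sum_sq_pi (h := fun j : Fin K × Fin n => if j.1 = a then h else 0),
    Fintype.sum_prod_type, Finset.sum_eq_single a]
  · simp
  · intro b _ hb; simp [hb]
  · simp
  · intro j; split_ifs
    · exact hh
    · exact MemLp.zero
  · intro j; split_ifs <;> simp [h0]

lemma integral_abs_pilotSum_le {h : Ω → ℝ} (hh : MemLp h 2 q) (h0 : ∫ x, h x ∂q = 0)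
    (a : Fin K) {s : ℝ} (hs : ∫ x, h x ^ 2 ∂q ≤ s) :
    ∫ y, |pilotSum (n := n) h a y| ∂(Measure.pi fun _ => q) ≤ √(n * s) := by
  refine integral_abs_le_sqrt (memLp_pilotSum hh a) ?_
  rw [integral_pilotSum_sq hh h0]
  gcongr

lemma integral_exp_pilotSum_le {g h : Ω → ℝ} {b c : Fin K} (hbc : b ≠ c) (hgm : Measurable g)
    (hhm : Measurable h) {C s t : ℝ} (hg : ∀ x, |g x| ≤ C) (hh : ∀ x, |h x| ≤ C)
    (hg0 : ∫ x, g x ∂q = 0) (hh0 : ∫ x, h x ∂q = 0) (hgs : ∫ x, g x ^ 2 ∂q ≤ s)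
    (hht : ∫ x, h x ^ 2 ∂q ≤ t) :
    Integrable (fun y => Real.exp (pilotSum (n := n) g b y + pilotSum h c y))
      (Measure.pi fun _ => q) ∧
    ∫ y, Real.exp (pilotSum (n := n) g b y + pilotSum h c y) ∂(Measure.pi fun _ => q) ≤
      Real.exp (n * (s + t) * (Real.exp C / 2)) := by
  have hC : 0 ≤ C := by
    obtain ⟨x⟩ : Nonempty Ω := q.nonempty_of_neZero
    exact (abs_nonneg _).trans (hg x)
  let k : Fin K × Fin n → Ω → ℝ := fun j => if j.1 = b then g else if j.1 = c then h else 0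
  let u : Fin K × Fin n → ℝ := fun j => if j.1 = b then s else if j.1 = c then t else 0
  have hk : ∀ y, pilotSum (n := n) g b y + pilotSum h c y = ∑ j, k j (y j) := by
    intro y
    rw [pilotSum_eq, pilotSum_eq, ← Finset.sum_add_distrib]
    refine Finset.sum_congr rfl fun j _ => ?_
    simp only [k]
    by_cases h1 : j.1 = b
    · simp [h1, hbc]
    · simp [h1]
  have hu : ∑ j, u j = n * (s + t) := by
    have : ∀ j, u j = (if j.1 = b then s else 0) + (if j.1 = c then t else 0) := by
      intro j
      simp only [u]
      by_cases h1 : j.1 = b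
      · simp [h1, hbc]
      · simp [h1]
    simp_rw [this]
    rw [Finset.sum_add_distrib, Fintype.sum_prod_type_right, Fintype.sum_prod_type_right]
    simp [mul_add]
  simp_rw [hk, ← hu]
  refine integral_exp_sum_pi_le (fun j => ?_) (fun j x => ?_) (fun j => ?_) (fun j => ?_)
  · simp only [k]; split_ifs; exacts [hgm, hhm, measurable_const]
  · simp only [k]; split_ifs; exacts [hg x, hh x, by simpa using hC]
  · simp only [k]; split_ifs; exacts [hg0, hh0, by simp]
  · simp only [k, u]; split_ifs; exacts [hgs, hht, by simp]

end PilotSums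

section DrawSums

variable {K n N T : ℕ} {r : ℝ} {z : Fin K → Fin n → ℝ} {Ω : Type*}

/-- The observation `h` if arm `a` is drawn, and `0` otherwise. -/
def ifDrawn (h : Ω → ℝ) (a : Fin K) (x : Fin K × Ω) : ℝ := if x.1 = a then h x.2 else 0

lemma ifDrawn_sq (h : Ω → ℝ) (a : Fin K) (x : Fin K × Ω) :
    ifDrawn h a x ^ 2 = ifDrawn (fun x => h x ^ 2) a x := by
  unfold ifDrawn
  split_ifs <;> simp

/-- The sum of `h` over the second-stage rounds in which arm `a` is drawn. -/
def drawSum (h : Ω → ℝ) (a : Fin K) (w : Fin N → Fin K × Ω) : ℝ := ∑ t, ifDrawn h a (w t)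

lemma drawSum_sub (g h : Ω → ℝ) (a : Fin K) (w : Fin N → Fin K × Ω) :
    drawSum (fun x => g x - h x) a w = drawSum g a w - drawSum h a w := by
  simp only [drawSum, ← Finset.sum_sub_distrib]
  refine Finset.sum_congr rfl fun t _ => ?_
  unfold ifDrawn
  split_ifs <;> simp

variable [MeasurableSpace Ω] {q : Measure Ω} [IsProbabilityMeasure q]

lemma armLaw_prod_eq : (armLaw r T z).prod q =
    ∑ a, ENNReal.ofReal (allocProb r T z a) • q.map (Prod.mk a) := by
  refine Measure.ext_of_lintegral _ fun g hg => ?_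
  rw [lintegral_prod _ hg.aemeasurable, armLaw, lintegral_finsetSum_measure,
    lintegral_finsetSum_measure]
  refine Finset.sum_congr rfl fun a _ => ?_
  rw [lintegral_smul_measure, lintegral_smul_measure, lintegral_dirac,
    lintegral_map hg measurable_prodMk_left]

lemma integral_armLaw_prod [NeZero K] (hr : r < 1) {g : Fin K × Ω → ℝ} (hg : Measurable g)
    (hi : ∀ a, Integrable (fun x => g (a, x)) q) :
    Integrable g ((armLaw r T z).prod q) ∧
      ∫ x, g x ∂((armLaw r T z).prod q) = ∑ a, allocProb r T z a * ∫ x, g (a, x) ∂q := by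
  have h1 : ∀ a, Integrable g (ENNReal.ofReal (allocProb r T z a) • q.map (Prod.mk a)) := by
    intro a
    refine Integrable.smul_measure ?_ ENNReal.ofReal_ne_top
    exact (integrable_map_measure hg.aestronglyMeasurable
      measurable_prodMk_left.aemeasurable).2 (hi a)
  rw [armLaw_prod_eq]
  refine ⟨integrable_finsetSum_measure.2 fun a _ => h1 a, ?_⟩
  rw [integral_finsetSum_measure fun a _ => h1 a]
  refine Finset.sum_congr rfl fun a _ => ?_
  rw [integral_smul_measure, integral_map measurable_prodMk_left.aemeasurable
    hg.aestronglyMeasurable, ENNReal.toReal_ofReal (allocProb_nonneg hr a), smul_eq_mul]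

lemma measurable_ifDrawn {h : Ω → ℝ} (hh : Measurable h) (a : Fin K) : Measurable (ifDrawn h a) :=
  Measurable.ite (measurable_fst (measurableSet_singleton a)) (hh.comp measurable_snd)
    measurable_const

lemma integral_ifDrawn [NeZero K] (hr : r < 1) {h : Ω → ℝ} (hh : Measurable h)
    (hi : Integrable h q) (a : Fin K) :
    Integrable (ifDrawn h a) ((armLaw r T z).prod q) ∧
      ∫ x, ifDrawn h a x ∂((armLaw r T z).prod q) = allocProb r T z a * ∫ x, h x ∂q := by
  obtain ⟨h1, h2⟩ := integral_armLaw_prod (T := T) (z := z) hr (q := q)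
    (measurable_ifDrawn hh a) fun b => by
      by_cases hb : b = a
      · simpa [ifDrawn, hb] using hi
      · simp [ifDrawn, hb]
  refine ⟨h1, ?_⟩
  rw [h2, Finset.sum_eq_single a]
  · simp [ifDrawn]
  · intro b _ hb; simp [ifDrawn, hb]
  · simp

lemma memLp_ifDrawn [NeZero K] (hr : r < 1) {h : Ω → ℝ} (hh : Measurable h)
    (hi : MemLp h 2 q) (a : Fin K) : MemLp (ifDrawn h a) 2 ((armLaw r T z).prod q) := by
  rw [memLp_two_iff_integrable_sq (measurable_ifDrawn hh a).aestronglyMeasurable]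
  simp_rw [ifDrawn_sq]
  exact (integral_ifDrawn hr (hh.pow_const 2) hi.integrable_sq a).1

lemma measurable_drawSum {h : Ω → ℝ} (hh : Measurable h) (a : Fin K) :
    Measurable (drawSum (N := N) h a) :=
  Finset.measurable_sum _ fun t _ => (measurable_ifDrawn hh a).comp (measurable_pi_apply t)

lemma memLp_drawSum [NeZero K] (hr : r < 1) {h : Ω → ℝ} (hh : Measurable h) (hi : MemLp h 2 q)
    (a : Fin K) :
    MemLp (drawSum (N := N) h a) 2 (Measure.pi fun _ => (armLaw r T z).prod q) := by
  have := isProbabilityMeasure_armLaw (T := T) (z := z) hr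
  exact memLp_sum_pi (h := fun _ => ifDrawn h a) fun t => memLp_ifDrawn hr hh hi a

lemma integral_drawSum_sq [NeZero K] (hr : r < 1) {h : Ω → ℝ} (hh : Measurable h)
    (hi : MemLp h 2 q) (h0 : ∫ x, h x ∂q = 0) (a : Fin K) :
    ∫ w, drawSum (N := N) h a w ^ 2 ∂(Measure.pi fun _ => (armLaw r T z).prod q) =
      N * allocProb r T z a * ∫ x, h x ^ 2 ∂q := by
  have := isProbabilityMeasure_armLaw (T := T) (z := z) hr
  simp only [drawSum]
  rw [integral_sum_sq_pi (h := fun _ => ifDrawn h a) (fun t => memLp_ifDrawn hr hh hi a)]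
  · simp_rw [ifDrawn_sq]
    rw [(integral_ifDrawn hr (hh.pow_const 2) hi.integrable_sq a).2]
    simp [mul_assoc]
  · intro _
    rw [(integral_ifDrawn hr hh (hi.integrable (by norm_num)) a).2, h0, mul_zero]

/-- The number of second-stage draws of an arm has at most the binomial variance. -/
lemma integral_count_sq_le [NeZero K] (hr : r < 1) (a : Fin K) :
    ∫ w, (drawSum (N := N) (fun _ : Ω => 1) a w - N * allocProb r T z a) ^ 2
      ∂(Measure.pi fun _ => (armLaw r T z).prod q) ≤ N := by
  have := isProbabilityMeasure_armLaw (T := T) (z := z) hr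
  set p := allocProb r T z a
  have hp0 : 0 ≤ p := allocProb_nonneg hr a
  have hp1 : p ≤ 1 := allocProb_le_one hr a
  have hm : MemLp (ifDrawn (fun _ : Ω => (1 : ℝ)) a) 2 ((armLaw r T z).prod q) :=
    memLp_ifDrawn hr measurable_const (memLp_const _) a
  have hE := integral_ifDrawn (T := T) (z := z) hr (q := q) (measurable_const (a := (1 : ℝ)))
    (integrable_const _) a
  simp only [integral_const, probReal_univ, smul_eq_mul, mul_one] at hE
  have hs : ∀ w : Fin N → Fin K × Ω, drawSum (fun _ : Ω => 1) a w - N * p =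
      ∑ t, (ifDrawn (fun _ : Ω => 1) a (w t) - p) := by
    intro w
    rw [Finset.sum_sub_distrib]
    simp [drawSum]
  simp_rw [hs]
  rw [integral_sum_sq_pi (h := fun _ x => ifDrawn (fun _ : Ω => 1) a x - p)
    (fun _ => hm.sub (memLp_const p))]
  · have h1 : ∫ x, (ifDrawn (fun _ : Ω => (1 : ℝ)) a x - p) ^ 2 ∂((armLaw r T z).prod q) ≤ 1 := by
      have hle : ∀ x : Fin K × Ω, (ifDrawn (fun _ : Ω => (1 : ℝ)) a x - p) ^ 2 ≤ 1 := by
        intro x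
        unfold ifDrawn
        split_ifs <;> nlinarith
      calc _ ≤ ∫ x, (1 : ℝ) ∂((armLaw r T z).prod q) :=
            integral_mono (hm.sub (memLp_const p)).integrable_sq (integrable_const _) hle
        _ = 1 := by simp
    calc _ ≤ ∑ _t : Fin N, (1 : ℝ) := Finset.sum_le_sum fun _ _ => h1
      _ = N := by simp
  · intro _
    rw [integral_sub hE.1 (integrable_const _), hE.2]
    simp [p]

lemma integral_exp_drawSum_le [NeZero K] (hr : r < 1) {g h : Ω → ℝ} {b c : Fin K} (hbc : b ≠ c)
    (hgm : Measurable g) (hhm : Measurable h) {C s t : ℝ} (hg : ∀ x, |g x| ≤ C)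
    (hh : ∀ x, |h x| ≤ C) (hg0 : ∫ x, g x ∂q = 0) (hh0 : ∫ x, h x ∂q = 0)
    (hgs : ∫ x, g x ^ 2 ∂q ≤ s) (hht : ∫ x, h x ^ 2 ∂q ≤ t) :
    Integrable (fun w => Real.exp (drawSum (N := N) g b w + drawSum h c w))
      (Measure.pi fun _ => (armLaw r T z).prod q) ∧
    ∫ w, Real.exp (drawSum (N := N) g b w + drawSum h c w)
        ∂(Measure.pi fun _ => (armLaw r T z).prod q) ≤
      Real.exp (N * (allocProb r T z b * s + allocProb r T z c * t) * (Real.exp C / 2)) := by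
  have := isProbabilityMeasure_armLaw (T := T) (z := z) hr
  have hC : 0 ≤ C := by
    obtain ⟨x⟩ : Nonempty Ω := q.nonempty_of_neZero
    exact (abs_nonneg _).trans (hg x)
  have hgL : MemLp g 2 q :=
    MemLp.of_bound hgm.aestronglyMeasurable C (Eventually.of_forall hg)
  have hhL : MemLp h 2 q :=
    MemLp.of_bound hhm.aestronglyMeasurable C (Eventually.of_forall hh)
  have hsum : ∀ w : Fin N → Fin K × Ω, drawSum g b w + drawSum h c w =
      ∑ i, (fun x => ifDrawn g b x + ifDrawn h c x) (w i) := fun w => by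
    rw [drawSum, drawSum, ← Finset.sum_add_distrib]
  have hN : N * (allocProb r T z b * s + allocProb r T z c * t) =
      ∑ _i : Fin N, (allocProb r T z b * s + allocProb r T z c * t) := by simp [mul_add]
  simp_rw [hsum, hN]
  have hIg := fun f (hfm : Measurable f) (hf : Integrable f q) (a : Fin K) =>
    integral_ifDrawn (T := T) (z := z) hr (q := q) hfm hf a
  refine integral_exp_sum_pi_le (fun _ => (measurable_ifDrawn hgm b).add
    (measurable_ifDrawn hhm c)) (fun _ x => ?_) (fun _ => ?_) (fun _ => ?_)
  · unfold ifDrawn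
    by_cases h1 : x.1 = b
    · simpa [h1, hbc] using hg _
    · by_cases h2 : x.1 = c
      · simpa [h2, hbc.symm] using hh _
      · simpa [h1, h2] using hC
  · change ∫ x, (ifDrawn g b x + ifDrawn h c x) ∂_ = 0
    rw [integral_add (hIg g hgm (hgL.integrable (by norm_num)) b).1
      (hIg h hhm (hhL.integrable (by norm_num)) c).1,
      (hIg g hgm (hgL.integrable (by norm_num)) b).2,
      (hIg h hhm (hhL.integrable (by norm_num)) c).2, hg0, hh0]
    simp
  · have hsq : ∀ x : Fin K × Ω, (ifDrawn g b x + ifDrawn h c x) ^ 2 =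
        ifDrawn (fun x => g x ^ 2) b x + ifDrawn (fun x => h x ^ 2) c x := by
      intro x
      unfold ifDrawn
      by_cases h1 : x.1 = b
      · simp [h1, hbc]
      · simp [h1]
    change ∫ x, (ifDrawn g b x + ifDrawn h c x) ^ 2 ∂_ ≤ _
    simp_rw [hsq]
    have i1 := hIg _ (hgm.pow_const 2) hgL.integrable_sq b
    have i2 := hIg _ (hhm.pow_const 2) hhL.integrable_sq c
    rw [integral_add i1.1 i2.1, i1.2, i2.2]
    exact add_le_add (mul_le_mul_of_nonneg_left hgs (allocProb_nonneg hr b))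
      (mul_le_mul_of_nonneg_left hht (allocProb_nonneg hr c))

end DrawSums

/-! ### Reduction of the regret to bounds for fixed pilot observations -/

/-- The (upper) mean of `f` is at most `c`: some integrable function above `f` has integral at most
`c`. -/
def MeanLE {Ω : Type*} [MeasurableSpace Ω] (q : Measure Ω) (f : Ω → ℝ) (c : ℝ) : Prop :=
  ∃ F, Integrable F q ∧ (∀ ω, f ω ≤ F ω) ∧ ∫ ω, F ω ∂q ≤ c

namespace MeanLE

variable {Ω ι : Type*} [MeasurableSpace Ω] {q : Measure Ω} {f g : Ω → ℝ} {c d : ℝ}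

lemma of_integrable (hf : Integrable f q) (h : ∫ ω, f ω ∂q ≤ c) : MeanLE q f c :=
  ⟨f, hf, fun _ => le_rfl, h⟩

lemma mono (h : MeanLE q f c) (hg : ∀ ω, g ω ≤ f ω) (hd : c ≤ d) : MeanLE q g d := by
  obtain ⟨F, h1, h2, h3⟩ := h
  exact ⟨F, h1, fun ω => (hg ω).trans (h2 ω), h3.trans hd⟩

lemma add (hf : MeanLE q f c) (hg : MeanLE q g d) : MeanLE q (fun ω => f ω + g ω) (c + d) := by
  obtain ⟨F, h1, h2, h3⟩ := hf
  obtain ⟨G, k1, k2, k3⟩ := hg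
  refine ⟨fun ω => F ω + G ω, h1.add k1, fun ω => add_le_add (h2 ω) (k2 ω), ?_⟩
  rw [integral_add h1 k1]
  exact add_le_add h3 k3

lemma const_mul (hf : MeanLE q f c) {k : ℝ} (hk : 0 ≤ k) :
    MeanLE q (fun ω => k * f ω) (k * c) := by
  obtain ⟨F, h1, h2, h3⟩ := hf
  refine ⟨fun ω => k * F ω, h1.const_mul k, fun ω => mul_le_mul_of_nonneg_left (h2 ω) hk, ?_⟩
  rw [integral_const_mul]
  exact mul_le_mul_of_nonneg_left h3 hk

lemma const [IsProbabilityMeasure q] (c : ℝ) : MeanLE q (fun _ => c) c :=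
  ⟨fun _ => c, integrable_const _, fun _ => le_rfl, by simp⟩

lemma sum {s : Finset ι} {f : ι → Ω → ℝ} {c : ι → ℝ} (h : ∀ i ∈ s, MeanLE q (f i) (c i)) :
    MeanLE q (fun ω => ∑ i ∈ s, f i ω) (∑ i ∈ s, c i) := by
  induction s using Finset.cons_induction with
  | empty => exact ⟨0, integrable_zero _ _ _, by simp, by simp⟩
  | cons i s hi ih =>
    simp_rw [Finset.sum_cons]
    exact (h i (Finset.mem_cons_self i s)).add
      (ih fun j hj => h j (Finset.mem_cons_of_mem hj))

end MeanLE

section Regret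

variable {K n N T : ℕ} {r : ℝ} {μ : Fin K → ℝ} {z : Fin K → Fin n → ℝ}
  {w : Fin N → Fin K × (Fin K → ℝ)} {sel : (Fin K → ℝ) → Fin K}

lemma sampleMean_eq (a : Fin K) : sampleMean z w a =
    ((∑ i, z a i) + drawSum (fun y => y a) a w) / (n + drawSum (fun _ => 1) a w) := by
  have h : ∀ t, (if (w t).1 = a then (w t).2 (w t).1 else 0) = ifDrawn (fun y => y a) a (w t) := by
    intro t
    unfold ifDrawn
    split_ifs with h
    · rw [h]
    · rfl
  simp only [sampleMean, h]
  rfl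

lemma measurable_recommend (hsel : Measurable sel) :
    Measurable fun w : Fin N → Fin K × (Fin K → ℝ) => recommend sel T z w := by
  unfold recommend
  split_ifs
  · exact measurable_const
  · refine hsel.comp (measurable_pi_lambda _ fun a => ?_)
    simp_rw [sampleMean_eq]
    exact (measurable_const.add (measurable_drawSum (measurable_pi_apply a) a)).div
      (measurable_const.add (measurable_drawSum measurable_const a))

/-- It suffices to bound the conditional expectation of the scaled loss for every fixed pilot; no
measurability in the pilot observations is needed, since the lower integral is superadditive. -/
lemma sqrt_mul_regret_le [NeZero K] (hr : r < 1) (hsel : Measurable sel)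
    {Q : Measure (Fin K → ℝ)} [IsProbabilityMeasure Q]
    {H : (Fin K × Fin (pilotSize K r T) → Fin K → ℝ) → ℝ}
    (hH : Integrable H (Measure.pi fun _ => Q))
    (h : ∀ y, MeanLE (Measure.pi fun _ : Fin (T - K * pilotSize K r T) =>
        (armLaw r T (pilotObs y)).prod Q)
      (fun w => √T * ((⨆ a, μ a) - μ (recommend sel T (pilotObs y) w))) (H y)) :
    √T * regret r sel T Q μ ≤ ∫ y, H y ∂(Measure.pi fun _ => Q) := by
  set c : Fin K → ℝ := fun b => √T * ((⨆ a, μ a) - μ b) with hc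
  have hc0 : ∀ b, 0 ≤ c b := fun b => mul_nonneg (Real.sqrt_nonneg _)
    (sub_nonneg.2 (le_ciSup (Set.finite_range μ).bddAbove b))
  have hprob : ∀ y : Fin K × Fin (pilotSize K r T) → Fin K → ℝ,
      IsProbabilityMeasure (armLaw r T (pilotObs y)) := fun y => isProbabilityMeasure_armLaw hr
  -- The bound for fixed pilot observations, in `ENNReal`.
  have hy : ∀ y : Fin K × Fin (pilotSize K r T) → Fin K → ℝ,
      ∑ b, ENNReal.ofReal (c b) *
        (Measure.pi fun _ : Fin (T - K * pilotSize K r T) => (armLaw r T (pilotObs y)).prod Q)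
          {w | recommend sel T (pilotObs y) w = b} ≤ ENNReal.ofReal (H y) := by
    intro y
    obtain ⟨F, hF, hle, hFH⟩ := h y
    have := hprob y
    have hm : Measurable fun w : Fin (T - K * pilotSize K r T) → Fin K × (Fin K → ℝ) =>
      recommend sel T (pilotObs y) w := measurable_recommend hsel
    let A : Fin K → Set (Fin (T - K * pilotSize K r T) → Fin K × (Fin K → ℝ)) := fun b =>
      {w | recommend sel T (pilotObs y) w = b}
    have hA : ∀ b, MeasurableSet (A b) := fun b => hm (measurableSet_singleton b)
    have h1 : ∀ w, ∑ b, ENNReal.ofReal (c b) * (A b).indicator 1 w =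
        ENNReal.ofReal (c (recommend sel T (pilotObs y) w)) := by
      intro w
      rw [Finset.sum_eq_single (recommend sel T (pilotObs y) w)]
      · simp [A]
      · intro b _ hb
        simp [A, Set.indicator, hb.symm]
      · simp
    calc _ = ∫⁻ w, ∑ b, ENNReal.ofReal (c b) * (A b).indicator 1 w
          ∂(Measure.pi fun _ => (armLaw r T (pilotObs y)).prod Q) := by
          rw [lintegral_finsetSum _ fun b _ => (measurable_one.indicator (hA b)).const_mul _]
          refine Finset.sum_congr rfl fun b _ => ?_
          rw [lintegral_const_mul _ (measurable_one.indicator (hA b)),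
            lintegral_indicator_one (hA b)]
      _ ≤ ∫⁻ w, ENNReal.ofReal (F w) ∂(Measure.pi fun _ => (armLaw r T (pilotObs y)).prod Q) := by
          refine lintegral_mono fun w => ?_
          rw [h1 w]
          exact ENNReal.ofReal_le_ofReal (hle w)
      _ = ENNReal.ofReal (∫ w, F w ∂(Measure.pi fun _ => (armLaw r T (pilotObs y)).prod Q)) :=
          (ofReal_integral_eq_lintegral_ofReal hF
            (Eventually.of_forall fun w => (hc0 _).trans (hle w))).symm
      _ ≤ _ := ENNReal.ofReal_le_ofReal hFH
  have hH0 : ∀ y, 0 ≤ H y := fun y => by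
    obtain ⟨F, -, hle, hFH⟩ := h y
    exact (integral_nonneg fun w => (hc0 _).trans (hle w)).trans hFH
  have hfin : ∀ b, recommendProb r sel T Q b ≠ ⊤ := fun b => by
    refine ne_top_of_le_ne_top ENNReal.one_ne_top ?_
    calc recommendProb r sel T Q b ≤ ∫⁻ _y : Fin K × Fin (pilotSize K r T) → Fin K → ℝ, 1
          ∂(Measure.pi fun _ => Q) := lintegral_mono fun y => by
            have := hprob y
            exact prob_le_one
      _ = 1 := by simp
  have hsum : √T * regret r sel T Q μ = ∑ b, c b * (recommendProb r sel T Q b).toReal := by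
    rw [regret, Finset.mul_sum]
    exact Finset.sum_congr rfl fun b _ => by rw [hc]; ring
  rw [hsum, ← ENNReal.ofReal_le_ofReal_iff (integral_nonneg hH0),
    ofReal_integral_eq_lintegral_ofReal hH (Eventually.of_forall hH0),
    ENNReal.ofReal_sum_of_nonneg fun b _ => mul_nonneg (hc0 b) ENNReal.toReal_nonneg]
  simp_rw [fun b => ENNReal.ofReal_mul (q := (recommendProb r sel T Q b).toReal) (hc0 b),
    fun b => ENNReal.ofReal_toReal (hfin b)]
  refine le_trans ?_ (lintegral_mono hy)
  have hadd : ∀ (s : Finset (Fin K)) (g : Fin K → (Fin K × Fin (pilotSize K r T) → Fin K → ℝ) →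
      ENNReal), ∑ b ∈ s, ∫⁻ y, g b y ∂(Measure.pi fun _ => Q) ≤
      ∫⁻ y, ∑ b ∈ s, g b y ∂(Measure.pi fun _ => Q) := by
    intro s g
    induction s using Finset.cons_induction with
    | empty => simp
    | cons b s hb ih =>
      simp_rw [Finset.sum_cons]
      exact (add_le_add le_rfl ih).trans (le_lintegral_add _ _)
  refine le_trans (Finset.sum_le_sum fun b _ => ?_) (hadd _ _)
  exact lintegral_const_mul_le _ _

/-! ### Losses in terms of the noise -/

/-- The centred sum of the pilot observations of arm `a`. -/
def pilotNoise (μ : Fin K → ℝ) (z : Fin K → Fin n → ℝ) (a : Fin K) : ℝ := ∑ i, (z a i - μ a)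

/-- The centred sum of the second-stage observations of arm `a`. -/
def drawNoise (μ : Fin K → ℝ) (w : Fin N → Fin K × (Fin K → ℝ)) (a : Fin K) : ℝ :=
  drawSum (fun y => y a - μ a) a w

/-- The number of observations of arm `a` in both stages. -/
def count (n : ℕ) (w : Fin N → Fin K × (Fin K → ℝ)) (a : Fin K) : ℝ :=
  n + drawSum (fun _ => 1) a w

lemma le_count (a : Fin K) : (n : ℝ) ≤ count n w a := by
  have : 0 ≤ drawSum (fun _ => 1) a w := Finset.sum_nonneg fun t _ => by
    unfold ifDrawn; split_ifs <;> norm_num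
  unfold count
  linarith

lemma pilotMean_eq (hn : 0 < n) (a : Fin K) : pilotMean z a = μ a + pilotNoise μ z a / n := by
  have : (n : ℝ) ≠ 0 := by positivity
  rw [pilotMean, pilotNoise, Finset.sum_sub_distrib]
  simp
  field_simp
  ring

lemma sampleMean_eq_add (hn : 0 < n) (a : Fin K) :
    sampleMean z w a = μ a + (pilotNoise μ z a + drawNoise μ w a) / count n w a := by
  have h1 : 0 < count n w a := lt_of_lt_of_le (by exact_mod_cast hn) (le_count a)
  have h2 : drawNoise μ w a = drawSum (fun y => y a) a w - μ a * drawSum (fun _ => 1) a w := by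
    rw [drawNoise, drawSum_sub, drawSum, drawSum, drawSum, Finset.mul_sum]
    congr 1
    refine Finset.sum_congr rfl fun t _ => ?_
    unfold ifDrawn; split_ifs <;> simp
  rw [sampleMean_eq, h2, pilotNoise, Finset.sum_sub_distrib, eq_comm, ← count]
  have h3 : drawSum (fun _ => (1 : ℝ)) a w = count n w a - n := by simp [count]
  rw [h3]
  simp
  field_simp
  ring

lemma recommend_of_singleton {b : Fin K} (h : candidates T z = {b}) :
    recommend sel T z w = b := by
  have hex : ∃ a, candidates T z = {a} := ⟨b, h⟩
  rw [recommend, dif_pos hex]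
  exact Finset.singleton_injective (hex.choose_spec.symm.trans h)

lemma recommend_of_not_singleton (h : ¬ ∃ a, candidates T z = {a}) :
    recommend sel T z w = sel (sampleMean z w) := by
  rw [recommend, dif_neg h]

/-- The gap of the recommended arm is at most the difference of two noise terms. -/
lemma gap_le (hn : 0 < n) (hsel_max : ∀ (x : Fin K → ℝ) (b : Fin K), x b ≤ x (sel x))
    (h : ¬ ∃ a, candidates T z = {a}) (b : Fin K) :
    μ b - μ (recommend sel T z w) ≤
      (pilotNoise μ z (recommend sel T z w) + drawNoise μ w (recommend sel T z w)) /
        count n w (recommend sel T z w) - (pilotNoise μ z b + drawNoise μ w b) / count n w b := by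
  rw [recommend_of_not_singleton h]
  have := hsel_max (sampleMean z w) b
  rw [sampleMean_eq_add (μ := μ) hn b, sampleMean_eq_add (μ := μ) hn] at this
  linarith

/-- A bound for the gap of the recommended arm that holds whatever the pilot observations are. -/
lemma gap_le_sum_noise (hn : 0 < n)
    (hsel_max : ∀ (x : Fin K → ℝ) (b : Fin K), x b ≤ x (sel x)) (b : Fin K) :
    μ b - μ (recommend sel T z w) ≤ (∑ a, (|pilotNoise μ z a| + |drawNoise μ w a|)) / n := by
  have hn' : (0 : ℝ) < n := by exact_mod_cast hn
  set f : Fin K → ℝ := fun a => |pilotNoise μ z a| + |drawNoise μ w a|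
  have hf : ∀ a, 0 ≤ f a := fun a => by positivity
  set c := recommend sel T z w with hc
  rcases eq_or_ne c b with hcb | hcb
  · rw [hcb, sub_self]
    exact div_nonneg (Finset.sum_nonneg fun a _ => hf a) hn'.le
  have hpair : f c + f b ≤ ∑ a, f a := by
    rw [← Finset.sum_pair hcb]
    exact Finset.sum_le_sum_of_subset_of_nonneg (Finset.subset_univ _) fun a _ _ => hf a
  suffices h : μ b - μ c ≤ f c / n + f b / n from
    h.trans (by rw [← add_div]; gcongr)
  by_cases h : ∃ a, candidates T z = {a}
  · obtain ⟨a, ha⟩ := h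
    have hca : c = a := recommend_of_singleton ha
    have : Nonempty (Fin K) := ⟨b⟩
    obtain ⟨d, hd⟩ := Finite.exists_max (pilotMean z)
    have hdmem : d ∈ candidates T z := mem_candidates_iff.2 fun e => by
      linarith [hd e, radius_nonneg (T := T) (z := z)]
    rw [ha, Finset.mem_singleton] at hdmem
    have h1 := hd b
    rw [hdmem, ← hca, pilotMean_eq (μ := μ) hn, pilotMean_eq (μ := μ) hn] at h1
    have h2 : pilotNoise μ z c / n ≤ f c / n := by
      gcongr
      exact (le_abs_self _).trans (le_add_of_nonneg_right (abs_nonneg _))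
    have h3 : -(pilotNoise μ z b / n) ≤ f b / n := by
      rw [← neg_div]
      gcongr
      exact (neg_le_abs _).trans (le_add_of_nonneg_right (abs_nonneg _))
    linarith
  · have h1 := gap_le (μ := μ) (w := w) hn hsel_max h b
    have h2 : ∀ a, |(pilotNoise μ z a + drawNoise μ w a) / count n w a| ≤ f a / n := by
      intro a
      have := le_count (n := n) (w := w) a
      rw [abs_div, abs_of_pos (hn'.trans_le this)]
      gcongr
      exact abs_add_le _ _
    have h3 := (abs_le.1 (h2 c)).2
    have h4 := (abs_le.1 (h2 b)).1
    rw [← hc] at h1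
    linarith

end Regret

/-! ### Consequences of typical pilot observations -/

section Typical

variable {K n N T : ℕ} {μ : Fin K → ℝ} {z : Fin K → Fin n → ℝ} {star : Fin K}
  {w : Fin N → Fin K × (Fin K → ℝ)} {sel : (Fin K → ℝ) → Fin K} {ρ C Λ : ℝ}

lemma abs_pilotNoise_div_le (hT : 0 < T) (hρ : 0 < ρ) (hn : ρ * T / 2 ≤ n)
    (hx : ∀ a, |pilotNoise μ z a| ≤ C * √T) (a : Fin K) :
    |pilotNoise μ z a / n| ≤ 2 * C / ρ / √T := by
  have hT' : (0 : ℝ) < T := by exact_mod_cast hT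
  have hn' : (0 : ℝ) < n := lt_of_lt_of_le (by positivity) hn
  have hs := Real.sqrt_pos.2 hT'
  have hC : 0 ≤ C * √T := (abs_nonneg _).trans (hx a)
  rw [abs_div, abs_of_pos hn', div_div, div_le_div_iff₀ hn' (by positivity)]
  have e := Real.mul_self_sqrt hT'.le
  calc |pilotNoise μ z a| * (ρ * √T) ≤ C * √T * (ρ * √T) := by gcongr; exact hx a
    _ = C * (ρ * (√T * √T)) := by ring
    _ = C * (ρ * T) := by rw [e]
    _ ≤ C * (2 * n) := by
      have hC' : 0 ≤ C := nonneg_of_mul_nonneg_left hC hs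
      exact mul_le_mul_of_nonneg_left (by linarith) hC'
    _ = 2 * C * n := by ring

/-- If the confidence radius dominates the pilot noise, the best arm stays a candidate. -/
lemma star_mem_candidates (hT : 0 < T) (hρ : 0 < ρ) (hn : ρ * T / 2 ≤ n)
    (hx : ∀ a, |pilotNoise μ z a| ≤ C * √T) (hstar : ∀ a, μ a ≤ μ star) (hΛ : 0 < Λ)
    (hrad : Λ + 4 * C / ρ ≤ 2 * (√T * radius T z)) : star ∈ candidates T z := by
  have hT' : (0 : ℝ) < T := by exact_mod_cast hT
  have hn' : 0 < n := by
    have : (0 : ℝ) < n := lt_of_lt_of_le (by positivity) hn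
    exact_mod_cast this
  have hs := Real.sqrt_pos.2 hT'
  refine mem_candidates_iff.2 fun b => ?_
  rw [pilotMean_eq (μ := μ) hn', pilotMean_eq (μ := μ) hn']
  have h1 := (abs_le.1 (abs_pilotNoise_div_le hT hρ hn hx b)).2
  have h2 := (abs_le.1 (abs_pilotNoise_div_le hT hρ hn hx star)).1
  have h3 : 4 * C / ρ / √T ≤ 2 * radius T z := by
    rw [div_le_iff₀ hs]; linarith
  have h4 : 4 * C / ρ / √T = 2 * C / ρ / √T + 2 * C / ρ / √T := by ring
  linarith [hstar b]

lemma gap_le_of_mem_candidates (hT : 0 < T) (hρ : 0 < ρ) (hn : ρ * T / 2 ≤ n)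
    (hx : ∀ a, |pilotNoise μ z a| ≤ C * √T) {a : Fin K} (ha : a ∈ candidates T z) :
    μ star - μ a ≤ 2 * radius T z + 4 * C / ρ / √T := by
  have hT' : (0 : ℝ) < T := by exact_mod_cast hT
  have hn' : 0 < n := by
    have : (0 : ℝ) < n := lt_of_lt_of_le (by positivity) hn
    exact_mod_cast this
  have h := mem_candidates_iff.1 ha star
  rw [pilotMean_eq (μ := μ) hn', pilotMean_eq (μ := μ) hn'] at h
  have h1 := (abs_le.1 (abs_pilotNoise_div_le hT hρ hn hx a)).2
  have h2 := (abs_le.1 (abs_pilotNoise_div_le hT hρ hn hx star)).1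
  have h4 : 4 * C / ρ / √T = 2 * C / ρ / √T + 2 * C / ρ / √T := by ring
  linarith

lemma le_gap_of_notMem_candidates (hT : 0 < T) (hρ : 0 < ρ) (hn : ρ * T / 2 ≤ n)
    (hx : ∀ a, |pilotNoise μ z a| ≤ C * √T) (hstar : ∀ a, μ a ≤ μ star)
    (hrad : Λ + 4 * C / ρ ≤ 2 * (√T * radius T z)) {a : Fin K} (ha : a ∉ candidates T z) :
    Λ ≤ √T * (μ star - μ a) := by
  have hT' : (0 : ℝ) < T := by exact_mod_cast hT
  have hs := Real.sqrt_pos.2 hT'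
  have hn' : 0 < n := by
    have : (0 : ℝ) < n := lt_of_lt_of_le (by positivity) hn
    exact_mod_cast this
  rw [mem_candidates_iff] at ha
  push Not at ha
  obtain ⟨c, hc⟩ := ha
  rw [pilotMean_eq (μ := μ) hn', pilotMean_eq (μ := μ) hn'] at hc
  have h1 := (abs_le.1 (abs_pilotNoise_div_le hT hρ hn hx a)).1
  have h2 := (abs_le.1 (abs_pilotNoise_div_le hT hρ hn hx c)).2
  have h3 : 2 * radius T z - 4 * C / ρ / √T ≤ μ star - μ a := by
    have h4 : 4 * C / ρ / √T = 2 * C / ρ / √T + 2 * C / ρ / √T := by ring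
    linarith [hstar c]
  have h5 := mul_le_mul_of_nonneg_left h3 hs.le
  rw [mul_sub, mul_div_cancel₀ _ hs.ne'] at h5
  linarith

/-- Replacing the inverse of a frequency `x ≥ ρ / 2` by the inverse of its limit `p ≥ ρ`. -/
lemma abs_mul_inv_sub_inv_le {x p κ y : ℝ} (hρ : 0 < ρ) (hx : ρ / 2 ≤ x) (hp : ρ ≤ p) (hκ : 0 < κ) :
    |y * (x⁻¹ - p⁻¹)| ≤ (κ * y ^ 2 + (x - p) ^ 2 / κ) / ρ ^ 2 := by
  have hx0 : 0 < x := lt_of_lt_of_le (by positivity) hx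
  have hp0 : 0 < p := hρ.trans_le hp
  have h1 : |y * (x⁻¹ - p⁻¹)| = |y| * |x - p| / (x * p) := by
    rw [abs_mul, inv_sub_inv hx0.ne' hp0.ne', abs_div, abs_of_pos (mul_pos hx0 hp0), abs_sub_comm,
      mul_div_assoc]
  have h2 : ρ ^ 2 / 2 ≤ x * p := by nlinarith
  have h3 : 2 * (|y| * |x - p|) ≤ κ * y ^ 2 + (x - p) ^ 2 / κ := by
    have := sq_nonneg (κ * |y| - |x - p|)
    rw [← sq_abs y, ← sq_abs (x - p), ← sub_nonneg]
    have h4 : κ * |y| ^ 2 + |x - p| ^ 2 / κ - 2 * (|y| * |x - p|) =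
        (κ * |y| - |x - p|) ^ 2 / κ := by
      field_simp
      ring
    rw [h4]
    positivity
  rw [h1, le_div_iff₀ (by positivity), div_mul_eq_mul_div, div_le_iff₀ (mul_pos hx0 hp0)]
  have h5 : 0 ≤ |y| * |x - p| := by positivity
  have h6 : 0 ≤ κ * y ^ 2 + (x - p) ^ 2 / κ := by linarith
  nlinarith [mul_le_mul_of_nonneg_left h2 h6]

/-- The loss in terms of the noise, when the pilot observations are typical and leave several
candidates. The first term bounds the loss from recommending an eliminated arm. For a candidate, the
noise is replaced by an approximation `x a`, and its frequency by a deterministic share `p a`; the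
resulting main term is bounded by means of `t ≤ β + γ exp (l t)`. -/
lemma sqrt_mul_gap_le (hT : 0 < T) (hρ : 0 < ρ) (hn : ρ * T / 2 ≤ n)
    (hx : ∀ a, |pilotNoise μ z a| ≤ C * √T) (hstar : ∀ a, μ a ≤ μ star) (hΛ : 0 < Λ)
    (hrad : Λ + 4 * C / ρ ≤ 2 * (√T * radius T z))
    (hsel_max : ∀ (x : Fin K → ℝ) (b : Fin K), x b ≤ x (sel x))
    (hns : ¬ ∃ a, candidates T z = {a}) {p x : Fin K → ℝ} (hp : ∀ a ∈ candidates T z, ρ ≤ p a)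
    {β γ l κ : ℝ} (hβ : 0 ≤ β) (hγ : 0 ≤ γ) (hκ : 0 < κ)
    (htan : ∀ t, t ≤ β + γ * Real.exp (l * t)) :
    √T * (μ star - μ (recommend sel T z w)) ≤
      8 * K / (ρ ^ 2 * Λ) * (∑ a, (pilotNoise μ z a ^ 2 + drawNoise μ w a ^ 2)) / T +
      ∑ a ∈ candidates T z, (|pilotNoise μ z a + drawNoise μ w a - x a| / (ρ * √T) +
        (κ * ((pilotNoise μ z a + drawNoise μ w a) ^ 2 / T) +
          (count n w a / T - p a) ^ 2 / κ) / ρ ^ 2) +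
      (β + γ * ∑ b ∈ (candidates T z).erase star,
        Real.exp (l * ((x b / p b - x star / p star) / √T))) := by
  have hT' : (0 : ℝ) < T := by exact_mod_cast hT
  have hs := Real.sqrt_pos.2 hT'
  have hn0 : (0 : ℝ) < n := lt_of_lt_of_le (by positivity) hn
  have hn' : 0 < n := by exact_mod_cast hn0
  have hstarS := star_mem_candidates hT hρ hn hx hstar hΛ hrad
  have hss := Real.mul_self_sqrt hT'.le
  set X : Fin K → ℝ := fun a => pilotNoise μ z a + drawNoise μ w a with hX
  set E : Fin K → ℝ := fun a => |X a - x a| / (ρ * √T) +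
    (κ * (X a ^ 2 / T) + (count n w a / T - p a) ^ 2 / κ) / ρ ^ 2 with hE
  have hE0 : ∀ a, 0 ≤ E a := fun a => by positivity
  set A := 8 * K / (ρ ^ 2 * Λ) * (∑ a, (pilotNoise μ z a ^ 2 + drawNoise μ w a ^ 2)) / T with hA
  have hA0 : 0 ≤ A := by
    have : 0 ≤ ∑ a, (pilotNoise μ z a ^ 2 + drawNoise μ w a ^ 2) :=
      Finset.sum_nonneg fun a _ => by positivity
    positivity
  set G := ∑ b ∈ (candidates T z).erase star,
    Real.exp (l * ((x b / p b - x star / p star) / √T)) with hG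
  have hG0 : 0 ≤ G := Finset.sum_nonneg fun b _ => (Real.exp_pos _).le
  have hES0 : 0 ≤ ∑ a ∈ candidates T z, E a := Finset.sum_nonneg fun a _ => hE0 a
  set b := recommend sel T z w with hb
  change √T * (μ star - μ b) ≤ A + ∑ a ∈ candidates T z, E a + (β + γ * G)
  by_cases hbS : b ∈ candidates T z
  · rcases eq_or_ne b star with hbs | hbs
    · rw [hbs, sub_self, mul_zero]
      positivity
    -- A candidate is recommended.
    have h1 := gap_le (μ := μ) (w := w) hn' hsel_max hns star
    rw [← hb] at h1
    have hfreq : ∀ a, ρ / 2 ≤ count n w a / T := fun a => by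
      rw [le_div_iff₀ hT']
      linarith [le_count (n := n) (w := w) a]
    have hkey : ∀ a ∈ candidates T z,
        |√T * (X a / count n w a) - x a / p a / √T| ≤ E a := by
      intro a ha
      have hc : 0 < count n w a := hn0.trans_le (le_count a)
      have hp0 : 0 < p a := hρ.trans_le (hp a ha)
      have e1 : √T * (X a / count n w a) - x a / p a / √T =
          X a / √T * ((count n w a / T)⁻¹ - (p a)⁻¹) + (X a - x a) / (p a * √T) := by
        field_simp
        rw [Real.sq_sqrt hT'.le]
        ring
      rw [e1, add_comm]
      refine (abs_add_le _ _).trans (add_le_add ?_ ?_)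
      · rw [abs_div, abs_of_pos (mul_pos hp0 hs)]
        gcongr
        exact hp a ha
      · have := abs_mul_inv_sub_inv_le (y := X a / √T) hρ (hfreq a) (hp a ha) hκ
        rwa [div_pow, Real.sq_sqrt hT'.le] at this
    have h2 : √T * (μ star - μ b) ≤ (x b / p b - x star / p star) / √T + (E b + E star) := by
      have h3 := (abs_le.1 (hkey b hbS)).2
      have h4 := (abs_le.1 (hkey star hstarS)).1
      have h5 : √T * (μ star - μ b) ≤
          √T * (X b / count n w b) - √T * (X star / count n w star) := by
        rw [← mul_sub]
        exact mul_le_mul_of_nonneg_left h1 hs.le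
      rw [sub_div]
      linarith
    have h3 : E b + E star ≤ ∑ a ∈ candidates T z, E a := by
      rw [← Finset.sum_pair hbs]
      refine Finset.sum_le_sum_of_subset_of_nonneg ?_ fun a _ _ => hE0 a
      intro a ha
      rcases Finset.mem_insert.1 ha with rfl | ha
      · exact hbS
      · rwa [Finset.mem_singleton.1 ha]
    have h4 : Real.exp (l * ((x b / p b - x star / p star) / √T)) ≤ G :=
      Finset.single_le_sum
        (f := fun b => Real.exp (l * ((x b / p b - x star / p star) / √T)))
        (fun b _ => (Real.exp_pos _).le) (Finset.mem_erase.2 ⟨hbs, hbS⟩)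
    have h5 := htan ((x b / p b - x star / p star) / √T)
    have h6 := mul_le_mul_of_nonneg_left h4 hγ
    linarith
  · -- An eliminated arm is recommended: its gap is large, hence so is the noise.
    have h1 := le_gap_of_notMem_candidates hT hρ hn hx hstar hrad hbS
    have h2 := gap_le_sum_noise (T := T) (μ := μ) (z := z) (w := w) hn' hsel_max star
    rw [← hb] at h2
    set g := √T * (μ star - μ b) with hg
    set R := ∑ a, (|pilotNoise μ z a| + |drawNoise μ w a|) with hR
    have hR0 : 0 ≤ R := Finset.sum_nonneg fun a _ => by positivity
    have h3 : g ≤ 2 / (ρ * √T) * R := by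
      calc g ≤ √T * (R / n) := mul_le_mul_of_nonneg_left h2 hs.le
        _ ≤ √T * (R / (ρ * T / 2)) := by gcongr
        _ = 2 / (ρ * √T) * R := by
          field_simp
          rw [Real.sq_sqrt hT'.le]
          ring
    have h4 : R ^ 2 ≤ 2 * K * ∑ a, (pilotNoise μ z a ^ 2 + drawNoise μ w a ^ 2) := by
      have h5 := sq_sum_le_card_mul_sum_sq (s := (Finset.univ : Finset (Fin K)))
        (f := fun a => |pilotNoise μ z a| + |drawNoise μ w a|)
      rw [Finset.card_univ, Fintype.card_fin] at h5
      calc R ^ 2 ≤ K * ∑ a, (|pilotNoise μ z a| + |drawNoise μ w a|) ^ 2 := h5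
        _ ≤ K * ∑ a, 2 * (pilotNoise μ z a ^ 2 + drawNoise μ w a ^ 2) := by
          gcongr with a
          have := add_sq_le (a := |pilotNoise μ z a|) (b := |drawNoise μ w a|)
          rwa [sq_abs, sq_abs] at this
        _ = _ := by rw [← Finset.mul_sum]; ring
    have h5 : g ≤ A := by
      have hgΛ : g * Λ ≤ (2 / (ρ * √T) * R) ^ 2 := by nlinarith
      have h6 : (2 / (ρ * √T) * R) ^ 2 ≤ A * Λ := by
        calc (2 / (ρ * √T) * R) ^ 2 = 4 / (ρ ^ 2 * T) * R ^ 2 := by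
              rw [mul_pow, div_pow, mul_pow, Real.sq_sqrt hT'.le]; norm_num
          _ ≤ 4 / (ρ ^ 2 * T) *
              (2 * K * ∑ a, (pilotNoise μ z a ^ 2 + drawNoise μ w a ^ 2)) := by gcongr
          _ = A * Λ := by rw [hA]; field_simp; ring
      exact le_of_mul_le_mul_right (hgΛ.trans h6) hΛ
    have h7 : 0 ≤ γ * G := mul_nonneg hγ hG0
    linarith

end Typical

/-! ### The mean loss given typical pilot observations -/

section Conditional

variable {K n N T : ℕ} {r : ℝ} {μ : Fin K → ℝ} {z : Fin K → Fin n → ℝ} {star : Fin K}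
  {sel : (Fin K → ℝ) → Fin K} {ρ C Λ : ℝ} {q : Measure (Fin K → ℝ)}

lemma integral_drawNoise_sq_le [NeZero K] [IsProbabilityMeasure q] (hr : r < 1) (hNT : N ≤ T)
    {a : Fin K} (hm : MemLp (fun y => y a - μ a) 2 q) (h0 : ∫ y, (y a - μ a) ∂q = 0) {s : ℝ}
    (hs : ∫ y, (y a - μ a) ^ 2 ∂q ≤ s) :
    MeanLE (Measure.pi fun _ : Fin N => (armLaw r T z).prod q) (fun w => drawNoise μ w a ^ 2)
      (T * s) := by
  have hX : Measurable fun y : Fin K → ℝ => y a - μ a := by fun_prop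
  have := isProbabilityMeasure_armLaw (T := T) (z := z) hr
  refine .of_integrable (memLp_drawSum hr hX hm a).integrable_sq ?_
  have h1 := integral_drawSum_sq (N := N) (T := T) (z := z) hr hX hm h0 a
  have h2 : (0 : ℝ) ≤ ∫ y, (y a - μ a) ^ 2 ∂q := integral_nonneg fun _ => sq_nonneg _
  have h3 := allocProb_le_one (T := T) (z := z) hr a
  have h4 := allocProb_nonneg (T := T) (z := z) hr a
  have h5 : (N : ℝ) ≤ T := by exact_mod_cast hNT
  calc _ = N * allocProb r T z a * ∫ y, (y a - μ a) ^ 2 ∂q := h1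
    _ ≤ T * 1 * s := by gcongr
    _ = T * s := by ring

lemma meanLE_drawNoise_sub_core [NeZero K] [IsProbabilityMeasure q] (hr : r < 1) (hNT : N ≤ T)
    {a : Fin K} (hm : MemLp (fun y => y a - μ a) 2 q) (h0 : ∫ y, (y a - μ a) ∂q = 0) {M ε : ℝ}
    (hM : 0 ≤ M) (hε : ∫ y, tail M (y a - μ a) ^ 2 ∂q ≤ ε) :
    MeanLE (Measure.pi fun _ : Fin N => (armLaw r T z).prod q)
      (fun w => |drawNoise μ w a - drawSum (core q M fun y => y a - μ a) a w|) (√(T * ε)) := by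
  have hX : Measurable fun y : Fin K → ℝ => y a - μ a := by fun_prop
  have := isProbabilityMeasure_armLaw (T := T) (z := z) hr
  have hY : Measurable fun y => (y a - μ a) - core q M (fun y => y a - μ a) y :=
    hX.sub (measurable_core hX)
  have hYm : MemLp (fun y => (y a - μ a) - core q M (fun y => y a - μ a) y) 2 q :=
    hm.sub (memLp_core hX hM)
  have e : ∀ w : Fin N → Fin K × (Fin K → ℝ),
      drawNoise μ w a - drawSum (core q M fun y => y a - μ a) a w =
      drawSum (fun y => (y a - μ a) - core q M (fun y => y a - μ a) y) a w := fun w => by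
    rw [drawNoise, ← drawSum_sub]
  simp_rw [e]
  have hL := memLp_drawSum (N := N) (T := T) (z := z) hr hY hYm a
  refine .of_integrable (hL.integrable (by norm_num)).abs (integral_abs_le_sqrt hL ?_)
  rw [integral_drawSum_sq hr hY hYm (integral_sub_core hX hm h0 hM)]
  have h2 : (0 : ℝ) ≤ ∫ y, ((y a - μ a) - core q M (fun y => y a - μ a) y) ^ 2 ∂q :=
    integral_nonneg fun _ => sq_nonneg _
  have h3 := allocProb_le_one (T := T) (z := z) hr a
  have h4 := allocProb_nonneg (T := T) (z := z) hr a
  have h5 : (N : ℝ) ≤ T := by exact_mod_cast hNT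
  calc _ ≤ T * 1 * ε := by
        gcongr
        exact (integral_sub_core_sq_le hX hm h0 hM).trans hε
    _ = T * ε := by ring

lemma meanLE_count [NeZero K] [IsProbabilityMeasure q] (hr : r < 1) (hT : 0 < T) (hNT : N ≤ T)
    {a : Fin K} {p δ : ℝ} (hp : |(n + N * allocProb r T z a) / T - p| ≤ δ) :
    MeanLE (Measure.pi fun _ : Fin N => (armLaw r T z).prod q)
      (fun w => (count n w a / T - p) ^ 2) (2 / T + 2 * δ ^ 2) := by
  have := isProbabilityMeasure_armLaw (T := T) (z := z) hr
  have hT' : (0 : ℝ) < T := by exact_mod_cast hT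
  have h5 : (N : ℝ) ≤ T := by exact_mod_cast hNT
  have h1 : MeanLE (Measure.pi fun _ : Fin N => (armLaw r T z).prod q)
      (fun w => (drawSum (fun _ => 1) a w - N * allocProb r T z a) ^ 2) N :=
    .of_integrable ((memLp_drawSum hr measurable_const (memLp_const _) a).sub
      (memLp_const _)).integrable_sq (integral_count_sq_le hr a)
  refine ((h1.const_mul (k := 2 / T ^ 2) (by positivity)).add
    (.const (2 * δ ^ 2))).mono (fun w => ?_) ?_
  · have e : count n w a / T - p = (drawSum (fun _ => 1) a w - N * allocProb r T z a) / T +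
        ((n + N * allocProb r T z a) / T - p) := by
      rw [count]; field_simp; ring
    rw [e]
    refine (add_sq_le).trans ?_
    have h6 := sq_le_sq'
      (by linarith [abs_le.1 hp, abs_nonneg ((n + N * allocProb r T z a) / T - p)]) (abs_le.1 hp).2
    rw [div_pow]
    calc _ = 2 / (T : ℝ) ^ 2 * (drawSum (fun _ => 1) a w - N * allocProb r T z a) ^ 2 +
          2 * ((n + N * allocProb r T z a) / T - p) ^ 2 := by ring
      _ ≤ _ := by gcongr
  · gcongr
    rw [div_mul_eq_mul_div, div_le_div_iff₀ (by positivity) hT']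
    nlinarith

/-- Comparison of the variance proxy in the exponent with its limit. -/
lemma variance_proxy_le {x p s s₁ θ η δ c : ℝ} (hρ : 0 < ρ) (hp : ρ ≤ p) (hp1 : p ≤ 1)
    (hs0 : 0 ≤ s) (hs : s ≤ s₁) (hη : 0 ≤ η) (hδ : 0 ≤ δ) (hθ : 0 ≤ θ) (hx : x ≤ p - ρ + δ)
    (hc0 : 0 ≤ c) (hc : c ≤ 1 + θ) (hθ1 : θ ≤ 1) :
    x * ((s + η) / p ^ 2) * c ≤
      (p - ρ) * s / p ^ 2 + (s₁ * θ + 2 * η + 2 * δ * (s₁ + η)) / ρ ^ 2 := by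
  have hp0 : 0 < p := hρ.trans_le hp
  have h1 : x * (s + η) * c ≤ (p - ρ) * s + (s₁ * θ + 2 * η + 2 * δ * (s₁ + η)) := by
    calc x * (s + η) * c ≤ (p - ρ + δ) * (s + η) * (1 + θ) := by
          have : 0 ≤ p - ρ + δ := by linarith
          gcongr
      _ = (p - ρ) * s + ((p - ρ) * (s * θ) + (p - ρ) * (η * (1 + θ)) + δ * (s + η) * (1 + θ)) := by
          ring
      _ ≤ (p - ρ) * s + (1 * (s₁ * θ) + 1 * (η * (1 + 1)) + δ * (s₁ + η) * (1 + 1)) := by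
          have : 0 ≤ s₁ := hs0.trans hs
          gcongr <;> linarith
      _ = _ := by ring
  have h2 : 0 ≤ s₁ * θ + 2 * η + 2 * δ * (s₁ + η) := by
    have : 0 ≤ s₁ := hs0.trans hs
    positivity
  calc x * ((s + η) / p ^ 2) * c = x * (s + η) * c / p ^ 2 := by ring
    _ ≤ ((p - ρ) * s + (s₁ * θ + 2 * η + 2 * δ * (s₁ + η))) / p ^ 2 := by gcongr
    _ ≤ _ := by rw [add_div]; gcongr

/-- The second-stage part of the exponential moment of the difference of two sample means. -/
lemma meanLE_exp_drawSum [NeZero K] [IsProbabilityMeasure q] (hr : r < 1) (hT : 0 < T)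
    {b : Fin K} (hb : b ≠ star) {M : ℝ} (hM : 0 ≤ M) (hρ : 0 < ρ)
    {p s : Fin K → ℝ} {l s₁ θ η δ ω : ℝ} (hl : 0 ≤ l)
    (hm : ∀ a, MemLp (fun y => y a - μ a) 2 q)
    (hθ : 0 ≤ θ) (hθ1 : θ ≤ 1) (hη : 0 ≤ η) (hδ : 0 ≤ δ)
    (hc : Real.exp (l * (2 * M) / (ρ * √T)) ≤ 1 + θ)
    (hω : l ^ 2 / ρ ^ 2 * (s₁ * θ + 2 * η + 2 * δ * (s₁ + η)) ≤ ω)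
    (h : ∀ a, a = b ∨ a = star → ρ ≤ p a ∧ p a ≤ 1 ∧ 0 ≤ s a ∧ s a ≤ s₁ ∧
      ∫ y, (y a - μ a) ^ 2 ∂q ≤ s a + η ∧ N * allocProb r T z a / T ≤ p a - ρ + δ) :
    MeanLE (Measure.pi fun _ : Fin N => (armLaw r T z).prod q)
      (fun w => Real.exp (l * ((drawSum (core q M fun y => y b - μ b) b w / p b -
        drawSum (core q M fun y => y star - μ star) star w / p star) / √T)))
      (Real.exp (l ^ 2 / 2 * ((p b - ρ) * s b / p b ^ 2 +
        (p star - ρ) * s star / p star ^ 2) + ω)) := by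
  have hT' : (0 : ℝ) < T := by exact_mod_cast hT
  have hsT := Real.sqrt_pos.2 hT'
  have hX : ∀ a, Measurable fun y : Fin K → ℝ => y a - μ a := fun a => by fun_prop
  set X : Fin K → (Fin K → ℝ) → ℝ := fun a => core q M fun y => y a - μ a with hXdef
  let k : Fin K → ℝ → (Fin K → ℝ) → ℝ := fun a c y => c * (l / (p a * √T)) * X a y
  have hkm : ∀ a c, Measurable (k a c) := fun a c => (measurable_core (hX a)).const_mul _
  have hk : ∀ a, a = b ∨ a = star → ∀ c, |c| = 1 → ∀ y,
      |k a c y| ≤ l * (2 * M) / (ρ * √T) := by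
    intro a ha c hc1 y
    have hp := (h a ha).1
    have hp0 := hρ.trans_le hp
    have h1 : |X a y| ≤ 2 * M := abs_core_le hM y
    have h2 : 0 ≤ l / (p a * √T) := by positivity
    simp only [k]
    rw [abs_mul, abs_mul, hc1, one_mul, abs_of_nonneg h2, div_mul_eq_mul_div]
    gcongr
  have hk0 : ∀ a c, ∫ y, k a c y ∂q = 0 := fun a c => by
    simp only [k]
    rw [integral_const_mul, hXdef]
    simp only
    rw [integral_core (hX a) hM, mul_zero]
  have hks : ∀ a, a = b ∨ a = star → ∀ c, |c| = 1 →
      ∫ y, k a c y ^ 2 ∂q ≤ l ^ 2 / T * ((s a + η) / p a ^ 2) := by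
    intro a ha c hc1
    have hp0 := hρ.trans_le (h a ha).1
    have h1 : ∀ y, k a c y ^ 2 = l ^ 2 / (p a ^ 2 * T) * X a y ^ 2 := fun y => by
      simp only [k]
      rw [mul_pow, mul_pow, ← sq_abs c, hc1, div_pow, mul_pow, Real.sq_sqrt hT'.le]
      ring
    simp_rw [h1]
    rw [integral_const_mul]
    calc _ ≤ l ^ 2 / (p a ^ 2 * T) * (s a + η) := by
          gcongr
          exact (integral_core_sq_le (hX a) (hm a) hM).trans (h a ha).2.2.2.2.1
      _ = _ := by field_simp
  obtain ⟨h1, h2⟩ := integral_exp_drawSum_le (N := N) (T := T) (z := z) hr hb (hkm b 1)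
    (hkm star (-1)) (hk b (Or.inl rfl) 1 (by simp)) (hk star (Or.inr rfl) (-1) (by simp))
    (hk0 b 1) (hk0 star (-1)) (hks b (Or.inl rfl) 1 (by simp))
    (hks star (Or.inr rfl) (-1) (by simp))
  have hsmul : ∀ (a : Fin K) (c : ℝ) (w : Fin N → Fin K × (Fin K → ℝ)),
      drawSum (k a c) a w = c * (l / (p a * √T)) * drawSum (X a) a w := by
    intro a c w
    rw [drawSum, drawSum, Finset.mul_sum]
    refine Finset.sum_congr rfl fun t _ => ?_
    unfold ifDrawn
    split_ifs <;> simp [k]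
  have hE := MeanLE.of_integrable h1 h2
  refine hE.mono (fun w => le_of_eq ?_) ?_
  · have hpb := hρ.trans_le (h b (Or.inl rfl)).1
    have hps := hρ.trans_le (h star (Or.inr rfl)).1
    rw [hsmul, hsmul]
    congr 1
    field_simp
    ring
  · refine Real.exp_le_exp.2 ?_
    have hv := fun a (ha : a = b ∨ a = star) => variance_proxy_le hρ (h a ha).1 (h a ha).2.1
      (h a ha).2.2.1 (h a ha).2.2.2.1 hη hδ hθ (h a ha).2.2.2.2.2 (Real.exp_pos _).le hc hθ1
    have hv1 := hv b (Or.inl rfl)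
    have hv2 := hv star (Or.inr rfl)
    set e := Real.exp (l * (2 * M) / (ρ * √T))
    calc _ = l ^ 2 / 2 * ((N * allocProb r T z b / T) * ((s b + η) / p b ^ 2) * e +
          (N * allocProb r T z star / T) * ((s star + η) / p star ^ 2) * e) := by
          ring
      _ ≤ l ^ 2 / 2 * (((p b - ρ) * s b / p b ^ 2 +
            (s₁ * θ + 2 * η + 2 * δ * (s₁ + η)) / ρ ^ 2) + ((p star - ρ) * s star / p star ^ 2 +
            (s₁ * θ + 2 * η + 2 * δ * (s₁ + η)) / ρ ^ 2)) := by gcongr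
      _ = l ^ 2 / 2 * ((p b - ρ) * s b / p b ^ 2 + (p star - ρ) * s star / p star ^ 2) +
          l ^ 2 / ρ ^ 2 * (s₁ * θ + 2 * η + 2 * δ * (s₁ + η)) := by ring
      _ ≤ _ := by gcongr

/-- The conditional mean of the scaled loss given typical pilot observations that leave several
candidates. Here `x a` stands for the bounded part of the pilot noise, and `p a` for the limiting
share of arm `a`. -/
lemma meanLE_sqrt_mul_gap [NeZero K] [IsProbabilityMeasure q] (hr : r < 1) (hT : 0 < T)
    (hNT : N ≤ T) (hρ : 0 < ρ) (hn : ρ * T / 2 ≤ n)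
    (hx : ∀ a, |pilotNoise μ z a| ≤ C * √T) (hstar : ∀ a, μ a ≤ μ star) (hΛ : 0 < Λ)
    (hrad : Λ + 4 * C / ρ ≤ 2 * (√T * radius T z))
    (hsel_max : ∀ (x : Fin K → ℝ) (b : Fin K), x b ≤ x (sel x))
    (hns : ¬ ∃ a, candidates T z = {a})
    (hm : ∀ a, MemLp (fun y => y a - μ a) 2 q) (h0 : ∀ a, ∫ y, (y a - μ a) ∂q = 0)
    {p s x : Fin K → ℝ} {β γ l κ M ε s₁ θ η δ ω : ℝ} (hl : 0 ≤ l) (hM : 0 ≤ M)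
    (hβ : 0 ≤ β) (hγ : 0 ≤ γ) (hκ : 0 < κ) (htan : ∀ t, t ≤ β + γ * Real.exp (l * t))
    (hs₁ : ∀ a, ∫ y, (y a - μ a) ^ 2 ∂q ≤ s₁)
    (hε : ∀ a, ∫ y, tail M (y a - μ a) ^ 2 ∂q ≤ ε)
    (hθ : 0 ≤ θ) (hθ1 : θ ≤ 1) (hη : 0 ≤ η) (hδ : 0 ≤ δ)
    (hc : Real.exp (l * (2 * M) / (ρ * √T)) ≤ 1 + θ)
    (hω : l ^ 2 / ρ ^ 2 * (s₁ * θ + 2 * η + 2 * δ * (s₁ + η)) ≤ ω)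
    (h : ∀ a ∈ candidates T z, ρ ≤ p a ∧ p a ≤ 1 ∧ 0 ≤ s a ∧ s a ≤ s₁ ∧
      ∫ y, (y a - μ a) ^ 2 ∂q ≤ s a + η ∧ N * allocProb r T z a / T ≤ p a - ρ + δ ∧
      |(n + N * allocProb r T z a) / T - p a| ≤ δ) :
    MeanLE (Measure.pi fun _ : Fin N => (armLaw r T z).prod q)
      (fun w => √T * (μ star - μ (recommend sel T z w)))
      (8 * K ^ 2 / (ρ ^ 2 * Λ) * (C ^ 2 + s₁) +
        (∑ a, |pilotNoise μ z a - x a| / (ρ * √T) + K * √ε / ρ +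
          K * ((κ * (2 * C ^ 2 + 2 * s₁) + (2 / T + 2 * δ ^ 2) / κ) / ρ ^ 2)) +
        (β + γ * ∑ b ∈ (candidates T z).erase star,
          Real.exp (l * ((x b / p b - x star / p star) / √T)) *
          Real.exp (l ^ 2 / 2 * ((p b - ρ) * s b / p b ^ 2 +
            (p star - ρ) * s star / p star ^ 2) + ω))) := by
  have := isProbabilityMeasure_armLaw (T := T) (z := z) hr
  have hT' : (0 : ℝ) < T := by exact_mod_cast hT
  have hsT := Real.sqrt_pos.2 hT'
  have hs₁0 : 0 ≤ s₁ := (integral_nonneg fun _ => sq_nonneg _).trans (hs₁ star)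
  have hε0 : 0 ≤ ε := (integral_nonneg fun _ => sq_nonneg _).trans (hε star)
  have hstarS := star_mem_candidates hT hρ hn hx hstar hΛ hrad
  have hx2 : ∀ a, pilotNoise μ z a ^ 2 ≤ C ^ 2 * T := fun a => by
    have := sq_le_sq' (by linarith [abs_le.1 (hx a), abs_nonneg (pilotNoise μ z a)])
      (abs_le.1 (hx a)).2
    rwa [mul_pow, Real.sq_sqrt hT'.le] at this
  have hD2 := fun a => integral_drawNoise_sq_le (z := z) hr hNT (hm a) (h0 a) (hs₁ a)
  have hA : MeanLE (Measure.pi fun _ : Fin N => (armLaw r T z).prod q)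
      (fun w => 8 * K / (ρ ^ 2 * Λ) * (∑ a, (pilotNoise μ z a ^ 2 + drawNoise μ w a ^ 2)) / T)
      (8 * K ^ 2 / (ρ ^ 2 * Λ) * (C ^ 2 + s₁)) := by
    refine ((MeanLE.sum (s := Finset.univ) fun a _ => (MeanLE.const (C ^ 2 * T)).add
      (hD2 a)).const_mul (k := 8 * K / (ρ ^ 2 * Λ) / T) (by positivity)).mono (fun w => ?_) ?_
    · rw [mul_div_right_comm]
      gcongr with a
      exact hx2 a
    · refine le_of_eq ?_
      simp
      field_simp
  have hB : MeanLE (Measure.pi fun _ : Fin N => (armLaw r T z).prod q)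
      (fun w => ∑ a ∈ candidates T z, (|pilotNoise μ z a + drawNoise μ w a -
          (x a + drawSum (core q M fun y => y a - μ a) a w)| / (ρ * √T) +
        (κ * ((pilotNoise μ z a + drawNoise μ w a) ^ 2 / T) +
          (count n w a / T - p a) ^ 2 / κ) / ρ ^ 2))
      (∑ a, |pilotNoise μ z a - x a| / (ρ * √T) + K * √ε / ρ +
          K * ((κ * (2 * C ^ 2 + 2 * s₁) + (2 / T + 2 * δ ^ 2) / κ) / ρ ^ 2)) := by
    have h1 : ∀ a ∈ candidates T z, MeanLE (Measure.pi fun _ : Fin N => (armLaw r T z).prod q)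
        (fun w => |pilotNoise μ z a + drawNoise μ w a -
          (x a + drawSum (core q M fun y => y a - μ a) a w)| / (ρ * √T) +
        (κ * ((pilotNoise μ z a + drawNoise μ w a) ^ 2 / T) +
          (count n w a / T - p a) ^ 2 / κ) / ρ ^ 2)
        (|pilotNoise μ z a - x a| / (ρ * √T) + √ε / ρ +
          (κ * (2 * C ^ 2 + 2 * s₁) + (2 / T + 2 * δ ^ 2) / κ) / ρ ^ 2) := by
      intro a ha
      have e1 := (MeanLE.const (q := Measure.pi fun _ : Fin N => (armLaw r T z).prod q)
        |pilotNoise μ z a - x a|).add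
        (meanLE_drawNoise_sub_core (z := z) hr hNT (hm a) (h0 a) hM (hε a))
      have e2 := (MeanLE.const (q := Measure.pi fun _ : Fin N => (armLaw r T z).prod q)
        (2 * (C ^ 2 * T))).add ((hD2 a).const_mul zero_le_two)
      have e3 := meanLE_count (n := n) (q := q) hr hT hNT (h a ha).2.2.2.2.2.2
      refine ((e1.const_mul (k := 1 / (ρ * √T)) (by positivity)).add
        ((e2.const_mul (k := κ / T / ρ ^ 2) (by positivity)).add
          (e3.const_mul (k := 1 / κ / ρ ^ 2) (by positivity)))).mono (fun w => ?_) (le_of_eq ?_)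
      · have i1 : |pilotNoise μ z a + drawNoise μ w a -
            (x a + drawSum (core q M fun y => y a - μ a) a w)| ≤ |pilotNoise μ z a - x a| +
            |drawNoise μ w a - drawSum (core q M fun y => y a - μ a) a w| := by
          refine le_trans (le_of_eq ?_) (abs_add_le _ _)
          congr 1; ring
        have i2 : (pilotNoise μ z a + drawNoise μ w a) ^ 2 ≤
            2 * (C ^ 2 * T) + 2 * drawNoise μ w a ^ 2 := by
          have := add_sq_le (a := pilotNoise μ z a) (b := drawNoise μ w a)
          linarith [hx2 a]
        calc _ ≤ (|pilotNoise μ z a - x a| +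
            |drawNoise μ w a - drawSum (core q M fun y => y a - μ a) a w|) / (ρ * √T) +
            (κ * ((2 * (C ^ 2 * T) + 2 * drawNoise μ w a ^ 2) / T) +
              (count n w a / T - p a) ^ 2 / κ) / ρ ^ 2 := by gcongr
          _ = _ := by ring
      · rw [Real.sqrt_mul hT'.le]
        field_simp
    refine (MeanLE.sum h1).mono (fun w => le_rfl) ?_
    calc _ ≤ ∑ a, (|pilotNoise μ z a - x a| / (ρ * √T) + √ε / ρ +
          (κ * (2 * C ^ 2 + 2 * s₁) + (2 / T + 2 * δ ^ 2) / κ) / ρ ^ 2) :=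
          Finset.sum_le_sum_of_subset_of_nonneg (Finset.subset_univ _) fun a _ _ => by positivity
      _ = _ := by
        rw [Finset.sum_add_distrib, Finset.sum_add_distrib]
        simp
        ring
  have hE : MeanLE (Measure.pi fun _ : Fin N => (armLaw r T z).prod q)
      (fun w => β + γ * ∑ b ∈ (candidates T z).erase star,
        Real.exp (l * (((x b + drawSum (core q M fun y => y b - μ b) b w) / p b -
          (x star + drawSum (core q M fun y => y star - μ star) star w) / p star) / √T)))
      (β + γ * ∑ b ∈ (candidates T z).erase star,
          Real.exp (l * ((x b / p b - x star / p star) / √T)) *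
          Real.exp (l ^ 2 / 2 * ((p b - ρ) * s b / p b ^ 2 +
            (p star - ρ) * s star / p star ^ 2) + ω)) := by
    refine (MeanLE.const β).add ((MeanLE.sum fun b hb => ?_).const_mul hγ)
    have hbS := Finset.mem_of_mem_erase hb
    refine ((meanLE_exp_drawSum hr hT (Finset.ne_of_mem_erase hb) hM hρ hl hm hθ hθ1 hη hδ hc hω
      fun a ha => ?_).const_mul (Real.exp_pos _).le).mono (fun w => le_of_eq ?_) le_rfl
    · obtain ⟨i1, i2, i3, i4, i5, i6, -⟩ := h a (ha.elim (fun e => e ▸ hbS) fun e => e ▸ hstarS)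
      exact ⟨i1, i2, i3, i4, i5, i6⟩
    · rw [← Real.exp_add]
      congr 1
      ring
  refine ((hA.add hB).add hE).mono (fun w => ?_) le_rfl
  exact sqrt_mul_gap_le hT hρ hn hx hstar hΛ hrad hsel_max hns
    (x := fun a => x a + drawSum (core q M fun y => y a - μ a) a w) (fun a ha => (h a ha).1)
    hβ hγ hκ htan

end Conditional

/-! ### Untypical pilot observations -/

section Pilot

variable {K n N T : ℕ} {r : ℝ} {μ : Fin K → ℝ} {z : Fin K → Fin n → ℝ}
  {sel : (Fin K → ℝ) → Fin K} {ρ C : ℝ} {q : Measure (Fin K → ℝ)}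

/-- The centred sum of the squared pilot deviations of arm `a`. -/
def sqNoise (μ : Fin K → ℝ) (s : ℝ) (z : Fin K → Fin n → ℝ) (a : Fin K) : ℝ :=
  ∑ i, ((z a i - μ a) ^ 2 - s)

lemma pilotVar_eq (hn : 2 ≤ n) (s : ℝ) (a : Fin K) :
    pilotVar z a - s = (s + sqNoise μ s z a - pilotNoise μ z a ^ 2 / n) / ((n : ℝ) - 1) := by
  have hn' : (2 : ℝ) ≤ n := by exact_mod_cast hn
  have h0 : (n : ℝ) ≠ 0 := by linarith
  have h1 : (n : ℝ) - 1 ≠ 0 := by linarith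
  have e : ∀ i, (z a i - pilotMean z a) ^ 2 = ((z a i - μ a) ^ 2 - s) + s -
      2 * (pilotNoise μ z a / n) * (z a i - μ a) + (pilotNoise μ z a / n) ^ 2 := by
    intro i
    rw [pilotMean_eq (μ := μ) (by omega)]
    ring
  rw [pilotVar, Finset.sum_congr rfl fun i _ => e i, Finset.sum_add_distrib,
    Finset.sum_sub_distrib, Finset.sum_add_distrib, ← Finset.mul_sum, ← sqNoise, ← pilotNoise]
  simp
  field_simp
  ring

lemma abs_pilotVar_sub_le (hn2 : 2 ≤ n) (hρ : 0 < ρ) (hn : ρ * T / 2 ≤ n) {a : Fin K}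
    (hx : |pilotNoise μ z a| ≤ C * √T) {s s₁ η : ℝ} (hs0 : 0 ≤ s) (hs : s ≤ s₁)
    (hη : |sqNoise μ s z a| ≤ η * n) :
    |pilotVar z a - s| ≤ 2 * η + 2 * (s₁ + 2 * C ^ 2 / ρ) / n := by
  have hn' : (2 : ℝ) ≤ n := by exact_mod_cast hn2
  have hn0 : (0 : ℝ) < n := by linarith
  have hη0 : 0 ≤ η * n := (abs_nonneg _).trans hη
  have h1 : pilotNoise μ z a ^ 2 / n ≤ 2 * C ^ 2 / ρ := by
    have h2 : pilotNoise μ z a ^ 2 ≤ C ^ 2 * T := by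
      have := sq_le_sq' (by linarith [abs_le.1 hx, abs_nonneg (pilotNoise μ z a)]) (abs_le.1 hx).2
      rwa [mul_pow, Real.sq_sqrt (Nat.cast_nonneg T)] at this
    rw [div_le_div_iff₀ hn0 hρ]
    nlinarith [sq_nonneg C]
  have h3 : 0 ≤ pilotNoise μ z a ^ 2 / n := by positivity
  have h4 : |s + sqNoise μ s z a - pilotNoise μ z a ^ 2 / n| ≤ η * n + (s₁ + 2 * C ^ 2 / ρ) := by
    have := abs_le.1 hη
    rw [abs_le]
    constructor <;> linarith
  have h5 : (n : ℝ) / 2 ≤ n - 1 := by linarith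
  rw [pilotVar_eq hn2 s a (μ := μ), abs_div, abs_of_pos (show (0 : ℝ) < n - 1 by linarith)]
  calc _ ≤ (η * n + (s₁ + 2 * C ^ 2 / ρ)) / (n / 2) := by
        have := (abs_nonneg _).trans h4
        gcongr
    _ = _ := by field_simp

/-- A quantitative law of large numbers for the squared deviations. -/
lemma meanLE_sqNoise [IsProbabilityMeasure q] {a : Fin K} (hm : MemLp (fun y => y a - μ a) 2 q)
    {M ε : ℝ} (hM : 0 ≤ M) (hε : ∫ y, tail M (y a - μ a) ^ 2 ∂q ≤ ε) :
    MeanLE (Measure.pi fun _ : Fin K × Fin n => q)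
      (fun y => |sqNoise μ (∫ y, (y a - μ a) ^ 2 ∂q) (pilotObs y) a|)
      (√n * M ^ 2 + n * (2 * ε)) := by
  set X : (Fin K → ℝ) → ℝ := fun y => y a - μ a with hX
  have hXm : Measurable X := by fun_prop
  have htm : Measurable fun y => tail M (X y) ^ 2 := ((measurable_tail M).comp hXm).pow_const 2
  have hbm : Measurable fun y => (X y - tail M (X y)) ^ 2 :=
    (hXm.sub ((measurable_tail M).comp hXm)).pow_const 2
  have hsplit : ∀ y, X y ^ 2 = (X y - tail M (X y)) ^ 2 + tail M (X y) ^ 2 := fun y => by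
    simp only [tail]; split_ifs <;> ring
  have hti : Integrable (fun y => tail M (X y) ^ 2) q :=
    hm.integrable_sq.mono' htm.aestronglyMeasurable (Eventually.of_forall fun y => by
      rw [Real.norm_eq_abs, abs_of_nonneg (sq_nonneg _)]; exact tail_sq_le)
  have hb4 : ∀ y, ((X y - tail M (X y)) ^ 2) ≤ M ^ 2 := fun y =>
    sq_le_sq.2 (by rw [abs_of_nonneg hM]; exact abs_sub_tail_le hM _)
  have hbL : MemLp (fun y => (X y - tail M (X y)) ^ 2) 2 q :=
    MemLp.of_bound hbm.aestronglyMeasurable (M ^ 2) (Eventually.of_forall fun y => by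
      rw [Real.norm_eq_abs, abs_of_nonneg (sq_nonneg _)]; exact hb4 y)
  set eb := ∫ y, (X y - tail M (X y)) ^ 2 ∂q with heb
  set et := ∫ y, tail M (X y) ^ 2 ∂q with het
  have hsum : ∫ y, X y ^ 2 ∂q = eb + et := by
    simp_rw [hsplit]
    exact integral_add (hbL.integrable (by norm_num)) hti
  have het0 : 0 ≤ et := integral_nonneg fun _ => sq_nonneg _
  -- The bounded part is controlled in mean square.
  have h1 : MeanLE (Measure.pi fun _ : Fin K × Fin n => q)
      (fun y => |pilotSum (fun x => (X x - tail M (X x)) ^ 2 - eb) a y|) (√n * M ^ 2) := by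
    have hL : MemLp (fun x => (X x - tail M (X x)) ^ 2 - eb) 2 q := hbL.sub (memLp_const _)
    refine .of_integrable ((memLp_pilotSum hL a).integrable (by norm_num)).abs ?_
    have h0 : ∫ x, ((X x - tail M (X x)) ^ 2 - eb) ∂q = 0 := by
      rw [integral_sub (hbL.integrable (by norm_num)) (integrable_const _)]
      simp [heb]
    refine (integral_abs_pilotSum_le (s := M ^ 4) hL h0 a ?_).trans (le_of_eq ?_)
    · have hv := ProbabilityTheory.variance_le_expectation_sq (μ := q) hbL.1
      rw [ProbabilityTheory.variance_eq_integral hbL.1.aemeasurable] at hv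
      refine hv.trans ?_
      calc _ ≤ ∫ _y, M ^ 4 ∂q := by
            refine integral_mono hbL.integrable_sq (integrable_const _) fun y => ?_
            have := pow_le_pow_left₀ (sq_nonneg _) (hb4 y) 2
            simp only [Pi.pow_apply]
            calc _ ≤ _ := this
              _ = M ^ 4 := by ring
        _ = M ^ 4 := by simp
    · rw [Real.sqrt_mul (Nat.cast_nonneg n), show M ^ 4 = (M ^ 2) ^ 2 by ring,
        Real.sqrt_sq (sq_nonneg M)]
  have h2 : ∀ i : Fin n, MeanLE (Measure.pi fun _ : Fin K × Fin n => q)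
      (fun y => tail M (X (y (a, i))) ^ 2) ε := by
    intro i
    have hp := measurePreserving_eval (fun _ : Fin K × Fin n => q) (a, i)
    refine .of_integrable (hp.integrable_comp_of_integrable hti) ?_
    rw [integral_comp_eval (μ := fun _ : Fin K × Fin n => q) (i := (a, i))
      (f := fun x => tail M (X x) ^ 2) hti.1]
    exact hε
  refine (h1.add ((MeanLE.sum (s := Finset.univ) fun i _ => h2 i).add
    (MeanLE.const (n * ε)))).mono (fun y => ?_) (le_of_eq ?_)
  · have e : sqNoise μ (∫ y, X y ^ 2 ∂q) (pilotObs y) a =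
        pilotSum (fun x => (X x - tail M (X x)) ^ 2 - eb) a y +
        (∑ i, tail M (X (y (a, i))) ^ 2 - n * et) := by
      have hn : (n : ℝ) * et = ∑ _i : Fin n, et := by simp
      rw [sqNoise, pilotSum, hn, ← Finset.sum_sub_distrib, ← Finset.sum_add_distrib, hsum]
      refine Finset.sum_congr rfl fun i _ => ?_
      have := hsplit (y (a, i))
      change X (y (a, i)) ^ 2 - (eb + et) = _
      rw [this]
      ring
    rw [e]
    refine (abs_add_le _ _).trans (add_le_add le_rfl ?_)
    have h3 : 0 ≤ ∑ i, tail M (X (y (a, i))) ^ 2 := Finset.sum_nonneg fun _ _ => sq_nonneg _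
    have h4 : (n : ℝ) * et ≤ n * ε := by gcongr
    have h5 : 0 ≤ (n : ℝ) * et := by positivity
    rw [abs_le]
    constructor <;> linarith
  · simp; ring

/-- Whatever the pilot observations are, the conditional mean of the scaled loss is at most
linear in the pilot noise. -/
lemma meanLE_sqrt_mul_gap_of_any [NeZero K] [IsProbabilityMeasure q] (hr : r < 1) (hT : 0 < T)
    (hNT : N ≤ T) (hρ : 0 < ρ) (hn : ρ * T / 2 ≤ n)
    (hsel_max : ∀ (x : Fin K → ℝ) (b : Fin K), x b ≤ x (sel x))
    (hm : ∀ a, MemLp (fun y => y a - μ a) 2 q) (h0 : ∀ a, ∫ y, (y a - μ a) ∂q = 0) {s₁ : ℝ}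
    (hs₁ : ∀ a, ∫ y, (y a - μ a) ^ 2 ∂q ≤ s₁) (star : Fin K) :
    MeanLE (Measure.pi fun _ : Fin N => (armLaw r T z).prod q)
      (fun w => √T * (μ star - μ (recommend sel T z w)))
      (2 / ρ * ∑ a, (|pilotNoise μ z a| / √T + √s₁)) := by
  have := isProbabilityMeasure_armLaw (T := T) (z := z) hr
  have hT' : (0 : ℝ) < T := by exact_mod_cast hT
  have hsT := Real.sqrt_pos.2 hT'
  have hn0 : (0 : ℝ) < n := lt_of_lt_of_le (by positivity) hn
  have h1 : ∀ a, MeanLE (Measure.pi fun _ : Fin N => (armLaw r T z).prod q)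
      (fun w => |drawNoise μ w a|) (√(T * s₁)) := by
    intro a
    have hX : Measurable fun y : Fin K → ℝ => y a - μ a := by fun_prop
    have hL := memLp_drawSum (N := N) (T := T) (z := z) hr hX (hm a) a
    obtain ⟨F, hF, hle, hi⟩ := integral_drawNoise_sq_le (N := N) (z := z) hr hNT (hm a) (h0 a)
      (hs₁ a)
    exact .of_integrable (hL.integrable (by norm_num)).abs
      (integral_abs_le_sqrt hL ((integral_mono hL.integrable_sq hF hle).trans hi))
  refine ((MeanLE.sum (s := Finset.univ) fun a _ => (MeanLE.const |pilotNoise μ z a|).add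
    (h1 a)).const_mul (k := 2 / (ρ * √T)) (by positivity)).mono (fun w => ?_) (le_of_eq ?_)
  · have h2 := gap_le_sum_noise (T := T) (μ := μ) (z := z) (w := w) (by exact_mod_cast hn0)
      hsel_max star
    have hR0 : 0 ≤ ∑ a, (|pilotNoise μ z a| + |drawNoise μ w a|) :=
      Finset.sum_nonneg fun a _ => by positivity
    calc _ ≤ √T * ((∑ a, (|pilotNoise μ z a| + |drawNoise μ w a|)) / n) :=
          mul_le_mul_of_nonneg_left h2 hsT.le
      _ ≤ √T * ((∑ a, (|pilotNoise μ z a| + |drawNoise μ w a|)) / (ρ * T / 2)) := by gcongr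
      _ = _ := by
        field_simp
        rw [Real.sq_sqrt hT'.le]
        ring
  · rw [Real.sqrt_mul hT'.le, Finset.mul_sum, Finset.mul_sum]
    refine Finset.sum_congr rfl fun a _ => ?_
    field_simp

lemma meanLE_pilotNoise_sq [IsProbabilityMeasure q] {a : Fin K}
    (hm : MemLp (fun y => y a - μ a) 2 q) (h0 : ∫ y, (y a - μ a) ∂q = 0) {s : ℝ}
    (hs : ∫ y, (y a - μ a) ^ 2 ∂q ≤ s) :
    MeanLE (Measure.pi fun _ : Fin K × Fin n => q)
      (fun y : Fin K × Fin n → Fin K → ℝ => pilotNoise μ (pilotObs y) a ^ 2)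
      (n * s) := by
  refine .of_integrable (memLp_pilotSum (n := n) hm a).integrable_sq ?_
  change ∫ y, pilotSum (fun y : Fin K → ℝ => y a - μ a) a y ^ 2 ∂_ ≤ _
  rw [integral_pilotSum_sq hm h0]
  gcongr

/-- An upper bound for the conditional mean loss that is valid for pilot observations with large
noise, and small in the mean: it combines `L ≤ τ L ^ 2 + 1 / (4 τ)` with Markov's inequality. -/
noncomputable def untypicalBound (ρ C τ η s₁ : ℝ) (T : ℕ) (μ s : Fin K → ℝ)
    (z : Fin K → Fin n → ℝ) : ℝ :=
  τ * (8 * K / ρ ^ 2 * ∑ a, (pilotNoise μ z a ^ 2 / T + s₁)) +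
    1 / (4 * τ) * ∑ a, (pilotNoise μ z a ^ 2 / (C ^ 2 * T) + |sqNoise μ (s a) z a| / (η * n))

lemma untypicalBound_nonneg {τ η s₁ : ℝ} (hτ : 0 < τ) (hη : 0 < η) (hs₁ : 0 ≤ s₁)
    (s : Fin K → ℝ) : 0 ≤ untypicalBound ρ C τ η s₁ T μ s z := by
  unfold untypicalBound
  have h1 : 0 ≤ ∑ a, (pilotNoise μ z a ^ 2 / T + s₁) :=
    Finset.sum_nonneg fun a _ => by positivity
  have h2 : 0 ≤ ∑ a, (pilotNoise μ z a ^ 2 / (C ^ 2 * T) + |sqNoise μ (s a) z a| / (η * n)) :=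
    Finset.sum_nonneg fun a _ => by positivity
  positivity

lemma le_untypicalBound {τ η s₁ : ℝ} {s : Fin K → ℝ} (hT : 0 < T) (hn : 0 < n) (hC : 0 < C)
    (hτ : 0 < τ) (hη : 0 < η) (hs₁ : 0 ≤ s₁)
    (hbad : ¬ ∀ a, |pilotNoise μ z a| ≤ C * √T ∧ |sqNoise μ (s a) z a| ≤ η * n) :
    2 / ρ * ∑ a, (|pilotNoise μ z a| / √T + √s₁) ≤ untypicalBound ρ C τ η s₁ T μ s z := by
  have hT' : (0 : ℝ) < T := by exact_mod_cast hT
  have hn' : (0 : ℝ) < n := by exact_mod_cast hn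
  have hsT := Real.sqrt_pos.2 hT'
  set L := 2 / ρ * ∑ a, (|pilotNoise μ z a| / √T + √s₁) with hL
  have h1 : L ^ 2 ≤ 8 * K / ρ ^ 2 * ∑ a, (pilotNoise μ z a ^ 2 / T + s₁) := by
    have h5 := sq_sum_le_card_mul_sum_sq (s := (Finset.univ : Finset (Fin K)))
      (f := fun a => |pilotNoise μ z a| / √T + √s₁)
    rw [Finset.card_univ, Fintype.card_fin] at h5
    calc L ^ 2 = 4 / ρ ^ 2 * (∑ a, (|pilotNoise μ z a| / √T + √s₁)) ^ 2 := by
          rw [hL, mul_pow, div_pow]; norm_num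
      _ ≤ 4 / ρ ^ 2 * (K * ∑ a, (|pilotNoise μ z a| / √T + √s₁) ^ 2) := by gcongr
      _ ≤ 4 / ρ ^ 2 * (K * ∑ a, 2 * (pilotNoise μ z a ^ 2 / T + s₁)) := by
        gcongr with a
        have := add_sq_le (a := |pilotNoise μ z a| / √T) (b := √s₁)
        rwa [div_pow, sq_abs, Real.sq_sqrt hT'.le, Real.sq_sqrt hs₁] at this
      _ = _ := by rw [← Finset.mul_sum]; ring
  have h2 : 1 ≤ ∑ a, (pilotNoise μ z a ^ 2 / (C ^ 2 * T) + |sqNoise μ (s a) z a| / (η * n)) := by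
    push Not at hbad
    obtain ⟨a, ha⟩ := hbad
    refine le_trans ?_ (Finset.single_le_sum
      (f := fun a => pilotNoise μ z a ^ 2 / (C ^ 2 * T) + |sqNoise μ (s a) z a| / (η * n))
      (fun a _ => by positivity) (Finset.mem_univ a))
    by_cases h : |pilotNoise μ z a| ≤ C * √T
    · have := (ha h).le
      have h3 : 1 ≤ |sqNoise μ (s a) z a| / (η * n) := by rwa [one_le_div (by positivity)]
      have h4 : 0 ≤ pilotNoise μ z a ^ 2 / (C ^ 2 * T) := by positivity
      linarith
    · have h3 : 1 ≤ pilotNoise μ z a ^ 2 / (C ^ 2 * T) := by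
        have := pow_le_pow_left₀ (by positivity) (not_le.1 h).le 2
        rw [mul_pow, Real.sq_sqrt hT'.le, sq_abs] at this
        rwa [one_le_div (by positivity)]
      have h4 : 0 ≤ |sqNoise μ (s a) z a| / (η * n) := by positivity
      linarith
  have h3 : L ≤ τ * L ^ 2 + 1 / (4 * τ) := by
    have : τ * L ^ 2 + 1 / (4 * τ) - L = (2 * τ * L - 1) ^ 2 / (4 * τ) := by field_simp; ring
    have h4 : 0 ≤ (2 * τ * L - 1) ^ 2 / (4 * τ) := by positivity
    linarith
  have h5 : 0 < 1 / (4 * τ) := by positivity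
  unfold untypicalBound
  nlinarith [mul_le_mul_of_nonneg_left h1 hτ.le, mul_le_mul_of_nonneg_left h2 h5.le]

lemma meanLE_untypicalBound [IsProbabilityMeasure q] (hT : 0 < T) (hn : 0 < n) (hnT : n ≤ T)
    (hm : ∀ a, MemLp (fun y => y a - μ a) 2 q) (h0 : ∀ a, ∫ y, (y a - μ a) ∂q = 0)
    {s₁ τ η M ε : ℝ} (hτ : 0 < τ) (hη : 0 < η) (hC : 0 < C) (hM : 0 ≤ M)
    (hs₁ : ∀ a, ∫ y, (y a - μ a) ^ 2 ∂q ≤ s₁)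
    (hε : ∀ a, ∫ y, tail M (y a - μ a) ^ 2 ∂q ≤ ε) :
    MeanLE (Measure.pi fun _ : Fin K × Fin n => q)
      (fun y => untypicalBound ρ C τ η s₁ T μ (fun a => ∫ y, (y a - μ a) ^ 2 ∂q) (pilotObs y))
      (τ * (16 * K ^ 2 / ρ ^ 2 * s₁) +
        1 / (4 * τ) * (K * (s₁ / C ^ 2 + (M ^ 2 / √n + 2 * ε) / η))) := by
  have hT' : (0 : ℝ) < T := by exact_mod_cast hT
  have hn' : (0 : ℝ) < n := by exact_mod_cast hn
  have hsn := Real.sqrt_pos.2 hn'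
  have hnT' : (n : ℝ) ≤ T := by exact_mod_cast hnT
  have e1 : MeanLE (Measure.pi fun _ : Fin K × Fin n => q)
      (fun y => ∑ a, (pilotNoise μ (pilotObs y) a ^ 2 / T + s₁)) (∑ _a : Fin K, (s₁ + s₁)) := by
    refine MeanLE.sum fun a _ => MeanLE.add ?_ (MeanLE.const s₁)
    refine ((meanLE_pilotNoise_sq (n := n) (hm a) (h0 a) (hs₁ a)).const_mul
      (k := 1 / T) (by positivity)).mono (fun y => le_of_eq (by ring)) ?_
    have hs0 : 0 ≤ s₁ := (integral_nonneg fun _ => sq_nonneg _).trans (hs₁ a)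
    rw [one_div_mul_eq_div, div_le_iff₀ hT']
    nlinarith
  have e2 : MeanLE (Measure.pi fun _ : Fin K × Fin n => q)
      (fun y => ∑ a, (pilotNoise μ (pilotObs y) a ^ 2 / (C ^ 2 * T) +
        |sqNoise μ (∫ y, (y a - μ a) ^ 2 ∂q) (pilotObs y) a| / (η * n)))
      (∑ _a : Fin K, (s₁ / C ^ 2 + (M ^ 2 / √n + 2 * ε) / η)) := by
    refine MeanLE.sum fun a _ => MeanLE.add ?_ ?_
    · refine ((meanLE_pilotNoise_sq (n := n) (hm a) (h0 a) (hs₁ a)).const_mul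
        (k := 1 / (C ^ 2 * T)) (by positivity)).mono (fun y => le_of_eq (by ring)) ?_
      have hs0 : 0 ≤ s₁ := (integral_nonneg fun _ => sq_nonneg _).trans (hs₁ a)
      rw [one_div_mul_eq_div, ← div_div, div_right_comm]
      gcongr
      rw [div_le_iff₀ hT']
      nlinarith
    · refine ((meanLE_sqNoise (n := n) (hm a) hM (hε a)).const_mul
        (k := 1 / (η * n)) (by positivity)).mono (fun y => le_of_eq (by ring)) (le_of_eq ?_)
      have hnn : (√n : ℝ) ^ 2 = n := Real.sq_sqrt hn'.le
      field_simp
      linear_combination M ^ 2 * hnn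
  refine (((e1.const_mul (k := 8 * K / ρ ^ 2) (by positivity)).const_mul hτ.le).add
    (e2.const_mul (k := 1 / (4 * τ)) (by positivity))).mono (fun y => le_rfl) (le_of_eq ?_)
  simp
  ring

end Pilot

/-! ### Exponential moments of the pilot noise -/

section Exponential

variable {K n T : ℕ} {μ s : Fin K → ℝ} {b star : Fin K} {ρ l ω : ℝ} {q : Measure (Fin K → ℝ)}
  {S : Finset (Fin K)}

/-- The pilot part of the exponential moment of the difference of two sample means. -/
lemma meanLE_exp_pilotSum [IsProbabilityMeasure q] (hT : 0 < T) (hb : b ≠ star) {M : ℝ}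
    (hM : 0 ≤ M) (hρ : 0 < ρ) (hρ1 : ρ ≤ 1) (hn : n ≤ ρ * T) {s₁ θ η : ℝ} (hl : 0 ≤ l)
    (hm : ∀ a, MemLp (fun y => y a - μ a) 2 q) (hθ : 0 ≤ θ) (hθ1 : θ ≤ 1) (hη : 0 ≤ η)
    (hc : Real.exp (l * (2 * M) / (ρ * √T)) ≤ 1 + θ)
    (hω : l ^ 2 / ρ ^ 2 * (s₁ * θ + 2 * η) ≤ ω) {c : Fin K → ℝ}
    (h : ∀ a, a = b ∨ a = star → 0 ≤ c a ∧ c a ≤ 1 / ρ ∧ 0 ≤ s a ∧ s a ≤ s₁ ∧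
      ∫ y, (y a - μ a) ^ 2 ∂q ≤ s a + η) :
    MeanLE (Measure.pi fun _ : Fin K × Fin n => q)
      (fun y => Real.exp (l * ((c b * pilotSum (core q M fun y => y b - μ b) b y -
        c star * pilotSum (core q M fun y => y star - μ star) star y) / √T)))
      (Real.exp (l ^ 2 / 2 * (ρ * (c b ^ 2 * s b + c star ^ 2 * s star)) + ω)) := by
  have hT' : (0 : ℝ) < T := by exact_mod_cast hT
  have hsT := Real.sqrt_pos.2 hT'
  have hX : ∀ a, Measurable fun y : Fin K → ℝ => y a - μ a := fun a => by fun_prop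
  set X : Fin K → (Fin K → ℝ) → ℝ := fun a => core q M fun y => y a - μ a with hXdef
  let k : Fin K → ℝ → (Fin K → ℝ) → ℝ := fun a e y => e * (l * c a / √T) * X a y
  have hkm : ∀ a e, Measurable (k a e) := fun a e => (measurable_core (hX a)).const_mul _
  have hk : ∀ a, a = b ∨ a = star → ∀ e, |e| = 1 → ∀ y,
      |k a e y| ≤ l * (2 * M) / (ρ * √T) := by
    intro a ha e he y
    have h1 : |X a y| ≤ 2 * M := abs_core_le hM y
    have h0 := (h a ha).1
    have h2 : 0 ≤ l * c a / √T := by positivity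
    simp only [k]
    rw [abs_mul, abs_mul, he, one_mul, abs_of_nonneg h2]
    calc l * c a / √T * |X a y| ≤ l * (1 / ρ) / √T * (2 * M) := by
          gcongr
          exact (h a ha).2.1
      _ = _ := by field_simp
  have hk0 : ∀ a e, ∫ y, k a e y ∂q = 0 := fun a e => by
    simp only [k]
    rw [integral_const_mul, hXdef]
    simp only
    rw [integral_core (hX a) hM, mul_zero]
  have hks : ∀ a, a = b ∨ a = star → ∀ e, |e| = 1 →
      ∫ y, k a e y ^ 2 ∂q ≤ l ^ 2 / T * (c a ^ 2 * (s a + η)) := by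
    intro a ha e he
    have h1 : ∀ y, k a e y ^ 2 = l ^ 2 / T * c a ^ 2 * X a y ^ 2 := fun y => by
      simp only [k]
      rw [mul_pow, mul_pow, ← sq_abs e, he, div_pow, mul_pow, Real.sq_sqrt hT'.le]
      ring
    simp_rw [h1]
    rw [integral_const_mul, ← mul_assoc]
    gcongr
    exact (integral_core_sq_le (hX a) (hm a) hM).trans (h a ha).2.2.2.2
  obtain ⟨h1, h2⟩ := integral_exp_pilotSum_le (n := n) hb (hkm b 1)
    (hkm star (-1)) (hk b (Or.inl rfl) 1 (by simp)) (hk star (Or.inr rfl) (-1) (by simp))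
    (hk0 b 1) (hk0 star (-1)) (hks b (Or.inl rfl) 1 (by simp))
    (hks star (Or.inr rfl) (-1) (by simp))
  have hsmul : ∀ (a : Fin K) (e : ℝ) (y : Fin K × Fin n → Fin K → ℝ),
      pilotSum (k a e) a y = e * (l * c a / √T) * pilotSum (X a) a y := by
    intro a e y
    rw [pilotSum, pilotSum, Finset.mul_sum]
  refine (MeanLE.of_integrable h1 h2).mono (fun y => le_of_eq ?_) ?_
  · rw [hsmul, hsmul]
    congr 1
    field_simp
    ring
  · refine Real.exp_le_exp.2 ?_
    have hv : ∀ a, a = b ∨ a = star → c a ^ 2 * (s a + η) * Real.exp (l * (2 * M) / (ρ * √T)) ≤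
        c a ^ 2 * s a + 1 / ρ ^ 2 * (s₁ * θ + 2 * η) := by
      intro a ha
      obtain ⟨i1, i2, i3, i4, -⟩ := h a ha
      have i5 : c a ^ 2 ≤ 1 / ρ ^ 2 := by
        have := pow_le_pow_left₀ i1 i2 2
        rwa [div_pow, one_pow] at this
      have hs₁ : 0 ≤ s₁ := i3.trans i4
      calc _ ≤ c a ^ 2 * (s a + η) * (1 + θ) := by gcongr
        _ = c a ^ 2 * s a + c a ^ 2 * (s a * θ + η * (1 + θ)) := by ring
        _ ≤ c a ^ 2 * s a + 1 / ρ ^ 2 * (s₁ * θ + η * (1 + 1)) := by gcongr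
        _ = _ := by ring
    have hv1 := hv b (Or.inl rfl)
    have hv2 := hv star (Or.inr rfl)
    have hb0 := (h b (Or.inl rfl)).2.2
    have hs0 := (h star (Or.inr rfl)).2.2
    set e := Real.exp (l * (2 * M) / (ρ * √T))
    have hs₁ : 0 ≤ s₁ := hb0.1.trans hb0.2.1
    have hnT : n / (T : ℝ) ≤ ρ := by rwa [div_le_iff₀ hT']
    calc _ = l ^ 2 / 2 * (n / T * (c b ^ 2 * (s b + η) * e + c star ^ 2 * (s star + η) * e)) := by
          ring
      _ ≤ l ^ 2 / 2 * (ρ * ((c b ^ 2 * s b + 1 / ρ ^ 2 * (s₁ * θ + 2 * η)) +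
            (c star ^ 2 * s star + 1 / ρ ^ 2 * (s₁ * θ + 2 * η)))) := by
          have i1 := hb0.1
          have i2 := hs0.1
          have i3 : 0 ≤ e := (Real.exp_pos _).le
          gcongr
      _ = l ^ 2 / 2 * (ρ * (c b ^ 2 * s b + c star ^ 2 * s star)) +
          ρ * (l ^ 2 / ρ ^ 2 * (s₁ * θ + 2 * η)) := by ring
      _ ≤ l ^ 2 / 2 * (ρ * (c b ^ 2 * s b + c star ^ 2 * s star)) +
          1 * (l ^ 2 / ρ ^ 2 * (s₁ * θ + 2 * η)) := by gcongr
      _ ≤ _ := by rw [one_mul]; gcongr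

/-- The exponential of the pilot noise, weighted by the second-stage moment, when exactly the arms
`b` and `star` are candidates. -/
noncomputable def pairTerm (ρ l ω : ℝ) (T : ℕ) (s x : Fin K → ℝ) (star b : Fin K) : ℝ :=
  Real.exp (l * ((x b / share ρ {b, star} s b - x star / share ρ {b, star} s star) / √T)) *
    Real.exp (l ^ 2 / 2 * ((share ρ {b, star} s b - ρ) * s b / share ρ {b, star} s b ^ 2 +
      (share ρ {b, star} s star - ρ) * s star / share ρ {b, star} s star ^ 2) + ω)

/-- A bound, uniform in the set of candidates, for the exponential of the pilot noise weighted by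
the second-stage moment, when there are at least three candidates. -/
noncomputable def manyTerm (ρ l ω : ℝ) (T : ℕ) (s x : Fin K → ℝ) (star b : Fin K) : ℝ :=
  Real.exp (5 / 4 * l ^ 2 * (∑ a, s a) + ω) +
    Real.exp (l * (((∑ a, s a) / s b * x b - (∑ a, s a) / s star * x star) / √T)) *
    Real.exp (l ^ 2 / 2 * ((5 / 4 * (∑ a, s a) - ρ * (∑ a, s a) ^ 2 / s b) +
      (5 / 4 * (∑ a, s a) - ρ * (∑ a, s a) ^ 2 / s star)) + ω)

lemma pairTerm_nonneg {x : Fin K → ℝ} : 0 ≤ pairTerm ρ l ω T s x star b := by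
  unfold pairTerm; positivity

lemma manyTerm_nonneg {x : Fin K → ℝ} : 0 ≤ manyTerm ρ l ω T s x star b := by
  unfold manyTerm; positivity

/-- For at least three candidates the coefficients of the pilot noise of all arms have the common
factor `ratio ρ S s ∈ (0, ∑ a, s a]`, so that they may be replaced by their largest value at the
cost of an additive term. -/
lemma exp_le_manyTerm (hρ : 0 < ρ) (hKρ : K * ρ < 1) (hl : 0 ≤ l) (hs : ∀ a, 0 < s a)
    (hle : ∀ a, ρ ≤ s a / ∑ b, s b) (hS : 3 ≤ S.card) (hb : b ∈ S) (hstar : star ∈ S)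
    {x : Fin K → ℝ} :
    Real.exp (l * ((x b / share ρ S s b - x star / share ρ S s star) / √T)) *
      Real.exp (l ^ 2 / 2 * ((share ρ S s b - ρ) * s b / share ρ S s b ^ 2 +
        (share ρ S s star - ρ) * s star / share ρ S s star ^ 2) + ω) ≤
      manyTerm ρ l ω T s x star b := by
  set V := ∑ a, s a with hV
  set g := ratio ρ S s with hg
  have hg0 : 0 < g := ratio_pos hρ hKρ hs ⟨b, hb⟩
  have hgV : g ≤ V := ratio_le hρ hKρ hs hle
  have hV0 : 0 < V := hg0.trans_le hgV
  have hinv : ∀ a ∈ S, (share ρ S s a)⁻¹ = g / s a := fun a ha =>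
    inv_share_of_three_le hρ hKρ hs hS ha
  have hshare : ∀ a ∈ S, share ρ S s a = s a / g := fun a ha => by
    rw [← inv_inv (share ρ S s a), hinv a ha, inv_div]
  have hvar : ∀ a ∈ S, (share ρ S s a - ρ) * s a / share ρ S s a ^ 2 = g - ρ * g ^ 2 / s a := by
    intro a ha
    have := hs a
    rw [hshare a ha]
    field_simp
  have hρs : ∀ a, ρ * V ≤ s a := fun a => (le_div_iff₀ hV0).1 (hle a)
  -- With `t = g / V` and `τ = ρ V / s a ≤ 1`, this is `t - τ t ^ 2 + τ ≤ 5 / 4`.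
  have hquad : ∀ a, g - ρ * g ^ 2 / s a ≤ 5 / 4 * V - ρ * V ^ 2 / s a := by
    intro a
    have h1 : ρ / s a * (V ^ 2 - g ^ 2) ≤ 1 / V * (V ^ 2 - g ^ 2) := by
      refine mul_le_mul_of_nonneg_right ?_ (by nlinarith)
      rw [div_le_div_iff₀ (hs a) hV0, one_mul]
      exact hρs a
    have h2 : 1 / V * (V ^ 2 - g ^ 2) ≤ 5 / 4 * V - g := by
      rw [one_div, inv_mul_le_iff₀ hV0]
      nlinarith [sq_nonneg (V - 2 * g)]
    have h3 : ρ / s a * (V ^ 2 - g ^ 2) = ρ * V ^ 2 / s a - ρ * g ^ 2 / s a := by ring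
    linarith
  have hsmall : ∀ a, g - ρ * g ^ 2 / s a ≤ 5 / 4 * V := fun a => by
    have := hs a
    have : 0 ≤ ρ * g ^ 2 / s a := by positivity
    linarith
  rw [hvar b hb, hvar star hstar, hshare b hb, hshare star hstar]
  set D := x b / s b - x star / s star with hD
  have e1 : x b / (s b / g) - x star / (s star / g) = g * D := by
    rw [hD]; field_simp
  have e2 : V / s b * x b - V / s star * x star = V * D := by
    rw [hD]; ring
  rw [manyTerm, ← hV, e1, e2]
  rcases le_total D 0 with h0 | h0
  · refine le_trans ?_ (le_add_of_nonneg_right (by positivity))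
    rw [← Real.exp_add]
    refine Real.exp_le_exp.2 ?_
    have h1 : l * (g * D / √T) ≤ 0 :=
      mul_nonpos_of_nonneg_of_nonpos hl
        (div_nonpos_of_nonpos_of_nonneg (mul_nonpos_of_nonneg_of_nonpos hg0.le h0)
          (Real.sqrt_nonneg _))
    have h2 : l ^ 2 / 2 * ((g - ρ * g ^ 2 / s b) + (g - ρ * g ^ 2 / s star)) ≤
        l ^ 2 / 2 * (5 / 4 * V + 5 / 4 * V) := by
      have := hsmall b
      have := hsmall star
      gcongr
    linarith
  · refine le_trans ?_ (le_add_of_nonneg_left (Real.exp_pos _).le)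
    have := hquad b
    have := hquad star
    gcongr

/-- Whatever the set of candidates is, the terms in the bound for the conditional mean loss are
dominated by quantities that do not depend on this set. -/
lemma exp_le_pairTerm_add_manyTerm (hρ : 0 < ρ) (hKρ : K * ρ < 1) (hl : 0 ≤ l) (hs : ∀ a, 0 < s a)
    (hle : 3 ≤ K → ∀ a, ρ ≤ s a / ∑ b, s b) (hbs : b ≠ star) (hb : b ∈ S) (hstar : star ∈ S)
    {x : Fin K → ℝ} :
    Real.exp (l * ((x b / share ρ S s b - x star / share ρ S s star) / √T)) *
      Real.exp (l ^ 2 / 2 * ((share ρ S s b - ρ) * s b / share ρ S s b ^ 2 +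
        (share ρ S s star - ρ) * s star / share ρ S s star ^ 2) + ω) ≤
      pairTerm ρ l ω T s x star b + if 3 ≤ K then manyTerm ρ l ω T s x star b else 0 := by
  have hsub : {b, star} ⊆ S := by
    intro a ha
    rcases Finset.mem_insert.1 ha with rfl | ha
    · exact hb
    · rwa [Finset.mem_singleton.1 ha]
  have hcard := Finset.card_le_card hsub
  rw [Finset.card_pair hbs] at hcard
  rcases hcard.eq_or_lt with h2 | h3
  · have hS : S = {b, star} :=
      (Finset.eq_of_subset_of_card_le hsub (by rw [Finset.card_pair hbs, ← h2])).symm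
    rw [hS]
    refine le_add_of_nonneg_right ?_
    split_ifs
    exacts [manyTerm_nonneg, le_rfl]
  · have hK : 3 ≤ K := by
      have := S.card_le_univ
      rw [Fintype.card_fin] at this
      omega
    rw [if_pos hK]
    exact (exp_le_manyTerm hρ hKρ hl hs (hle hK) h3 hb hstar).trans
      (le_add_of_nonneg_left pairTerm_nonneg)

lemma meanLE_pairTerm [IsProbabilityMeasure q] (hT : 0 < T) (hb : b ≠ star) {M : ℝ}
    (hM : 0 ≤ M) (hρ : 0 < ρ) (hρ1 : ρ ≤ 1) (hKρ : K * ρ < 1) (hn : n ≤ ρ * T) {s₁ θ η : ℝ}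
    (hl : 0 ≤ l) (hm : ∀ a, MemLp (fun y => y a - μ a) 2 q) (hθ : 0 ≤ θ) (hθ1 : θ ≤ 1) (hη : 0 ≤ η)
    (hc : Real.exp (l * (2 * M) / (ρ * √T)) ≤ 1 + θ)
    (hω : l ^ 2 / ρ ^ 2 * (s₁ * θ + 2 * η) ≤ ω) (hs : ∀ a, 0 < s a)
    (hshare : ∀ a ∈ ({b, star} : Finset (Fin K)), ρ ≤ share ρ {b, star} s a)
    (h : ∀ a, a = b ∨ a = star → s a ≤ s₁ ∧ ∫ y, (y a - μ a) ^ 2 ∂q ≤ s a + η) :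
    MeanLE (Measure.pi fun _ : Fin K × Fin n => q)
      (fun y => pairTerm ρ l ω T s
        (fun a => pilotSum (core q M fun y => y a - μ a) a y) star b)
      (Real.exp (l ^ 2 / 2 * ((√(s b) + √(s star)) ^ 2 / (1 - ((K : ℝ) - 2) * ρ)) + 2 * ω)) := by
  set p := share ρ {b, star} s with hp
  have hpb : ρ ≤ p b := hshare b (by simp)
  have hps : ρ ≤ p star := hshare star (by simp)
  have hpb0 := hρ.trans_le hpb
  have hps0 := hρ.trans_le hps
  have hp' : ∀ a, a = b ∨ a = star → ρ ≤ p a := by rintro a (rfl | rfl) <;> assumption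
  have h1 := one_sub_pos (S := {b, star}) hρ hKρ
  rw [Finset.card_pair hb, Nat.cast_ofNat] at h1
  have hE := (meanLE_exp_pilotSum (c := fun a => (p a)⁻¹) hT hb hM hρ hρ1 hn hl hm hθ hθ1 hη hc hω
    fun a ha => ⟨inv_nonneg.2 (hρ.le.trans (hp' a ha)), by
      rw [one_div]; exact inv_anti₀ hρ (hp' a ha), (hs a).le, (h a ha).1, (h a ha).2⟩).const_mul
    (k := Real.exp (l ^ 2 / 2 * ((p b - ρ) * s b / p b ^ 2 +
      (p star - ρ) * s star / p star ^ 2) + ω)) (Real.exp_pos _).le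
  refine hE.mono (fun y => le_of_eq ?_) (le_of_eq ?_)
  · rw [pairTerm, mul_comm, ← hp]
    congr 3
    ring
  · rw [← Real.exp_add, ← sum_div_share_pair hs hb h1, ← hp]
    congr 1
    field_simp
    ring

lemma meanLE_manyTerm [IsProbabilityMeasure q] (hT : 0 < T) (hb : b ≠ star) {M : ℝ}
    (hM : 0 ≤ M) (hρ : 0 < ρ) (hρ1 : ρ ≤ 1) (hn : n ≤ ρ * T) {s₁ θ η : ℝ} (hω0 : 0 ≤ ω)
    (hl : 0 ≤ l) (hm : ∀ a, MemLp (fun y => y a - μ a) 2 q) (hθ : 0 ≤ θ) (hθ1 : θ ≤ 1) (hη : 0 ≤ η)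
    (hc : Real.exp (l * (2 * M) / (ρ * √T)) ≤ 1 + θ)
    (hω : l ^ 2 / ρ ^ 2 * (s₁ * θ + 2 * η) ≤ ω) (hs : ∀ a, 0 < s a)
    (hle : ∀ a, ρ ≤ s a / ∑ b, s b)
    (h : ∀ a, a = b ∨ a = star → s a ≤ s₁ ∧ ∫ y, (y a - μ a) ^ 2 ∂q ≤ s a + η) :
    MeanLE (Measure.pi fun _ : Fin K × Fin n => q)
      (fun y => manyTerm ρ l ω T s
        (fun a => pilotSum (core q M fun y => y a - μ a) a y) star b)
      (2 * Real.exp (5 / 4 * l ^ 2 * (∑ a, s a) + 2 * ω)) := by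
  set V := ∑ a, s a with hV
  have hV0 : 0 < V := Finset.sum_pos (fun a _ => hs a) ⟨b, Finset.mem_univ b⟩
  have hE := (meanLE_exp_pilotSum (c := fun a => V / s a) hT hb hM hρ hρ1 hn hl hm hθ hθ1 hη hc hω
    fun a ha => ⟨div_nonneg hV0.le (hs a).le, by
      rw [div_le_div_iff₀ (hs a) hρ, one_mul, mul_comm]
      exact (le_div_iff₀ hV0).1 (hle a), (hs a).le, (h a ha).1, (h a ha).2⟩).const_mul
    (k := Real.exp (l ^ 2 / 2 * ((5 / 4 * V - ρ * V ^ 2 / s b) +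
      (5 / 4 * V - ρ * V ^ 2 / s star)) + ω)) (Real.exp_pos _).le
  refine ((MeanLE.const (Real.exp (5 / 4 * l ^ 2 * V + ω))).add hE).mono
    (fun y => le_of_eq ?_) ?_
  · rw [manyTerm, ← hV]
    ring
  · have e : l ^ 2 / 2 * ((5 / 4 * V - ρ * V ^ 2 / s b) + (5 / 4 * V - ρ * V ^ 2 / s star)) + ω +
        (l ^ 2 / 2 * (ρ * ((V / s b) ^ 2 * s b + (V / s star) ^ 2 * s star)) + ω) =
        5 / 4 * l ^ 2 * V + 2 * ω := by
      have := (hs b).ne'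
      have := (hs star).ne'
      field_simp
      ring
    rw [← Real.exp_add, e]
    have := Real.exp_le_exp.2 (show 5 / 4 * l ^ 2 * V + ω ≤ 5 / 4 * l ^ 2 * V + 2 * ω by linarith)
    linarith

end Exponential

/-! ### The mean loss for a given horizon -/

section Horizon

variable {K T : ℕ} {r ρ : ℝ} {s : Fin K → ℝ} {S : Finset (Fin K)} {a : Fin K}

lemma share_le_one (hρ : 0 < ρ) (hs : ∀ a, 0 < s a) (ha : a ∈ S) : share ρ S s a ≤ 1 := by
  have h1 : scale S s a ≤ ∑ b ∈ S, scale S s b :=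
    Finset.single_le_sum (fun b _ => (scale_pos (hs b)).le) ha
  have h2 : scale S s a / ∑ b ∈ S, scale S s b ≤ 1 :=
    div_le_one_of_le₀ h1 (sum_scale_pos ⟨a, ha⟩ fun b _ => hs b).le
  have h3 : 0 ≤ scale S s a / ∑ b ∈ S, scale S s b :=
    div_nonneg (scale_pos (hs a)).le (sum_scale_pos ⟨a, ha⟩ fun b _ => hs b).le
  have h4 : (S.card : ℝ) ≤ K := by
    have := S.card_le_univ
    rw [Fintype.card_fin] at this
    exact_mod_cast this
  have h5 : 1 - ((K : ℝ) - S.card) * ρ ≤ 1 := by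
    have : 0 ≤ ((K : ℝ) - S.card) * ρ := mul_nonneg (sub_nonneg.2 h4) hρ.le
    linarith
  exact (mul_le_mul_of_nonneg_left h5 h3).trans (by rwa [mul_one])

lemma pilotSize_bounds [NeZero K] (hr0 : 0 < r) (hr : r < 1) (hρ : ρ = r / K) (hT : 4 ≤ ρ * T) :
    2 ≤ pilotSize K r T ∧ ρ * T / 2 ≤ pilotSize K r T ∧ (pilotSize K r T : ℝ) ≤ ρ * T ∧
      ρ * T - 1 ≤ pilotSize K r T ∧ K * pilotSize K r T ≤ T := by
  have hK : (0 : ℝ) < K := by exact_mod_cast Nat.pos_of_ne_zero (NeZero.ne K)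
  have e : r * T / K = ρ * T := by rw [hρ]; ring
  have h1 : (pilotSize K r T : ℝ) ≤ ρ * T := by
    rw [pilotSize, e]; exact Nat.floor_le (by linarith)
  have h2 : ρ * T - 1 < pilotSize K r T := by
    rw [pilotSize, e]; exact Nat.sub_one_lt_floor _
  have h3 : (K * pilotSize K r T : ℝ) ≤ T := by
    calc (K * pilotSize K r T : ℝ) ≤ K * (ρ * T) := by gcongr
      _ = r * T := by rw [hρ]; field_simp
      _ ≤ 1 * T := by gcongr
      _ = T := one_mul _
  refine ⟨?_, by linarith, h1, h2.le, by exact_mod_cast h3⟩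
  have : (2 : ℝ) ≤ pilotSize K r T := by linarith
  exact_mod_cast this

/-- The frequency of a candidate after both stages is close to its share. -/
lemma abs_frequency_sub_le {n p x δ₁ δ : ℝ} (hT : (0 : ℝ) < T) (hKρ : K * ρ < 1)
    (hn : n ≤ ρ * T) (hn' : ρ * T - 1 ≤ n) (hρ : 0 < ρ) (hx0 : 0 ≤ x) (hx1 : x ≤ 1)
    (hx : |x - (p - ρ) / (1 - K * ρ)| ≤ δ₁) (hδ : (1 + K) / (T : ℝ) + δ₁ ≤ δ) :
    (T - K * n) * x / T ≤ p - ρ + δ ∧ |(n + (T - K * n) * x) / T - p| ≤ δ := by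
  have hD : 0 < 1 - K * ρ := by linarith
  have hD1 : 1 - K * ρ ≤ 1 := by
    have : 0 ≤ K * ρ := by positivity
    linarith
  set e := x - (p - ρ) / (1 - K * ρ) with he
  have hxe : (1 - K * ρ) * x = p - ρ + (1 - K * ρ) * e := by
    rw [he]; field_simp; ring
  set f := (ρ * T - n) / T with hf
  have hf0 : 0 ≤ f := div_nonneg (by linarith) hT.le
  have hf1 : f ≤ 1 / T := by rw [hf]; gcongr; linarith
  have e1 : (T - K * n) * x / T = p - ρ + (1 - K * ρ) * e + K * f * x := by
    rw [← hxe, hf]; field_simp; ring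
  have e2 : (n + (T - K * n) * x) / T = p + (1 - K * ρ) * e + K * f * x - f := by
    have : (n + (T - K * n) * x) / T = n / T + (T - K * n) * x / T := by ring
    rw [this, e1, hf]; field_simp; ring
  have h1 : |(1 - K * ρ) * e| ≤ δ₁ := by
    rw [abs_mul, abs_of_pos hD]
    calc _ ≤ 1 * |e| := by gcongr
      _ ≤ δ₁ := by rw [one_mul]; exact hx
  have h2 : 0 ≤ K * f * x := by positivity
  have h3 : K * f * x ≤ K / T := by
    calc K * f * x ≤ K * (1 / T) * 1 := by gcongr
      _ = K / T := by ring
  have h4 : (1 + K) / (T : ℝ) = 1 / T + K / T := by ring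
  have h5 := abs_le.1 h1
  have h6 : 0 ≤ 1 / (T : ℝ) := by positivity
  have h7 : 0 ≤ (K : ℝ) / T := by positivity
  rw [e1, e2]
  refine ⟨by linarith, abs_le.2 ⟨by linarith, by linarith⟩⟩

/-- Lower and upper bounds for the confidence radius. -/
lemma radius_bounds [NeZero K] {n : ℕ} {z : Fin K → Fin n → ℝ} (hT : 0 < T) (hn : 0 < n)
    (hnT : n ≤ T) (hnT' : ρ * T / 2 ≤ n) (hρ : 0 < ρ) {s₀ s₁ : ℝ}
    (hs : ∀ a, s₀ ≤ pilotVar z a ∧ pilotVar z a ≤ s₁) :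
    √(Real.log T) * √s₀ ≤ √T * radius T z ∧
      radius T z ≤ √(Real.log T / (ρ * T / 2)) * √s₁ := by
  have hT' : (0 : ℝ) < T := by exact_mod_cast hT
  have hn' : (0 : ℝ) < n := by exact_mod_cast hn
  have hlog : 0 ≤ Real.log T := Real.log_natCast_nonneg T
  have h1 : √s₀ ≤ ⨆ b, √(pilotVar z b) :=
    le_ciSup_of_le (Set.finite_range _).bddAbove 0 (Real.sqrt_le_sqrt (hs 0).1)
  have h2 : ⨆ b, √(pilotVar z b) ≤ √s₁ := ciSup_le fun b => Real.sqrt_le_sqrt (hs b).2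
  have hsup : 0 ≤ ⨆ b, √(pilotVar z b) := (Real.sqrt_nonneg _).trans h1
  unfold radius
  constructor
  · rw [← mul_assoc, ← Real.sqrt_mul hT'.le]
    gcongr
    rw [mul_div_assoc', le_div_iff₀ hn', mul_comm]
    have : (n : ℝ) ≤ T := by exact_mod_cast hnT
    gcongr
  · gcongr

/-- The conditional mean of the scaled loss for typical pilot observations. The parameters are: `C`
and `η₁`, which define typical observations; `Λ`, the margin of the confidence radius over the pilot
noise; the tangent `β + γ * exp (l * t)`; `κ`, the weight in the comparison of frequencies and
shares; `M` and `ε`, the truncation level and its error; `θ`, the error in the exponential moments;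
`η` and `d`, the accuracy of the variances and the modulus of continuity; `δ₁` and `δ`, the accuracy
of the drawing probabilities and of the frequencies; and `ω`, the resulting error in the exponent.
The argument `x a` is arbitrary; it stands for the bounded part of the pilot noise. -/
lemma meanLE_of_typical [NeZero K] {θ₁ θ₂ : ℝ} {v : Fin K → ℝ → ℝ}
    {Q : (Fin K → ℝ) → Measure (Fin K → ℝ)} (hU : IsUniformModel θ₁ θ₂ v Q)
    {μ : Fin K → ℝ} (hμ : μ ∈ Set.univ.pi (fun _ : Fin K => Icc θ₁ θ₂))
    (hr0 : 0 < r) (hr : r < 1) (hρ : ρ = r / K)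
    {sel : (Fin K → ℝ) → Fin K} (hsel_max : ∀ (x : Fin K → ℝ) (b : Fin K), x b ≤ x (sel x))
    {star : Fin K} (hstar : ∀ a, μ a ≤ μ star)
    {s₀ s₁ : ℝ} (hs₀ : 0 < s₀) (hsb : ∀ a, ∀ m ∈ Icc θ₁ θ₂, s₀ ≤ v a m ∧ v a m ≤ s₁)
    (hshare : ∀ m ∈ Icc θ₁ θ₂, ∀ S : Finset (Fin K), 2 ≤ S.card → ∀ a ∈ S,
      ρ ≤ share ρ S (fun b => v b m) a)
    (hle : 3 ≤ K → ∀ m ∈ Icc θ₁ θ₂, ∀ a, ρ ≤ v a m / ∑ b, v b m)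
    {C Λ β γ l κ M ε θ η δ δ₁ ω η₁ d : ℝ} (hΛ : 0 < Λ) (hl : 0 ≤ l) (hM : 0 ≤ M)
    (hβ : 0 ≤ β) (hγ : 0 ≤ γ) (hκ : 0 < κ) (htan : ∀ t, t ≤ β + γ * Real.exp (l * t))
    (hε : ∀ a, ∫ y, tail M (y a - μ a) ^ 2 ∂(Q μ) ≤ ε)
    (hθ : 0 ≤ θ) (hθ1 : θ ≤ 1) (hη : 0 ≤ η) (hη1 : η ≤ 1) (hηs : η ≤ s₀ / 2) (hδ : 0 ≤ δ)
    (hc : Real.exp (l * (2 * M) / (ρ * √T)) ≤ 1 + θ)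
    (hω : l ^ 2 / ρ ^ 2 * (s₁ * θ + 2 * η + 2 * δ * (s₁ + η)) ≤ ω)
    (hd : ∀ a, ∀ m ∈ Icc θ₁ θ₂, ∀ m' ∈ Icc θ₁ θ₂, |m - m'| ≤ d → |v a m - v a m'| ≤ η)
    (hmod : ∀ (S : Finset (Fin K)) (a : Fin K), S.Nonempty → ∀ s s' : Fin K → ℝ,
      (∀ a, s₀ ≤ s a ∧ s a ≤ s₁) → (∀ a ∈ S, |s' a - s a| ≤ 2 * η) →
      |drawProb ρ S s' a - drawProb ρ S s a| ≤ δ₁)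
    (hδ₁ : (1 + K) / (T : ℝ) + δ₁ ≤ δ) (hT4 : 4 ≤ ρ * T)
    (hvar : 2 * η₁ + 2 * (s₁ + 2 * C ^ 2 / ρ) / (ρ * T / 2) ≤ η)
    (hrad : Λ + 4 * C / ρ ≤ 2 * (√(Real.log T) * √(s₀ / 2)))
    (hrad' : 2 * (√(Real.log T / (ρ * T / 2)) * √(s₁ + 1)) + 4 * C / ρ / √T ≤ d)
    {n : ℕ} (hn : n = pilotSize K r T) {z : Fin K → Fin n → ℝ}
    (hx : ∀ a, |pilotNoise μ z a| ≤ C * √T)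
    (hx' : ∀ a, |sqNoise μ (v a (μ a)) z a| ≤ η₁ * n) {x : Fin K → ℝ} :
    MeanLE (Measure.pi fun _ : Fin (T - K * n) => (armLaw r T z).prod (Q μ))
      (fun w => √T * (μ star - μ (recommend sel T z w)))
      (8 * K ^ 2 / (ρ ^ 2 * Λ) * (C ^ 2 + s₁) +
        (∑ a, |pilotNoise μ z a - x a| / (ρ * √T) + K * √ε / ρ +
          K * ((κ * (2 * C ^ 2 + 2 * s₁) + (2 / T + 2 * δ ^ 2) / κ) / ρ ^ 2)) +
        (β + γ * ∑ b with b ≠ star ∧ v b (μ b) ≤ v b (μ star) + η,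
          (pairTerm ρ l ω T (fun a => v a (μ star)) x star b +
            if 3 ≤ K then manyTerm ρ l ω T (fun a => v a (μ star)) x star b else 0))) := by
  have hprob := hU.prob μ hμ
  have hK : (0 : ℝ) < K := by exact_mod_cast Nat.pos_of_ne_zero (NeZero.ne K)
  have hρ0 : 0 < ρ := by rw [hρ]; positivity
  have hKρ : K * ρ < 1 := by rw [hρ, mul_div_cancel₀ _ hK.ne']; exact hr
  have hT' : (0 : ℝ) < T := by
    by_contra hneg
    nlinarith [Nat.cast_nonneg (α := ℝ) T]
  have hT : 0 < T := by exact_mod_cast hT'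
  obtain ⟨hn2, hnlow, hnup, hnlow', hKn⟩ := pilotSize_bounds (K := K) (T := T) hr0 hr hρ hT4
  rw [← hn] at hn2 hnlow hnup hnlow' hKn
  have hn0 : 0 < n := by omega
  have hnT : n ≤ T := le_trans (Nat.le_mul_of_pos_left n (Nat.pos_of_ne_zero (NeZero.ne K))) hKn
  have := isProbabilityMeasure_armLaw (T := T) (z := z) hr
  have hmem : ∀ a, μ a ∈ Icc θ₁ θ₂ := fun a => hμ a (mem_univ a)
  have hs₁0 : 0 ≤ s₁ := hs₀.le.trans ((hsb star _ (hmem star)).1.trans (hsb star _ (hmem star)).2)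
  have hsv : ∀ a, ∫ y, (y a - μ a) ^ 2 ∂(Q μ) = v a (μ a) := hU.variance μ hμ
  -- The sample variances are close to the true ones.
  have hpv : ∀ a, |pilotVar z a - v a (μ a)| ≤ η := by
    intro a
    refine (abs_pilotVar_sub_le hn2 hρ0 hnlow (hx a) (hU.pos a _ (hmem a)).le
      (hsb a _ (hmem a)).2 (hx' a)).trans (le_trans ?_ hvar)
    have : 0 ≤ 2 * (s₁ + 2 * C ^ 2 / ρ) := by positivity
    gcongr
  have hpv' : ∀ a, s₀ / 2 ≤ pilotVar z a ∧ pilotVar z a ≤ s₁ + 1 := fun a => by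
    have h1 := abs_le.1 (hpv a)
    have h2 := hsb a _ (hmem a)
    constructor <;> linarith
  obtain ⟨hR1, hR2⟩ := radius_bounds hT hn0 hnT hnlow hρ0 hpv'
  have hrad2 : Λ + 4 * C / ρ ≤ 2 * (√T * radius T z) := hrad.trans (by linarith)
  have hstarS := star_mem_candidates hT hρ0 hnlow hx hstar hΛ hrad2
  have hbound0 : 0 ≤ γ * ∑ b with b ≠ star ∧ v b (μ b) ≤ v b (μ star) + η,
      (pairTerm ρ l ω T (fun a => v a (μ star)) x star b +
        if 3 ≤ K then manyTerm ρ l ω T (fun a => v a (μ star)) x star b else 0) := by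
    refine mul_nonneg hγ (Finset.sum_nonneg fun b _ => add_nonneg pairTerm_nonneg ?_)
    split_ifs
    exacts [manyTerm_nonneg, le_rfl]
  by_cases hns : ∃ a, candidates T z = {a}
  · obtain ⟨a, ha⟩ := hns
    have : a = star := by rw [ha, Finset.mem_singleton] at hstarS; exact hstarS.symm
    refine (MeanLE.const 0).mono (fun w => ?_) ?_
    · rw [recommend_of_singleton ha, this, sub_self, mul_zero]
    · have : 0 ≤ ∑ a, |pilotNoise μ z a - x a| / (ρ * √T) :=
        Finset.sum_nonneg fun a _ => by positivity
      positivity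
  have hcard : 2 ≤ (candidates T z).card := by
    have h1 : 0 < (candidates T z).card := Finset.card_pos.2 ⟨star, hstarS⟩
    have h2 : (candidates T z).card ≠ 1 := fun h => hns (Finset.card_eq_one.1 h)
    omega
  have hspos : ∀ a, 0 < v a (μ star) := fun a => hU.pos a _ (hmem star)
  -- The candidates have nearly the same mean, hence their variances are nearly those at `μ star`.
  have hclose : ∀ a ∈ candidates T z, |v a (μ a) - v a (μ star)| ≤ η := by
    intro a ha
    refine hd a _ (hmem a) _ (hmem star) ?_
    have h1 := gap_le_of_mem_candidates (star := star) hT hρ0 hnlow hx ha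
    rw [abs_sub_comm, abs_of_nonneg (sub_nonneg.2 (hstar a))]
    linarith
  have hdraw : ∀ a ∈ candidates T z, |allocProb r T z a -
      (share ρ (candidates T z) (fun a => v a (μ star)) a - ρ) / (1 - K * ρ)| ≤ δ₁ := by
    intro a ha
    rw [allocProb_eq_drawProb hr0 (fun a _ => lt_of_lt_of_le (by positivity) (hpv' a).1), ← hρ,
      ← drawProb_eq ⟨star, hstarS⟩ (fun a _ => hspos a)
        (hshare _ (hmem star) _ hcard) ha]
    refine hmod _ a ⟨star, hstarS⟩ _ _ (fun a => hsb a _ (hmem star)) fun b hb => ?_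
    have h1 := abs_le.1 (hpv b)
    have h2 := abs_le.1 (hclose b hb)
    exact abs_le.2 ⟨by linarith, by linarith⟩
  have hN : ((T - K * n : ℕ) : ℝ) = T - K * n := by
    rw [Nat.cast_sub hKn]; push_cast; ring
  refine (meanLE_sqrt_mul_gap (N := T - K * n) (p := share ρ (candidates T z) fun a => v a (μ star))
    (s := fun a => v a (μ star)) (x := x) hr hT (Nat.sub_le _ _) hρ0 hnlow hx hstar hΛ
    hrad2 hsel_max hns (hU.memLp μ hμ) (hU.mean μ hμ) hl hM hβ hγ hκ htan
    (fun a => (hsv a).le.trans (hsb a _ (hmem a)).2) hε hθ hθ1 hη hδ hc hω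
    fun a ha => ?_).mono (fun w => le_rfl) ?_
  · have h1 := abs_frequency_sub_le (n := n) hT' hKρ hnup hnlow' hρ0 (allocProb_nonneg hr a)
      (allocProb_le_one hr a) (hdraw a ha) hδ₁
    have h2 := abs_le.1 (hclose a ha)
    rw [hN]
    exact ⟨hshare _ (hmem star) _ hcard a ha, share_le_one hρ0 hspos ha, (hspos a).le,
      (hsb a _ (hmem star)).2, by rw [hsv a]; linarith, h1⟩
  · refine add_le_add le_rfl (add_le_add le_rfl (mul_le_mul_of_nonneg_left ?_ hγ))
    refine (Finset.sum_le_sum fun b hb => exp_le_pairTerm_add_manyTerm hρ0 hKρ hl hspos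
      (fun h3 => hle h3 _ (hmem star)) (Finset.ne_of_mem_erase hb)
      (Finset.mem_of_mem_erase hb) hstarS).trans ?_
    refine Finset.sum_le_sum_of_subset_of_nonneg (fun b hb => ?_) fun b _ _ =>
      add_nonneg pairTerm_nonneg ?_
    · simp only [Finset.mem_filter, Finset.mem_univ, true_and]
      have h2 := abs_le.1 (hclose b (Finset.mem_of_mem_erase hb))
      exact ⟨Finset.ne_of_mem_erase hb, by linarith⟩
    · split_ifs
      exacts [manyTerm_nonneg, le_rfl]

end Horizon

/-! ### The regret for large horizons -/

section LargeHorizon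

variable {K T : ℕ} {r ρ : ℝ}

/-- The mean of the pilot noise that is lost by truncating the observations. -/
lemma meanLE_pilotNoise_sub_core {n : ℕ} {q : Measure (Fin K → ℝ)} [IsProbabilityMeasure q]
    {μ : Fin K → ℝ} {a : Fin K} (hT : 0 < T) (hnT : n ≤ T) (hρ : 0 < ρ)
    (hm : MemLp (fun y => y a - μ a) 2 q) (h0 : ∫ y, (y a - μ a) ∂q = 0) {M ε : ℝ} (hM : 0 ≤ M)
    (hε : ∫ y, tail M (y a - μ a) ^ 2 ∂q ≤ ε) :
    MeanLE (Measure.pi fun _ : Fin K × Fin n => q)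
      (fun y => |pilotNoise μ (pilotObs y) a -
        pilotSum (core q M fun y => y a - μ a) a y| / (ρ * √T)) (√ε / ρ) := by
  have hT' : (0 : ℝ) < T := by exact_mod_cast hT
  have hnT' : (n : ℝ) ≤ T := by exact_mod_cast hnT
  have hX : Measurable fun y : Fin K → ℝ => y a - μ a := by fun_prop
  have hL := hm.sub (memLp_core (q := q) hX hM)
  have hle := (integral_abs_pilotSum_le (n := n) hL (integral_sub_core hX hm h0 hM) a
    (integral_sub_core_sq_le hX hm h0 hM)).trans (Real.sqrt_le_sqrt
      (show (n : ℝ) * ∫ y, tail M (y a - μ a) ^ 2 ∂q ≤ T * ε by gcongr))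
  refine ((MeanLE.of_integrable ((memLp_pilotSum (n := n) hL a).integrable
    (by norm_num)).abs hle).const_mul (k := 1 / (ρ * √T)) (by positivity)).mono
      (fun y => le_of_eq ?_) (le_of_eq ?_)
  · rw [one_div_mul_eq_div]
    congr 2
    simp only [pilotNoise, pilotObs, pilotSum, ← Finset.sum_sub_distrib]
    rfl
  · rw [Real.sqrt_mul hT'.le]
    field_simp

/-- The scaled regret for a fixed horizon, with the parameters of `meanLE_of_typical`, the weight
`τ` of `untypicalBound`, and a second truncation level `M₂` with error `ε₂` for the sample
variances. All terms but `β + γ * D` become small for a suitable choice of the parameters and large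
horizons. -/
lemma sqrt_mul_regret_le_of_horizon [NeZero K] {θ₁ θ₂ : ℝ} {v : Fin K → ℝ → ℝ}
    {Q : (Fin K → ℝ) → Measure (Fin K → ℝ)} (hU : IsUniformModel θ₁ θ₂ v Q)
    {μ : Fin K → ℝ} (hμ : μ ∈ Set.univ.pi (fun _ : Fin K => Icc θ₁ θ₂))
    (hr0 : 0 < r) (hr : r < 1) (hρ : ρ = r / K)
    {sel : (Fin K → ℝ) → Fin K} (hsel : Measurable sel)
    (hsel_max : ∀ (x : Fin K → ℝ) (b : Fin K), x b ≤ x (sel x))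
    {s₀ s₁ : ℝ} (hs₀ : 0 < s₀) (hsb : ∀ a, ∀ m ∈ Icc θ₁ θ₂, s₀ ≤ v a m ∧ v a m ≤ s₁)
    (hshare : ∀ m ∈ Icc θ₁ θ₂, ∀ S : Finset (Fin K), 2 ≤ S.card → ∀ a ∈ S,
      ρ ≤ share ρ S (fun b => v b m) a)
    (hle : 3 ≤ K → ∀ m ∈ Icc θ₁ θ₂, ∀ a, ρ ≤ v a m / ∑ b, v b m)
    {C Λ β γ l κ M ε θ η δ δ₁ ω η₁ d D τ M₂ ε₂ : ℝ} (hΛ : 0 < Λ) (hl : 0 ≤ l) (hM : 0 ≤ M)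
    (hβ : 0 ≤ β) (hγ : 0 ≤ γ) (hκ : 0 < κ) (htan : ∀ t, t ≤ β + γ * Real.exp (l * t))
    (hD : ∀ m ∈ Icc θ₁ θ₂, ∀ star, ∑ b ∈ Finset.univ.erase star,
      (Real.exp (l ^ 2 / 2 * ((√(v b m) + √(v star m)) ^ 2 / (1 - ((K : ℝ) - 2) * ρ))) +
        if 3 ≤ K then 2 * Real.exp (5 / 4 * l ^ 2 * ∑ a, v a m) else 0) ≤ D)
    (hε : ∀ a, ∫ y, tail M (y a - μ a) ^ 2 ∂(Q μ) ≤ ε) (hC : 0 < C)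
    (hθ : 0 ≤ θ) (hθ1 : θ ≤ 1) (hη : 0 ≤ η) (hη1 : η ≤ 1) (hηs : η ≤ s₀ / 2) (hδ : 0 ≤ δ)
    (hc : Real.exp (l * (2 * M) / (ρ * √T)) ≤ 1 + θ)
    (hω : l ^ 2 / ρ ^ 2 * (s₁ * θ + 2 * η + 2 * δ * (s₁ + η)) ≤ ω)
    (hd : ∀ a, ∀ m ∈ Icc θ₁ θ₂, ∀ m' ∈ Icc θ₁ θ₂, |m - m'| ≤ d → |v a m - v a m'| ≤ η)
    (hmod : ∀ (S : Finset (Fin K)) (a : Fin K), S.Nonempty → ∀ s s' : Fin K → ℝ,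
      (∀ a, s₀ ≤ s a ∧ s a ≤ s₁) → (∀ a ∈ S, |s' a - s a| ≤ 2 * η) →
      |drawProb ρ S s' a - drawProb ρ S s a| ≤ δ₁)
    (hδ₁ : (1 + K) / (T : ℝ) + δ₁ ≤ δ) (hT4 : 4 ≤ ρ * T)
    (hvar : 2 * η₁ + 2 * (s₁ + 2 * C ^ 2 / ρ) / (ρ * T / 2) ≤ η)
    (hrad : Λ + 4 * C / ρ ≤ 2 * (√(Real.log T) * √(s₀ / 2)))
    (hrad' : 2 * (√(Real.log T / (ρ * T / 2)) * √(s₁ + 1)) + 4 * C / ρ / √T ≤ d)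
    (hη₁ : 0 < η₁) (hτ : 0 < τ) (hM₂ : 0 ≤ M₂)
    (hε₂ : ∀ a, ∫ y, tail M₂ (y a - μ a) ^ 2 ∂(Q μ) ≤ ε₂) :
    √T * regret r sel T (Q μ) μ ≤ 8 * K ^ 2 / (ρ ^ 2 * Λ) * (C ^ 2 + s₁) +
      (K * (√ε / ρ) + K * √ε / ρ +
        K * ((κ * (2 * C ^ 2 + 2 * s₁) + (2 / T + 2 * δ ^ 2) / κ) / ρ ^ 2)) +
      (β + γ * (Real.exp (2 * ω) * D)) +
      (τ * (16 * K ^ 2 / ρ ^ 2 * s₁) +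
        1 / (4 * τ) * (K * (s₁ / C ^ 2 + (M₂ ^ 2 / √(ρ * T / 2) + 2 * ε₂) / η₁))) := by
  have hprob := hU.prob μ hμ
  have hK : (0 : ℝ) < K := by exact_mod_cast Nat.pos_of_ne_zero (NeZero.ne K)
  have hρ0 : 0 < ρ := by rw [hρ]; positivity
  have hKρ : K * ρ < 1 := by rw [hρ, mul_div_cancel₀ _ hK.ne']; exact hr
  have hK1 : (1 : ℝ) ≤ K := by exact_mod_cast Nat.pos_of_ne_zero (NeZero.ne K)
  have hρ1 : ρ ≤ 1 := by nlinarith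
  have hT' : (0 : ℝ) < T := by
    by_contra hneg
    nlinarith [Nat.cast_nonneg (α := ℝ) T]
  have hT : 0 < T := by exact_mod_cast hT'
  obtain ⟨hn2, hnlow, hnup, hnlow', hKn⟩ := pilotSize_bounds (K := K) (T := T) hr0 hr hρ hT4
  have hn0 : 0 < pilotSize K r T := by omega
  have hnT : pilotSize K r T ≤ T :=
    le_trans (Nat.le_mul_of_pos_left _ (Nat.pos_of_ne_zero (NeZero.ne K))) hKn
  have hmem : ∀ a, μ a ∈ Icc θ₁ θ₂ := fun a => hμ a (mem_univ a)
  have hsv : ∀ a, ∫ y, (y a - μ a) ^ 2 ∂(Q μ) = v a (μ a) := hU.variance μ hμ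
  have hsv₁ : ∀ a, ∫ y, (y a - μ a) ^ 2 ∂(Q μ) ≤ s₁ := fun a =>
    (hsv a).le.trans (hsb a _ (hmem a)).2
  have hs₁ : 0 ≤ s₁ := (integral_nonneg fun _ => sq_nonneg _).trans (hsv₁ 0)
  obtain ⟨star, hstar⟩ := Finite.exists_max μ
  have hsup : ⨆ a, μ a = μ star :=
    le_antisymm (ciSup_le hstar) (le_ciSup (Set.finite_range μ).bddAbove star)
  have hspos : ∀ a, 0 < v a (μ star) := fun a => hU.pos a _ (hmem star)
  let x : (Fin K × Fin (pilotSize K r T) → Fin K → ℝ) → Fin K → ℝ := fun y a =>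
    pilotSum (core (Q μ) M fun y => y a - μ a) a y
  let s : Fin K → ℝ := fun a => v a (μ star)
  let B : Finset (Fin K) := Finset.univ.filter fun b => b ≠ star ∧ v b (μ b) ≤ v b (μ star) + η
  let term : (Fin K × Fin (pilotSize K r T) → Fin K → ℝ) → Fin K → ℝ := fun y b =>
    pairTerm ρ l ω T s (x y) star b + if 3 ≤ K then manyTerm ρ l ω T s (x y) star b else 0
  let H₁ : (Fin K × Fin (pilotSize K r T) → Fin K → ℝ) → ℝ := fun y =>
    8 * K ^ 2 / (ρ ^ 2 * Λ) * (C ^ 2 + s₁) +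
      (∑ a, |pilotNoise μ (pilotObs y) a - x y a| / (ρ * √T) + K * √ε / ρ +
        K * ((κ * (2 * C ^ 2 + 2 * s₁) + (2 / T + 2 * δ ^ 2) / κ) / ρ ^ 2)) +
      (β + γ * ∑ b ∈ B, term y b)
  let H₂ : (Fin K × Fin (pilotSize K r T) → Fin K → ℝ) → ℝ := fun y =>
    untypicalBound ρ C τ η₁ s₁ T μ (fun a => ∫ y, (y a - μ a) ^ 2 ∂(Q μ)) (pilotObs y)
  have hterm : ∀ y b, 0 ≤ term y b := fun y b => by
    refine add_nonneg pairTerm_nonneg ?_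
    split_ifs
    exacts [manyTerm_nonneg, le_rfl]
  have hH₁ : ∀ y, 0 ≤ H₁ y := fun y => by
    have h1 : 0 ≤ ∑ a, |pilotNoise μ (pilotObs y) a - x y a| / (ρ * √T) :=
      Finset.sum_nonneg fun a _ => by positivity
    have h2 : 0 ≤ ∑ b ∈ B, term y b := Finset.sum_nonneg fun b _ => hterm y b
    positivity
  have hH₂ : ∀ y, 0 ≤ H₂ y := fun y => untypicalBound_nonneg hτ hη₁ hs₁ _
  -- The conditional bounds: typical and untypical pilot observations.
  have hcond : ∀ y, MeanLE (Measure.pi fun _ : Fin (T - K * pilotSize K r T) =>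
        (armLaw r T (pilotObs y)).prod (Q μ))
      (fun w => √T * ((⨆ a, μ a) - μ (recommend sel T (pilotObs y) w))) (H₁ y + H₂ y) := by
    intro y
    rw [hsup]
    by_cases hty : ∀ a, |pilotNoise μ (pilotObs y) a| ≤ C * √T ∧
        |sqNoise μ (∫ y, (y a - μ a) ^ 2 ∂(Q μ)) (pilotObs y) a| ≤ η₁ * (pilotSize K r T : ℝ)
    · exact (meanLE_of_typical hU hμ hr0 hr hρ hsel_max hstar hs₀ hsb hshare hle hΛ hl hM hβ hγ hκ
        htan hε hθ hθ1 hη hη1 hηs hδ hc hω hd hmod hδ₁ hT4 hvar hrad hrad' rfl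
        (fun a => (hty a).1) (fun a => by rw [← hsv a]; exact (hty a).2) (x := x y)).mono
        (fun w => le_rfl) (le_add_of_nonneg_right (hH₂ y))
    · exact (meanLE_sqrt_mul_gap_of_any hr hT (Nat.sub_le _ _) hρ0 hnlow hsel_max (hU.memLp μ hμ)
        (hU.mean μ hμ) hsv₁ star).mono (fun w => le_rfl)
        ((le_untypicalBound hT hn0 hC hτ hη₁ hs₁ hty).trans (le_add_of_nonneg_left (hH₁ y)))
  have hω' : l ^ 2 / ρ ^ 2 * (s₁ * θ + 2 * η) ≤ ω := by
    refine le_trans ?_ hω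
    have : 0 ≤ 2 * δ * (s₁ + η) := by positivity
    exact mul_le_mul_of_nonneg_left (by linarith) (by positivity)
  have hω0 : 0 ≤ ω := le_trans (by positivity) hω'
  let e : Fin K → ℝ := fun b =>
    Real.exp (l ^ 2 / 2 * ((√(v b (μ star)) + √(v star (μ star))) ^ 2 /
      (1 - ((K : ℝ) - 2) * ρ))) +
        if 3 ≤ K then 2 * Real.exp (5 / 4 * l ^ 2 * ∑ a, v a (μ star)) else 0
  have he : ∀ b, 0 ≤ e b := fun b => by
    simp only [e]
    split_ifs <;> positivity
  have hmean : ∀ b ∈ B, MeanLE (Measure.pi fun _ => Q μ) (fun y => term y b)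
      (Real.exp (2 * ω) * e b) := by
    intro b hb
    obtain ⟨hb1, hb2⟩ : b ≠ star ∧ v b (μ b) ≤ v b (μ star) + η := by simpa [B] using hb
    have hv : ∀ a, a = b ∨ a = star → s a ≤ s₁ ∧ ∫ y, (y a - μ a) ^ 2 ∂(Q μ) ≤ s a + η := by
      rintro a (rfl | rfl)
      · exact ⟨(hsb _ _ (hmem star)).2, (hsv _).le.trans hb2⟩
      · exact ⟨(hsb _ _ (hmem _)).2, (hsv _).le.trans (le_add_of_nonneg_right hη)⟩
    have h1 := meanLE_pairTerm (ω := ω) hT hb1 hM hρ0 hρ1 hKρ hnup hl (hU.memLp μ hμ) hθ hθ1 hη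
      hc hω' hspos (hshare _ (hmem star) {b, star} (by rw [Finset.card_pair hb1])) hv
    have h2 : MeanLE (Measure.pi fun _ => Q μ)
        (fun y => if 3 ≤ K then manyTerm ρ l ω T s (x y) star b else 0)
        (if 3 ≤ K then 2 * Real.exp (5 / 4 * l ^ 2 * (∑ a, v a (μ star)) + 2 * ω) else 0) := by
      split_ifs with h3
      · exact meanLE_manyTerm hT hb1 hM hρ0 hρ1 hnup hω0 hl (hU.memLp μ hμ) hθ hθ1 hη hc hω'
          hspos (hle h3 _ (hmem star)) hv
      · exact MeanLE.const 0
    refine (h1.add h2).mono (fun y => le_rfl) (le_of_eq ?_)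
    simp only [e]
    rw [mul_add]
    split_ifs
    · rw [Real.exp_add, Real.exp_add]; ring
    · rw [Real.exp_add]; ring
  have hB : ∑ b ∈ B, Real.exp (2 * ω) * e b ≤ Real.exp (2 * ω) * D := by
    rw [← Finset.mul_sum]
    refine mul_le_mul_of_nonneg_left (le_trans ?_ (hD _ (hmem star) star)) (Real.exp_pos _).le
    refine Finset.sum_le_sum_of_subset_of_nonneg (fun b hb => ?_) fun b _ _ => he b
    have : b ≠ star ∧ v b (μ b) ≤ v b (μ star) + η := by simpa [B] using hb
    simpa using this.1
  have hpn : ∀ a ∈ Finset.univ, MeanLE (Measure.pi fun _ : Fin K × Fin (pilotSize K r T) => Q μ)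
      (fun y => |pilotNoise μ (pilotObs y) a - x y a| / (ρ * √T)) (√ε / ρ) := fun a _ =>
    meanLE_pilotNoise_sub_core hT hnT hρ0 (hU.memLp μ hμ a) (hU.mean μ hμ a) hM (hε a)
  have hε₂0 : 0 ≤ ε₂ := (integral_nonneg fun _ => sq_nonneg _).trans (hε₂ 0)
  have hH₁m : MeanLE (Measure.pi fun _ => Q μ) H₁ (8 * K ^ 2 / (ρ ^ 2 * Λ) * (C ^ 2 + s₁) +
      (∑ _a : Fin K, √ε / ρ + K * √ε / ρ +
        K * ((κ * (2 * C ^ 2 + 2 * s₁) + (2 / T + 2 * δ ^ 2) / κ) / ρ ^ 2)) +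
      (β + γ * ∑ b ∈ B, Real.exp (2 * ω) * e b)) :=
    ((MeanLE.const _).add (((MeanLE.sum hpn).add (MeanLE.const _)).add (MeanLE.const _))).add
      ((MeanLE.const _).add ((MeanLE.sum hmean).const_mul hγ))
  have hH₂m := meanLE_untypicalBound (ρ := ρ) (τ := τ) hT hn0 hnT (hU.memLp μ hμ) (hU.mean μ hμ)
    hτ hη₁ hC hM₂ hsv₁ hε₂
  obtain ⟨F, hF, hHF, hFle⟩ := hH₁m.add hH₂m
  refine (sqrt_mul_regret_le hr hsel hF fun y => (hcond y).mono (fun w => le_rfl) (hHF y)).trans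
    (hFle.trans ?_)
  rw [Finset.sum_const, Finset.card_univ, Fintype.card_fin, nsmul_eq_mul]
  have : √(ρ * T / 2) ≤ √(pilotSize K r T : ℝ) := Real.sqrt_le_sqrt hnlow
  have : 0 < √(ρ * T / 2) := Real.sqrt_pos.2 (by positivity)
  gcongr

lemma exists_mul_le (c : ℝ) {w u : ℝ} (hw : 0 < w) (hu : 0 < u) :
    ∃ x, 0 < x ∧ x ≤ u ∧ c * x ≤ w := by
  refine ⟨min u (w / (|c| + 1)), lt_min hu (by positivity), min_le_left _ _, ?_⟩
  calc c * min u (w / (|c| + 1)) ≤ (|c| + 1) * (w / (|c| + 1)) :=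
        mul_le_mul (by linarith [le_abs_self c]) (min_le_right _ _)
          (le_min hu.le (by positivity)) (by positivity)
    _ = w := by field_simp

/-- Uniformly in the means, the limit superior of the scaled regret is at most `β + γ * D`. -/
theorem eventually_sqrt_mul_regret_le [NeZero K] {θ₁ θ₂ : ℝ} {v : Fin K → ℝ → ℝ}
    {Q : (Fin K → ℝ) → Measure (Fin K → ℝ)} (hU : IsUniformModel θ₁ θ₂ v Q)
    (hr0 : 0 < r) (hr : r < 1) (hρ : ρ = r / K)
    {sel : (Fin K → ℝ) → Fin K} (hsel : Measurable sel)
    (hsel_max : ∀ (x : Fin K → ℝ) (b : Fin K), x b ≤ x (sel x))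
    (hshare : ∀ m ∈ Icc θ₁ θ₂, ∀ S : Finset (Fin K), 2 ≤ S.card → ∀ a ∈ S,
      ρ ≤ share ρ S (fun b => v b m) a)
    (hle : 3 ≤ K → ∀ m ∈ Icc θ₁ θ₂, ∀ a, ρ ≤ v a m / ∑ b, v b m)
    {β γ l D : ℝ} (hl : 0 ≤ l) (hβ : 0 ≤ β) (hγ : 0 ≤ γ)
    (htan : ∀ t, t ≤ β + γ * Real.exp (l * t))
    (hD : ∀ m ∈ Icc θ₁ θ₂, ∀ star, ∑ b ∈ Finset.univ.erase star,
      (Real.exp (l ^ 2 / 2 * ((√(v b m) + √(v star m)) ^ 2 / (1 - ((K : ℝ) - 2) * ρ))) +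
        if 3 ≤ K then 2 * Real.exp (5 / 4 * l ^ 2 * ∑ a, v a m) else 0) ≤ D)
    {ω₀ : ℝ} (hω₀ : 0 < ω₀) :
    ∀ᶠ T : ℕ in atTop, ∀ μ ∈ Set.univ.pi (fun _ : Fin K => Icc θ₁ θ₂),
      √T * regret r sel T (Q μ) μ ≤ β + γ * D + ω₀ := by
  have hK : (0 : ℝ) < K := by exact_mod_cast Nat.pos_of_ne_zero (NeZero.ne K)
  have hρ0 : 0 < ρ := by rw [hρ]; positivity
  have hKρ : K * ρ < 1 := by rw [hρ, mul_div_cancel₀ _ hK.ne']; exact hr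
  obtain ⟨s₀, s₁, hs₀, hs₁, hsb⟩ := hU.exists_bounds
  set w := ω₀ / 10 with hw
  have hw0 : 0 < w := by positivity
  -- The parameters are chosen one after the other, each small depending on the previous ones.
  obtain ⟨x, hx0, -, hx⟩ := exists_mul_le (γ * D) hw0 one_pos
  set ω := Real.log (1 + x) / 2 with hω
  have hω0 : 0 < ω := half_pos (Real.log_pos (by linarith))
  have hexp : Real.exp (2 * ω) = 1 + x := by
    rw [hω, mul_div_cancel₀ _ two_ne_zero, Real.exp_log (by linarith)]
  obtain ⟨e, he0, -, he⟩ := exists_mul_le (2 * K / ρ) hw0 one_pos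
  obtain ⟨M, hM0, hM⟩ := hU.tail_le (e ^ 2) (by positivity)
  obtain ⟨τ, hτ0, -, hτ⟩ := exists_mul_le (16 * K ^ 2 / ρ ^ 2 * s₁) hw0 one_pos
  obtain ⟨c, hc0, hc1, hc⟩ := exists_mul_le (1 / (4 * τ) * (K * s₁)) hw0 one_pos
  obtain ⟨Λ', hΛ0, -, hΛ⟩ := exists_mul_le (8 * K ^ 2 / ρ ^ 2 * ((1 / c) ^ 2 + s₁)) hw0 one_pos
  obtain ⟨κ, hκ0, -, hκ⟩ := exists_mul_le (K / ρ ^ 2 * (2 * (1 / c) ^ 2 + 2 * s₁)) hw0 one_pos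
  obtain ⟨δ, hδ0, hδ1, hδ⟩ := exists_mul_le
    (l ^ 2 / ρ ^ 2 * (2 * (s₁ + 1)) + K / ρ ^ 2 * (2 / κ))
    (lt_min (div_pos hω0 three_pos) hw0) one_pos
  obtain ⟨θ, hθ0, hθ1, hθ⟩ := exists_mul_le (l ^ 2 / ρ ^ 2 * s₁) (div_pos hω0 three_pos) one_pos
  obtain ⟨ηd, hηd0, hηd⟩ := exists_drawProb_modulus (K := K) (s₁ := s₁) hKρ hs₀ (half_pos hδ0)
  obtain ⟨η, hη0, hηle, hη⟩ := exists_mul_le (l ^ 2 / ρ ^ 2 * 2) (div_pos hω0 three_pos)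
    (u := min 1 (min (s₀ / 2) (ηd / 2))) (by positivity)
  have hη1 : η ≤ 1 := hηle.trans (min_le_left _ _)
  have hηs : η ≤ s₀ / 2 := hηle.trans ((min_le_right _ _).trans (min_le_left _ _))
  have hηη : 2 * η ≤ ηd := by
    linarith [hηle.trans ((min_le_right _ _).trans (min_le_right _ _))]
  obtain ⟨d, hd0, hd⟩ := hU.exists_modulus hη0
  obtain ⟨ε₂, hε₂0, -, hε₂⟩ := exists_mul_le (1 / (4 * τ) * (K * 2 / (η / 4))) hw0 one_pos
  obtain ⟨M₂, hM₂0, hM₂⟩ := hU.tail_le ε₂ hε₂0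
  have hδa : l ^ 2 / ρ ^ 2 * (2 * (s₁ + 1)) * δ ≤ ω / 3 := by
    have h1 : 0 ≤ K / ρ ^ 2 * (2 / κ) * δ := by positivity
    have h2 := hδ.trans (min_le_left _ _)
    linarith only [h1, h2]
  have hδb : K / ρ ^ 2 * (2 / κ) * δ ≤ w := by
    have h1 : 0 ≤ l ^ 2 / ρ ^ 2 * (2 * (s₁ + 1)) * δ := by positivity
    have h2 := hδ.trans (min_le_right _ _)
    linarith only [h1, h2]
  have hωle : l ^ 2 / ρ ^ 2 * (s₁ * θ + 2 * η + 2 * δ * (s₁ + η)) ≤ ω := by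
    have : l ^ 2 / ρ ^ 2 * (2 * δ * (s₁ + η)) ≤ l ^ 2 / ρ ^ 2 * (2 * δ * (s₁ + 1)) := by gcongr
    linarith only [this, hδa, hθ, hη]
  -- The conditions on the horizon.
  have tT : Tendsto (fun T : ℕ => (T : ℝ)) atTop atTop := tendsto_natCast_atTop_atTop
  have tS : Tendsto (fun T : ℕ => √(T : ℝ)) atTop atTop := Real.tendsto_sqrt_atTop.comp tT
  have tL : Tendsto (fun T : ℕ => √(Real.log T)) atTop atTop :=
    Real.tendsto_sqrt_atTop.comp (Real.tendsto_log_atTop.comp tT)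
  have tLT : Tendsto (fun T : ℕ => Real.log T / T) atTop (𝓝 0) :=
    (Real.isLittleO_log_id_atTop.tendsto_div_nhds_zero).comp tT
  have c1 : ∀ᶠ T : ℕ in atTop, 4 ≤ ρ * T := (tT.const_mul_atTop hρ0).eventually_ge_atTop 4
  have c2 : ∀ᶠ T : ℕ in atTop, Real.exp (l * (2 * M) / (ρ * √T)) ≤ 1 + θ := by
    have h1 : Tendsto (fun T : ℕ => l * (2 * M) / (ρ * √T)) atTop (𝓝 0) :=
      (tS.const_mul_atTop hρ0).const_div_atTop _
    have h2 := (Real.continuous_exp.tendsto 0).comp h1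
    rw [Real.exp_zero] at h2
    exact h2.eventually_le_const (by linarith)
  have c3 : ∀ᶠ T : ℕ in atTop, (1 + K) / (T : ℝ) ≤ δ / 2 :=
    (tT.const_div_atTop _).eventually_le_const (by positivity)
  have c4 : ∀ᶠ T : ℕ in atTop, 2 * (s₁ + 2 * (1 / c) ^ 2 / ρ) / (ρ * T / 2) ≤ η / 2 :=
    (((tT.const_mul_atTop hρ0).atTop_div_const two_pos).const_div_atTop _).eventually_le_const
      (by positivity)
  have c5 : ∀ᶠ T : ℕ in atTop,
      1 / Λ' + 4 * (1 / c) / ρ ≤ 2 * (√(Real.log T) * √(s₀ / 2)) :=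
    ((tL.atTop_mul_const (Real.sqrt_pos.2 (half_pos hs₀))).const_mul_atTop
      two_pos).eventually_ge_atTop _
  have c6 : ∀ᶠ T : ℕ in atTop,
      2 * (√(Real.log T / (ρ * T / 2)) * √(s₁ + 1)) + 4 * (1 / c) / ρ / √T ≤ d := by
    have h1 : Tendsto (fun T : ℕ => 2 / ρ * (Real.log T / T)) atTop (𝓝 (2 / ρ * 0)) :=
      tLT.const_mul _
    have h2 := (((Real.continuous_sqrt.tendsto _).comp h1).mul_const (√(s₁ + 1))).const_mul 2
    have h3 := h2.add (tS.const_div_atTop (4 * (1 / c) / ρ))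
    simp only [mul_zero, Real.sqrt_zero, zero_mul, add_zero] at h3
    filter_upwards [h3.eventually_le_const hd0] with T hT
    have e1 : Real.log T / (ρ * T / 2) = 2 / ρ * (Real.log T / T) := by field_simp
    rw [e1]
    exact hT
  have c7 : ∀ᶠ T : ℕ in atTop, K / ρ ^ 2 * (2 / κ) / (T : ℝ) ≤ w :=
    (tT.const_div_atTop _).eventually_le_const hw0
  have c8 : ∀ᶠ T : ℕ in atTop,
      1 / (4 * τ) * (K * M₂ ^ 2 / (η / 4)) / √(ρ * T / 2) ≤ w :=
    ((Real.tendsto_sqrt_atTop.comp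
      ((tT.const_mul_atTop hρ0).atTop_div_const two_pos)).const_div_atTop _).eventually_le_const hw0
  filter_upwards [c1, c2, c3, c4, c5, c6, c7, c8] with T c1 c2 c3 c4 c5 c6 c7 c8 μ hμ
  refine (sqrt_mul_regret_le_of_horizon hU hμ hr0 hr hρ hsel hsel_max hs₀ hsb hshare hle
    (Λ := 1 / Λ') (C := 1 / c) (η₁ := η / 4) (δ₁ := δ / 2) (one_div_pos.2 hΛ0) hl hM0.le hβ hγ hκ0
    htan hD (hM μ hμ) (one_div_pos.2 hc0) hθ0.le hθ1 hη0.le hη1 hηs hδ0.le c2 hωle hd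
    (fun S a hS s s' hs hss => hηd S a hS s s' hs fun b hb => (hss b hb).trans hηη)
    (by linarith only [c3]) c1 (by linarith only [c4]) c5 c6 (by positivity) hτ0 hM₂0.le
    (hM₂ μ hμ)).trans ?_
  rw [hexp, Real.sqrt_sq he0.le]
  have b1 : 8 * K ^ 2 / (ρ ^ 2 * (1 / Λ')) * ((1 / c) ^ 2 + s₁) ≤ w := by
    refine le_trans (le_of_eq ?_) hΛ
    field_simp
  have b2 : K * (e / ρ) + K * e / ρ ≤ w := by
    refine le_trans (le_of_eq ?_) he
    ring
  have b3 : K * ((κ * (2 * (1 / c) ^ 2 + 2 * s₁) + (2 / T + 2 * δ ^ 2) / κ) / ρ ^ 2) ≤ 3 * w := by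
    have h1 : K / ρ ^ 2 * (2 / κ) * δ ^ 2 ≤ K / ρ ^ 2 * (2 / κ) * δ :=
      mul_le_mul_of_nonneg_left (pow_le_of_le_one hδ0.le hδ1 two_ne_zero) (by positivity)
    calc _ = K / ρ ^ 2 * (2 * (1 / c) ^ 2 + 2 * s₁) * κ + K / ρ ^ 2 * (2 / κ) / (T : ℝ) +
          K / ρ ^ 2 * (2 / κ) * δ ^ 2 := by ring
      _ ≤ 3 * w := by linarith only [h1, hκ, c7, hδb]
  have b4 : 1 / (4 * τ) * (K * (s₁ / (1 / c) ^ 2 +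
      (M₂ ^ 2 / √(ρ * T / 2) + 2 * ε₂) / (η / 4))) ≤ 3 * w := by
    have h1 : 1 / (4 * τ) * (K * s₁) * c ^ 2 ≤ 1 / (4 * τ) * (K * s₁) * c :=
      mul_le_mul_of_nonneg_left (pow_le_of_le_one hc0.le hc1 two_ne_zero) (by positivity)
    calc _ = 1 / (4 * τ) * (K * s₁) * c ^ 2 +
          1 / (4 * τ) * (K * M₂ ^ 2 / (η / 4)) / √(ρ * T / 2) +
          1 / (4 * τ) * (K * 2 / (η / 4)) * ε₂ := by
          rw [one_div, one_div, inv_pow, div_inv_eq_mul]; ring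
      _ ≤ 3 * w := by linarith only [h1, hc, c8, hε₂]
  have b5 : τ * (16 * K ^ 2 / ρ ^ 2 * s₁) ≤ w := by rw [mul_comm]; exact hτ
  have b6 : γ * ((1 + x) * D) ≤ γ * D + w := by
    calc _ = γ * D + γ * D * x := by ring
      _ ≤ _ := by linarith only [hx]
  have b7 : 10 * w = ω₀ := by rw [hw]; ring
  linarith only [b1, b2, b3, b4, b5, b6, b7]

end LargeHorizon

/-! ### The limit superior of the worst case -/

section Limsup

variable {K : ℕ} {r : ℝ} {sel : (Fin K → ℝ) → Fin K} {θ₁ θ₂ : ℝ} {v : Fin K → ℝ → ℝ}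
  {Q : (Fin K → ℝ) → Measure (Fin K → ℝ)}

/-- A uniform eventual bound for real numbers, as a bound in the extended reals. -/
lemma worstCaseLimsup_le {B : ℝ}
    (h : ∀ ω > 0, ∀ᶠ T : ℕ in atTop, ∀ μ ∈ Set.univ.pi (fun _ : Fin K => Icc θ₁ θ₂),
      √T * regret r sel T (Q μ) μ ≤ B + ω) : worstCaseLimsup r sel θ₁ θ₂ Q ≤ (B : EReal) := by
  refine EReal.le_of_forall_lt_iff_le.1 fun x hx => ?_
  rw [EReal.coe_lt_coe_iff] at hx
  refine limsup_le_of_le (by isBoundedDefault) ?_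
  filter_upwards [h (x - B) (sub_pos.2 hx)] with T hT
  refine iSup₂_le fun μ hμ => EReal.coe_le_coe_iff.2 ?_
  have := hT μ hμ
  linarith

lemma coe_le_coe_mul_iSup {f : ℝ → ℝ} {m B c : ℝ} (hc : 0 ≤ c) (hm : m ∈ Icc θ₁ θ₂)
    (h : B ≤ c * f m) : (B : EReal) ≤ (c : EReal) * ⨆ m ∈ Icc θ₁ θ₂, (f m : EReal) :=
  calc (B : EReal) ≤ (c : EReal) * (f m : EReal) := by
        rw [← EReal.coe_mul]; exact EReal.coe_le_coe_iff.2 h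
    _ ≤ _ := mul_le_mul_of_nonneg_left (le_iSup₂ (f := fun m (_ : m ∈ Icc θ₁ θ₂) => (f m : EReal))
        m hm) (EReal.coe_nonneg.2 hc)

/-- For two arms the exponential is compared with the line through the origin that touches it. -/
theorem worstCaseLimsup_le_of_two {v : Fin 2 → ℝ → ℝ} {Q : (Fin 2 → ℝ) → Measure (Fin 2 → ℝ)}
    {sel : (Fin 2 → ℝ) → Fin 2} (hU : IsUniformModel θ₁ θ₂ v Q) (hθ : θ₁ < θ₂)
    (hr0 : 0 < r) (hr : r < 1) (hsel : Measurable sel)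
    (hsel_max : ∀ (x : Fin 2 → ℝ) (b : Fin 2), x b ≤ x (sel x))
    (h : ∀ m ∈ Icc θ₁ θ₂, ∀ a, r / (2 : ℕ) ≤ √(v a m) / ∑ b, √(v b m)) :
    worstCaseLimsup r sel θ₁ θ₂ Q ≤ ((1 / √(Real.exp 1) : ℝ) : EReal) *
      ⨆ m ∈ Icc θ₁ θ₂, ((∑ a, √(v a m) : ℝ) : EReal) := by
  have hcont : ContinuousOn (fun m => ∑ a, √(v a m)) (Icc θ₁ θ₂) :=
    continuousOn_finsetSum _ fun a _ => (hU.cont a).sqrt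
  obtain ⟨m₀, hm₀, hmax⟩ := isCompact_Icc.exists_isMaxOn (nonempty_Icc.2 hθ.le) hcont
  set F := ∑ a, √(v a m₀) with hF
  have hF0 : 0 < F := Finset.sum_pos (fun a _ => Real.sqrt_pos.2 (hU.pos a m₀ hm₀)) ⟨0, by simp⟩
  have hshare : ∀ m ∈ Icc θ₁ θ₂, ∀ S : Finset (Fin 2), 2 ≤ S.card → ∀ a ∈ S,
      r / (2 : ℕ) ≤ share (r / (2 : ℕ)) S (fun b => v b m) a := by
    intro m hm S hS a _
    have hcard : S.card = 2 := le_antisymm (by simpa using S.card_le_univ) hS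
    have hSu : S = Finset.univ := Finset.eq_univ_of_card S (by simpa using hcard)
    simp only [share, scale, hcard, if_true, Nat.cast_ofNat, sub_self, zero_mul, sub_zero, mul_one]
    rw [hSu]
    exact h m hm a
  have key := fun ω (hω : (0 : ℝ) < ω) =>
    eventually_sqrt_mul_regret_le hU hr0 hr rfl hsel hsel_max hshare
    (fun h3 => absurd h3 (by norm_num)) (β := 0) (γ := F * Real.exp (-1)) (l := 1 / F)
    (D := Real.exp (1 / 2)) (by positivity) le_rfl (by positivity)
    (fun t => by
      have h1 := Real.add_one_le_exp (1 / F * t - 1)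
      rw [sub_add_cancel, sub_eq_add_neg, Real.exp_add] at h1
      calc t = F * (1 / F * t) := by field_simp
        _ ≤ F * (Real.exp (1 / F * t) * Real.exp (-1)) := by gcongr
        _ = _ := by ring)
    (fun m hm star => by
      have hm' : ∑ a, √(v a m) ≤ F := hmax hm
      have hb : ∀ b ∈ Finset.univ.erase star, √(v b m) + √(v star m) = ∑ a, √(v a m) := by
        intro b hb
        have hne := Finset.ne_of_mem_erase hb
        rw [← Finset.sum_pair hne (f := fun a => √(v a m)),
          Finset.eq_univ_of_card {b, star} (by rw [Finset.card_pair hne]; simp)]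
      have hcard : (Finset.univ.erase star).card = 1 := by simp
      obtain ⟨b, hbe⟩ := Finset.card_eq_one.1 hcard
      rw [hbe, Finset.sum_singleton, if_neg (by norm_num), add_zero,
        hb b (by rw [hbe]; simp)]
      refine Real.exp_le_exp.2 ?_
      have h0 : 0 ≤ ∑ a, √(v a m) := Finset.sum_nonneg fun a _ => Real.sqrt_nonneg _
      calc _ = (1 / F) ^ 2 / 2 * (∑ a, √(v a m)) ^ 2 := by norm_num
        _ ≤ (1 / F) ^ 2 / 2 * F ^ 2 := by gcongr
        _ = 1 / 2 := by field_simp) hω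
  refine (worstCaseLimsup_le key).trans (coe_le_coe_mul_iSup (f := fun m => ∑ a, √(v a m))
    (by positivity) hm₀ (le_of_eq ?_))
  rw [zero_add, mul_assoc, ← Real.exp_add, ← hF, ← Real.exp_half, one_div (Real.exp _),
    ← Real.exp_neg, mul_comm]
  norm_num

/-- For at least three arms the exponential is compared with its tangent at the point where it
equals the bound `A` for the exponential moments. -/
theorem worstCaseLimsup_le_of_three_le (hK : 3 ≤ K) (hU : IsUniformModel θ₁ θ₂ v Q) (hθ : θ₁ < θ₂)
    (hr0 : 0 < r) (hr : r < 1) (hsel : Measurable sel)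
    (hsel_max : ∀ (x : Fin K → ℝ) (b : Fin K), x b ≤ x (sel x))
    (h : ∀ m ∈ Icc θ₁ θ₂, ∀ a, r / K ≤ v a m / ∑ b, v b m) :
    worstCaseLimsup r sel θ₁ θ₂ Q ≤ ((2 * (1 + ((K : ℝ) - 1) / K) : ℝ) : EReal) *
      ⨆ m ∈ Icc θ₁ θ₂, ((√((∑ a, v a m) * Real.log K) : ℝ) : EReal) := by
  have : NeZero K := ⟨by omega⟩
  have hK3 : (3 : ℝ) ≤ K := by exact_mod_cast hK
  have hK0 : (0 : ℝ) < K := by linarith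
  have hρ0 : 0 < r / K := by positivity
  have hKρ : K * (r / K) < 1 := by rwa [mul_div_cancel₀ _ hK0.ne']
  have hcont : ContinuousOn (fun m => ∑ a, v a m) (Icc θ₁ θ₂) :=
    continuousOn_finsetSum _ fun a _ => hU.cont a
  obtain ⟨m₀, hm₀, hmax⟩ := isCompact_Icc.exists_isMaxOn (nonempty_Icc.2 hθ.le) hcont
  set V := ∑ a, v a m₀ with hV
  have hV0 : 0 < V := Finset.sum_pos (fun a _ => hU.pos a m₀ hm₀) ⟨0, by simp⟩
  set L := Real.log K with hL
  have hL0 : 0 < L := Real.log_pos (by linarith)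
  set R := √(V * L) with hR
  have hR0 : 0 < R := Real.sqrt_pos.2 (by positivity)
  have hR2 : R ^ 2 = V * L := Real.sq_sqrt (by positivity)
  -- This is nearly the minimiser of `(2 * L + 5 / 4 * l ^ 2 * V) / l`, the bound obtained below.
  set l := 5 / 4 * (R / V) with hl
  have hl0 : 0 < l := by positivity
  have hlV : l ^ 2 * V = 25 / 16 * L := by
    rw [hl, mul_pow, div_pow R, hR2]; field_simp; norm_num
  have hlR : l * R = 5 / 4 * L := by
    rw [hl, mul_assoc, div_mul_eq_mul_div R, ← sq, hR2, mul_div_cancel_left₀ L hV0.ne']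
  set A := 3 * ((K : ℝ) - 1) * Real.exp (5 / 4 * (l ^ 2 * V)) with hA
  have hK1 : 0 < 3 * ((K : ℝ) - 1) := by linarith
  have hA0 : 0 < A := by positivity
  have hlogA : Real.log A = Real.log (3 * ((K : ℝ) - 1)) + 5 / 4 * (l ^ 2 * V) := by
    rw [hA, Real.log_mul hK1.ne' (Real.exp_pos _).ne', Real.log_exp]
  have hlog1 : 1 ≤ Real.log A := by
    have h1 : 1 ≤ Real.log (3 * ((K : ℝ) - 1)) := by
      rw [Real.le_log_iff_exp_le hK1]
      linarith [Real.exp_one_lt_d9]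
    have h2 : 0 ≤ 5 / 4 * (l ^ 2 * V) := by positivity
    linarith
  have hlog2 : Real.log (3 * ((K : ℝ) - 1)) ≤ 2 * L := by
    have h1 : 2 * L = Real.log ((K : ℝ) ^ 2) := by rw [Real.log_pow, Nat.cast_ofNat]
    rw [h1]
    exact Real.log_le_log hK1 (by nlinarith)
  have key := fun ω (hω : (0 : ℝ) < ω) => eventually_sqrt_mul_regret_le hU hr0 hr rfl hsel hsel_max
    (fun m hm S hS a ha => le_share hρ0 hKρ (fun a => hU.pos a m hm) (h m hm) hS ha)
    (fun _ => h) (β := (Real.log A - 1) / l) (γ := 1 / (l * A)) (l := l) (D := A) hl0.le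
    (div_nonneg (by linarith) hl0.le) (by positivity)
    (fun t => by
      have h1 := Real.add_one_le_exp (l * t - Real.log A)
      rw [Real.exp_sub, Real.exp_log hA0] at h1
      have h2 : l * ((Real.log A - 1) / l + 1 / (l * A) * Real.exp (l * t)) =
          Real.log A - 1 + Real.exp (l * t) / A := by field_simp
      refine le_of_mul_le_mul_left ?_ hl0
      rw [h2]
      linarith)
    (fun m hm star => by
      have hm' : ∑ a, v a m ≤ V := hmax hm
      have hpos : 0 ≤ ∑ a, v a m := Finset.sum_nonneg fun a _ => (hU.pos a m hm).le
      have hl2 : l ^ 2 * ∑ a, v a m ≤ l ^ 2 * V := by gcongr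
      have hl20 : 0 ≤ l ^ 2 * ∑ a, v a m := by positivity
      have hcard : ((Finset.univ.erase star).card : ℝ) = K - 1 := by
        rw [Finset.card_erase_of_mem (Finset.mem_univ _), Finset.card_univ, Fintype.card_fin,
          Nat.cast_sub (by omega), Nat.cast_one]
      calc _ ≤ ∑ _b ∈ Finset.univ.erase star, 3 * Real.exp (5 / 4 * (l ^ 2 * V)) := by
            refine Finset.sum_le_sum fun b hb => ?_
            rw [if_pos hK]
            have h1 := pair_variance_le hρ0 hKρ (fun a => hU.pos a m hm) (h m hm)
              (Finset.ne_of_mem_erase hb)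
            have h2 := mul_le_mul_of_nonneg_left h1 (show 0 ≤ l ^ 2 / 2 by positivity)
            have h3 := Real.exp_le_exp.2 (show l ^ 2 / 2 * ((√(v b m) + √(v star m)) ^ 2 /
              (1 - ((K : ℝ) - 2) * (r / K))) ≤ 5 / 4 * (l ^ 2 * V) by linarith)
            have h4 := Real.exp_le_exp.2 (show 5 / 4 * l ^ 2 * ∑ a, v a m ≤ 5 / 4 * (l ^ 2 * V) by
              linarith)
            linarith
        _ = A := by rw [Finset.sum_const, nsmul_eq_mul, hcard, hA]; ring) hω
  have hc : 10 / 3 ≤ 2 * (1 + ((K : ℝ) - 1) / K) := by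
    have : 2 / 3 ≤ ((K : ℝ) - 1) / K := by rw [div_le_div_iff₀ three_pos hK0]; linarith
    linarith
  refine (worstCaseLimsup_le key).trans (coe_le_coe_mul_iSup
    (f := fun m => √((∑ a, v a m) * Real.log K)) (by linarith) hm₀ ?_)
  have e : (Real.log A - 1) / l + 1 / (l * A) * A = Real.log A / l := by field_simp; ring
  rw [e, div_le_iff₀ hl0]
  calc Real.log A ≤ 10 / 3 * (l * R) := by rw [hlR, hlogA, hlV]; linarith
    _ ≤ 2 * (1 + ((K : ℝ) - 1) / K) * (l * R) := by gcongr
    _ = _ := by ring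

end Limsup

end TSEBA

theorem mainTheorem3 (K : ℕ)
    (𝒴 : Set ℝ) (h𝒴 : MeasurableSet 𝒴)
    (θ₁ θ₂ : ℝ) (hθ : θ₁ < θ₂)
    (v : Fin K → ℝ → ℝ) (P : Fin K → ℝ → Measure ℝ)
    (hP : TSEBA.IsBanditModel 𝒴 θ₁ θ₂ v P)
    (Q : (Fin K → ℝ) → Measure (Fin K → ℝ))
    (hQ : ∀ μ ∈ Set.univ.pi (fun _ : Fin K => Icc θ₁ θ₂), ∀ a,
      (Q μ).map (fun y => y a) = P a (μ a))
    (r : ℝ) (hr : r ∈ Ioo (0 : ℝ) 1)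
    (sel : (Fin K → ℝ) → Fin K) (hsel : Measurable sel)
    (hsel_max : ∀ (x : Fin K → ℝ) (b : Fin K), x b ≤ x (sel x)) :
    (K = 2 →
      (∀ m ∈ Icc θ₁ θ₂, ∀ a, r / K ≤ √(v a m) / ∑ b, √(v b m)) →
      TSEBA.worstCaseLimsup r sel θ₁ θ₂ Q ≤
        ((1 / √(Real.exp 1) : ℝ) : EReal) *
          ⨆ m ∈ Icc θ₁ θ₂, ((∑ a, √(v a m) : ℝ) : EReal)) ∧
    (3 ≤ K →
      (∀ m ∈ Icc θ₁ θ₂, ∀ a, r / K ≤ v a m / ∑ b, v b m) →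
      TSEBA.worstCaseLimsup r sel θ₁ θ₂ Q ≤
        ((2 * (1 + ((K : ℝ) - 1) / K) : ℝ) : EReal) *
          ⨆ m ∈ Icc θ₁ θ₂, ((√((∑ a, v a m) * Real.log K) : ℝ) : EReal)) := by
  constructor
  · intro hK h
    subst hK
    exact TSEBA.worstCaseLimsup_le_of_two (hP.isUniformModel h𝒴 hQ) hθ hr.1 hr.2 hsel hsel_max h
  · intro hK h
    have : NeZero K := ⟨by omega⟩
    exact TSEBA.worstCaseLimsup_le_of_three_le hK (hP.isUniformModel h𝒴 hQ) hθ hr.1 hr.2 hsel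
      hsel_max h
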